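/- Let $n\ge 1$, let $v(x)={}^t x V x$ be a real quadratic form on $\mathbb{R}^n$ ($V$ a real symmetric matrix) and let $B\in M_n(\mathbb{R})$ be skew-symmetric. Write $B=L+U$ with $L$ strictly lower and $U$ strictly upper triangular, identify quadratic forms with their symmetric matrices, let $J=\begin{pmatrix}0&I_n\\-I_n&0\end{pmatrix}$, let $|\cdot|$ be the operator norm on $M_n(\mathbb{R})$ associated with the Euclidean norm, and let $e_1,\dots,e_n$ be the canonical basis of $\mathbb{R}^n$. Non-commutative products are taken in increasing order of the index, from left to right. There exist $t_0>0$ and, depending analytically on $t\in(-t_0,t_0)$, real symmetric matrices $A_t$, $V_t^{(r)}$, a diagonal matrix $V_t^{(\ell)}$, a strictly upper triangular matrix $U_t$ and a strictly lower triangular matrix $L_t$ (all in $M_n(\mathbb{R})$) such that, with $a_t,v_t^{(r)},v_t^{(\ell)}$ the quadratic forms of matrices $A_t,V_t^{(r)},V_t^{(\ell)}$, for all $t\in(-t_0,t_0)$, as operators on $L^2(\mathbb{R}^n)$, $$e^{it(\Delta/2-v(x))-tBx\cdot\nabla}=e^{-itv_t^{(\ell)}(x)}\Big(\prod_{j=1}^{n-1}e^{-t(U_tx)_j\partial_{x_j}}\Big)e^{ita_t(\nabla)}\Big(\prod_{j=2}^{n}e^{-t(L_tx)_j\partial_{x_j}}\Big)e^{-itv_t^{(r)}(x)},$$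 where the left-hand side is the strongly continuous group generated by $i(\Delta/2-v)-Bx\cdot\nabla$ with its maximal domain in $L^2(\mathbb{R}^n)$, and $a_t(\nabla)$ is the Fourier multiplier of symbol $-a_t(\xi)$; and moreover the following holds. For $t\neq 0$ define by induction on $k\ge 0$, starting from $(A_{t,0},L_{t,0},U_{t,0},V^{(m)}_{t,0})=(I_n/2,L,U,V)$, $$A_{t,k+1}=A_{t,k}+\tfrac12 I_n-\widetilde A_{t,k},\quad L_{t,k+1}=L_{t,k}+L-\widetilde L_{t,k},\quad U_{t,k+1}=U_{t,k}+U-\widetilde U_{t,k},$$ $$V^{(m)}_{t,k+1}=V^{(m)}_{t,k}+V-\widetilde V^{(m)}_{t,k}+\tfrac t2[D_{t,k},B]+\tfrac{t^2}2D_{t,k}^2,$$ where $\widetilde A_{t,k},\widetilde V^{(m)}_{t,k}$ are symmetric, $\widetilde L_{t,k}$ is strictly lower triangular, $\widetilde U_{t,k}$ is strictly upper triangular, $D_{t,k}$ is diagonal, and $$\begin{pmatrix}2\widetilde V^{(m)}_{t,k}&{}^t\widetilde L_{t,k}+{}^t\widetilde U_{t,k}+tD_{t,k}\\ \widetilde L_{t,k}+\widetilde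 U_{t,k}+tD_{t,k}&2\widetilde A_{t,k}\end{pmatrix}=-t^{-1}J\log(P_{t,k}),$$ $$P_{t,k}=\Big[\prod_{j=1}^{n-1}\begin{pmatrix}I_n+tU^{(j)}_{t,k}&0\\0&I_n-t\,{}^tU^{(j)}_{t,k}\end{pmatrix}\Big]\begin{pmatrix}I_n&2tA_{t,k}\\0&I_n\end{pmatrix}\Big[\prod_{j=2}^{n}\begin{pmatrix}I_n+tL^{(j)}_{t,k}&0\\0&I_n-t\,{}^tL^{(j)}_{t,k}\end{pmatrix}\Big]\begin{pmatrix}I_n&0\\-2tV^{(m)}_{t,k}&I_n\end{pmatrix},$$ with $U^{(j)}_{t,k}=(e_j\otimes e_j)U_{t,k}$, $L^{(j)}_{t,k}=(e_j\otimes e_j)L_{t,k}$, and $\log P=\sum_{m\ge1}\frac{(-1)^{m+1}}{m}(P-I_{2n})^m$. There exists $\tau_0\in(0,t_0)$ such that, if $0<|t|<\tau_0$, these sequences are well defined (for every $k$ the series defining $\log P_{t,k}$ converges and $-t^{-1}J\log P_{t,k}$ is symmetric, hence has the block form above), and for every $k\ge0$ $$|A_t-A_{t,k}|+|L_t-L_{t,k}|+|U_t-U_{t,k}|+\big|V_t^{(\ell)}+\tfrac12D_{t,k}\big|+\big|V_t^{(r)}-V^{(m)}_{t,k}-\tfrac12D_{t,k}\big|\le\Big(\frac{|t|}{\tau_0}\Big)^k.$$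 -/

import Mathlib

open MeasureTheory SchwartzMap LineDeriv Laplacian FourierTransform
open scoped ENNReal Matrix Matrix.Norms.L2Operator

noncomputable section

namespace ExactSplitting

/-! ### The space `L²(ℝⁿ)`, quadratic forms and linear vector fields -/

/-- The Hilbert space `L²(ℝⁿ; ℂ)`. -/
abbrev L2 (n : ℕ) : Type := Lp ℂ 2 (volume : Measure (EuclideanSpace ℝ (Fin n)))

/-- The quadratic form `x ↦ ᵗx M x` on `ℝⁿ`. -/
def quadForm {n : ℕ} (M : Matrix (Fin n) (Fin n) ℝ) (x : EuclideanSpace ℝ (Fin n)) : ℝ :=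
  x.ofLp ⬝ᵥ (M *ᵥ x.ofLp)

/-- The `j`-th coordinate `(M x)_j` of `M x`. -/
def linCoord {n : ℕ} (M : Matrix (Fin n) (Fin n) ℝ) (j : Fin n)
    (x : EuclideanSpace ℝ (Fin n)) : ℝ :=
  (M *ᵥ x.ofLp) j

lemma continuous_quadForm {n : ℕ} (M : Matrix (Fin n) (Fin n) ℝ) : Continuous (quadForm M) := by
  unfold quadForm
  fun_prop

/-! ### The Schrödinger group -/

/-- The differential operator `i (Δ / 2 - v(x)) - B x · ∇`, acting on tempered distributions,
where `v` is the quadratic form of matrix `V`. -/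
def schrodinger {n : ℕ} (V B : Matrix (Fin n) (Fin n) ℝ)
    (u : 𝓢'(EuclideanSpace ℝ (Fin n), ℂ)) : 𝓢'(EuclideanSpace ℝ (Fin n), ℂ) :=
  Complex.I • ((1 / 2 : ℂ) • Δ u
      - TemperedDistribution.smulLeftCLM ℂ (fun x => (quadForm V x : ℂ)) u)
    - ∑ j : Fin n, TemperedDistribution.smulLeftCLM ℂ (fun x => (linCoord B j x : ℂ))
        (∂_{EuclideanSpace.single j (1 : ℝ)} u)

/-- `S` is the strongly continuous one-parameter group `t ↦ e^{tG}` on `L²(ℝⁿ)`, where the operator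
`G` on tempered distributions is realized on `L²(ℝⁿ)` with its maximal domain
`{u ∈ L² | G u ∈ L²}`: the infinitesimal generator of `S` is exactly this realization. -/
structure IsGroupGeneratedBy {n : ℕ}
    (G : 𝓢'(EuclideanSpace ℝ (Fin n), ℂ) → 𝓢'(EuclideanSpace ℝ (Fin n), ℂ))
    (S : ℝ → (L2 n →L[ℂ] L2 n)) : Prop where
  zero : S 0 = 1
  add : ∀ s t : ℝ, S (s + t) = S s * S t
  continuous : ∀ u : L2 n, Continuous fun t => S t u
  generator : ∀ u w : L2 n, HasDerivAt (fun t => S t u) w 0 ↔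
    (w : 𝓢'(EuclideanSpace ℝ (Fin n), ℂ)) = G (u : 𝓢'(EuclideanSpace ℝ (Fin n), ℂ))

/-! ### The elementary factors -/

lemma memLp_mul {n : ℕ} (g : EuclideanSpace ℝ (Fin n) → ℂ) (hg : Continuous g)
    (hb : ∀ x, ‖g x‖ ≤ 1) (u : L2 n) :
    MemLp (fun x => g x * u x) 2 (volume : Measure (EuclideanSpace ℝ (Fin n))) := by
  refine (Lp.memLp u).of_le (hg.aestronglyMeasurable.mul (Lp.aestronglyMeasurable u)) ?_
  refine Filter.Eventually.of_forall fun x => ?_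
  rw [norm_mul]
  exact mul_le_of_le_one_left (norm_nonneg _) (hb x)

/-- Multiplication by a continuous function of modulus at most one, `u ↦ g u`. -/
def mulOp {n : ℕ} (g : EuclideanSpace ℝ (Fin n) → ℂ) (hg : Continuous g)
    (hb : ∀ x, ‖g x‖ ≤ 1) : L2 n →L[ℂ] L2 n :=
  LinearMap.mkContinuous
    { toFun := fun u => (memLp_mul g hg hb u).toLp
      map_add' := fun u w => by
        rw [← MemLp.toLp_add]
        refine MemLp.toLp_congr _ _ ?_
        filter_upwards [Lp.coeFn_add u w] with x hx
        simp only [hx, Pi.add_apply, mul_add]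
      map_smul' := fun c u => by
        rw [RingHom.id_apply, ← MemLp.toLp_const_smul]
        refine MemLp.toLp_congr _ _ ?_
        filter_upwards [Lp.coeFn_smul c u] with x hx
        simp only [hx, Pi.smul_apply, smul_eq_mul, mul_left_comm] }
    1 (fun u => by
      rw [one_mul]
      refine Lp.norm_le_norm_of_ae_le ?_
      filter_upwards [(memLp_mul g hg hb u).coeFn_toLp] with x hx
      simp only [LinearMap.coe_mk, AddHom.coe_mk, hx, norm_mul]
      exact mul_le_of_le_one_left (norm_nonneg _) (hb x))

lemma norm_exp_phase_le (θ : ℝ) : ‖Complex.exp (-Complex.I * (θ : ℂ))‖ ≤ 1 := by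
  rw [Complex.norm_exp]
  simp

/-- The operator `e^{-i t v(x)}`: multiplication by the function `x ↦ e^{-i t v(x)}`, where `v` is
the quadratic form of matrix `M`. -/
def phaseOp {n : ℕ} (t : ℝ) (M : Matrix (Fin n) (Fin n) ℝ) : L2 n →L[ℂ] L2 n :=
  mulOp (fun x => Complex.exp (-Complex.I * ((t * quadForm M x : ℝ) : ℂ)))
    (by have := continuous_quadForm M; fun_prop) (fun _ => norm_exp_phase_le _)

/-- The operator `e^{i t a(∇)}`, where `a` is the quadratic form of matrix `M`: the Fourier
multiplier of symbol `ξ ↦ e^{-i t a(ξ)}`. The Fourier transform of Mathlib is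
`𝓕 u (η) = ∫ e^{-2 i π x·η} u(x) dx`, so that the frequency variable is `ξ = 2 π η`. -/
def fourierPhaseOp {n : ℕ} (t : ℝ) (M : Matrix (Fin n) (Fin n) ℝ) : L2 n →L[ℂ] L2 n :=
  ((Lp.fourierTransformₗᵢ (EuclideanSpace ℝ (Fin n)) ℂ).symm.toContinuousLinearEquiv :
      L2 n →L[ℂ] L2 n) *
  mulOp (fun η => Complex.exp (-Complex.I * ((t * quadForm M ((2 * Real.pi) • η) : ℝ) : ℂ)))
    (by have := continuous_quadForm M; fun_prop) (fun _ => norm_exp_phase_le _) *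
  ((Lp.fourierTransformₗᵢ (EuclideanSpace ℝ (Fin n)) ℂ).toContinuousLinearEquiv :
      L2 n →L[ℂ] L2 n)

/-- The linear map `x ↦ e^N x` of `ℝⁿ`. -/
def flowMap {n : ℕ} (N : Matrix (Fin n) (Fin n) ℝ) :
    EuclideanSpace ℝ (Fin n) →ₗ[ℝ] EuclideanSpace ℝ (Fin n) :=
  Matrix.toEuclideanLin (NormedSpace.exp N)

lemma det_flowMap_ne_zero {n : ℕ} (N : Matrix (Fin n) (Fin n) ℝ) :
    LinearMap.det (flowMap N) ≠ 0 := by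
  have h : LinearMap.det (flowMap N) = (NormedSpace.exp N).det := by
    unfold flowMap
    change LinearMap.det (Matrix.toLpLin 2 2 (NormedSpace.exp N)) = _
    rw [Matrix.toLpLin_eq_toLin, LinearMap.det_toLin]
  rw [h]
  exact ((Matrix.isUnit_iff_isUnit_det _).1 (Matrix.isUnit_exp N)).ne_zero

lemma map_flowMap {n : ℕ} (N : Matrix (Fin n) (Fin n) ℝ) :
    Measure.map (flowMap N) (volume : Measure (EuclideanSpace ℝ (Fin n)))
      = ENNReal.ofReal |(LinearMap.det (flowMap N))⁻¹| • volume :=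
  Measure.map_linearMap_addHaar_eq_smul_addHaar _ (det_flowMap_ne_zero N)

lemma quasiMeasurePreserving_flowMap {n : ℕ} (N : Matrix (Fin n) (Fin n) ℝ) :
    Measure.QuasiMeasurePreserving (flowMap N)
      (volume : Measure (EuclideanSpace ℝ (Fin n))) volume := by
  refine ⟨(flowMap N).continuous_of_finiteDimensional.measurable, ?_⟩
  rw [map_flowMap]
  exact Measure.smul_absolutelyContinuous

lemma eLpNorm_comp_flowMap {n : ℕ} (N : Matrix (Fin n) (Fin n) ℝ) (u : L2 n) :
    eLpNorm (fun x => u (flowMap N x)) 2 (volume : Measure (EuclideanSpace ℝ (Fin n)))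
      = ENNReal.ofReal |(LinearMap.det (flowMap N))⁻¹| ^ (1 / (2 : ℝ≥0∞)).toReal
        * eLpNorm u 2 volume := by
  have hm := (flowMap N).continuous_of_finiteDimensional.measurable
  have h1 := eLpNorm_map_measure (p := 2) (g := (u : EuclideanSpace ℝ (Fin n) → ℂ))
    (f := flowMap N) (μ := (volume : Measure (EuclideanSpace ℝ (Fin n))))
    ((Lp.aestronglyMeasurable u).mono_ac (quasiMeasurePreserving_flowMap N).absolutelyContinuous)
    hm.aemeasurable
  rw [map_flowMap, eLpNorm_smul_measure_of_ne_top (by norm_num)] at h1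
  exact h1.symm

lemma memLp_comp_flowMap {n : ℕ} (N : Matrix (Fin n) (Fin n) ℝ) (u : L2 n) :
    MemLp (fun x => u (flowMap N x)) 2 (volume : Measure (EuclideanSpace ℝ (Fin n))) := by
  refine ⟨(Lp.aestronglyMeasurable u).comp_quasiMeasurePreserving
    (quasiMeasurePreserving_flowMap N), ?_⟩
  rw [eLpNorm_comp_flowMap]
  exact ENNReal.mul_lt_top (by finiteness) (Lp.eLpNorm_lt_top u)

/-- The transport operator `e^{N x · ∇}`, given by the method of characteristics:
`u ↦ u ∘ e^N`. -/
def transportOp {n : ℕ} (N : Matrix (Fin n) (Fin n) ℝ) : L2 n →L[ℂ] L2 n :=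
  LinearMap.mkContinuous
    { toFun := fun u => (memLp_comp_flowMap N u).toLp
      map_add' := fun u w => by
        rw [← MemLp.toLp_add]
        refine MemLp.toLp_congr _ _ ?_
        filter_upwards [(quasiMeasurePreserving_flowMap N).ae (Lp.coeFn_add u w)] with x hx
        simp only [hx, Pi.add_apply]
      map_smul' := fun c u => by
        rw [RingHom.id_apply, ← MemLp.toLp_const_smul]
        refine MemLp.toLp_congr _ _ ?_
        filter_upwards [(quasiMeasurePreserving_flowMap N).ae (Lp.coeFn_smul c u)] with x hx
        simp only [hx, Pi.smul_apply] }
    (ENNReal.ofReal |(LinearMap.det (flowMap N))⁻¹| ^ (1 / (2 : ℝ≥0∞)).toReal).toReal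
    (fun u => by
      refine le_of_eq ?_
      change ‖(memLp_comp_flowMap N u).toLp‖ = _
      rw [Lp.norm_toLp, eLpNorm_comp_flowMap, ENNReal.toReal_mul, ← Lp.norm_def])

/-! ### The exact splitting -/

/-- `(e_j ⊗ e_j) M`: the matrix whose `j`-th row is the one of `M` and whose other rows vanish.
Thus `((e_j ⊗ e_j) M x) · ∇ = (M x)_j ∂_{x_j}`. -/
def rowPart {n : ℕ} (j : Fin n) (M : Matrix (Fin n) (Fin n) ℝ) : Matrix (Fin n) (Fin n) ℝ :=
  Matrix.single j j 1 * M

/-- The ordered product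
`e^{-i t v^ℓ(x)} (∏_{j=1}^{n-1} e^{-t (U x)_j ∂_j}) e^{i t a(∇)}
  (∏_{j=2}^{n} e^{-t (L x)_j ∂_j}) e^{-i t v^r(x)}`,
quadratic forms being given by their matrices. -/
def splittingOp {n : ℕ} (t : ℝ) (A L U Vl Vr : Matrix (Fin n) (Fin n) ℝ) : L2 n →L[ℂ] L2 n :=
  phaseOp t Vl
    * ((List.finRange n).dropLast.map fun j => transportOp (-(t • rowPart j U))).prod
    * fourierPhaseOp t A
    * ((List.finRange n).tail.map fun j => transportOp (-(t • rowPart j L))).prod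
    * phaseOp t Vr

/-- The families `A, L, U, Vl, Vr` are the coefficients, analytic on `(-t₀, t₀)`, of an exact
splitting of the group `e^{i t (Δ / 2 - v(x)) - t B x · ∇}`. -/
structure IsExactSplitting {n : ℕ} (V B : Matrix (Fin n) (Fin n) ℝ) (t₀ : ℝ)
    (A L U Vl Vr : ℝ → Matrix (Fin n) (Fin n) ℝ) : Prop where
  analytic_A : AnalyticOnNhd ℝ A (Set.Ioo (-t₀) t₀)
  analytic_L : AnalyticOnNhd ℝ L (Set.Ioo (-t₀) t₀)
  analytic_U : AnalyticOnNhd ℝ U (Set.Ioo (-t₀) t₀)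
  analytic_Vl : AnalyticOnNhd ℝ Vl (Set.Ioo (-t₀) t₀)
  analytic_Vr : AnalyticOnNhd ℝ Vr (Set.Ioo (-t₀) t₀)
  symm_A : ∀ t ∈ Set.Ioo (-t₀) t₀, (A t).IsSymm
  strictLower_L : ∀ t ∈ Set.Ioo (-t₀) t₀, ∀ i j, i ≤ j → L t i j = 0
  strictUpper_U : ∀ t ∈ Set.Ioo (-t₀) t₀, ∀ i j, j ≤ i → U t i j = 0
  diag_Vl : ∀ t ∈ Set.Ioo (-t₀) t₀, (Vl t).IsDiag
  symm_Vr : ∀ t ∈ Set.Ioo (-t₀) t₀, (Vr t).IsSymm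
  splitting : ∃ S : ℝ → (L2 n →L[ℂ] L2 n), IsGroupGeneratedBy (schrodinger V B) S ∧
    ∀ t ∈ Set.Ioo (-t₀) t₀, S t = splittingOp t (A t) (L t) (U t) (Vl t) (Vr t)

/-! ### The iterative method -/

/-- Strictly lower triangular part. -/
def lowerPart {n : ℕ} (M : Matrix (Fin n) (Fin n) ℝ) : Matrix (Fin n) (Fin n) ℝ :=
  Matrix.of fun i j => if j < i then M i j else 0

/-- Strictly upper triangular part. -/
def upperPart {n : ℕ} (M : Matrix (Fin n) (Fin n) ℝ) : Matrix (Fin n) (Fin n) ℝ :=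
  Matrix.of fun i j => if i < j then M i j else 0

/-- The terms of the series `log P = ∑_{m ≥ 0} (-1)^m (P - I)^{m+1} / (m + 1)`. -/
def logTerm {ι : Type} [Fintype ι] [DecidableEq ι] (P : Matrix ι ι ℝ) (m : ℕ) : Matrix ι ι ℝ :=
  ((-1 : ℝ) ^ m / ((m : ℝ) + 1)) • (P - 1) ^ (m + 1)

/-- The logarithm of a matrix, defined by its power series at the identity. It is meaningful when
`Summable (logTerm P)`. -/
def matLog {ι : Type} [Fintype ι] [DecidableEq ι] (P : Matrix ι ι ℝ) : Matrix ι ι ℝ :=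
  ∑' m, logTerm P m

/-- The matrix `J = [[0, I], [-I, 0]]` of the canonical symplectic form. -/
def sympJ (n : ℕ) : Matrix (Fin n ⊕ Fin n) (Fin n ⊕ Fin n) ℝ :=
  Matrix.fromBlocks 0 1 (-1) 0

/-- The unknowns `(A_{t,k}, L_{t,k}, U_{t,k}, V^{(m)}_{t,k})` of the iterative method. -/
structure State (n : ℕ) where
  A : Matrix (Fin n) (Fin n) ℝ
  L : Matrix (Fin n) (Fin n) ℝ
  U : Matrix (Fin n) (Fin n) ℝ
  Vm : Matrix (Fin n) (Fin n) ℝ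

/-- The symplectic factor `[[I + t M, 0], [0, I - t ᵗM]]`. -/
def shearBlock {n : ℕ} (t : ℝ) (M : Matrix (Fin n) (Fin n) ℝ) :
    Matrix (Fin n ⊕ Fin n) (Fin n ⊕ Fin n) ℝ :=
  Matrix.fromBlocks (1 + t • M) 0 0 (1 - t • Mᵀ)

namespace State

variable {n : ℕ}

/-- The matrix `P_{t,k}`. -/
def P (t : ℝ) (s : State n) : Matrix (Fin n ⊕ Fin n) (Fin n ⊕ Fin n) ℝ :=
  ((List.finRange n).dropLast.map fun j => shearBlock t (rowPart j s.U)).prod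
    * Matrix.fromBlocks 1 ((2 * t) • s.A) 0 1
    * ((List.finRange n).tail.map fun j => shearBlock t (rowPart j s.L)).prod
    * Matrix.fromBlocks 1 0 (-((2 * t) • s.Vm)) 1

/-- The matrix `-t⁻¹ J log P_{t,k}`, whose blocks define the quantities below. -/
def H (t : ℝ) (s : State n) : Matrix (Fin n ⊕ Fin n) (Fin n ⊕ Fin n) ℝ :=
  -(t⁻¹ • (sympJ n * matLog (s.P t)))

/-- `Ã_{t,k}`: half of the lower right block. -/
def Atilde (t : ℝ) (s : State n) : Matrix (Fin n) (Fin n) ℝ :=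
  (1 / 2 : ℝ) • (s.H t).toBlocks₂₂

/-- `Ṽ^{(m)}_{t,k}`: half of the upper left block. -/
def Vtilde (t : ℝ) (s : State n) : Matrix (Fin n) (Fin n) ℝ :=
  (1 / 2 : ℝ) • (s.H t).toBlocks₁₁

/-- `L̃_{t,k}`: the strictly lower triangular part of the lower left block. -/
def Ltilde (t : ℝ) (s : State n) : Matrix (Fin n) (Fin n) ℝ :=
  lowerPart (s.H t).toBlocks₂₁

/-- `Ũ_{t,k}`: the strictly upper triangular part of the lower left block. -/
def Utilde (t : ℝ) (s : State n) : Matrix (Fin n) (Fin n) ℝ :=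
  upperPart (s.H t).toBlocks₂₁

/-- `D_{t,k}`: `t⁻¹` times the diagonal part of the lower left block. -/
def D (t : ℝ) (s : State n) : Matrix (Fin n) (Fin n) ℝ :=
  t⁻¹ • Matrix.diagonal (s.H t).toBlocks₂₁.diag

/-- The step `k → k + 1` is well defined: the logarithm of `P_{t,k}` is well defined, the matrix
`-t⁻¹ J log P_{t,k}` is the matrix of a quadratic form, i.e. is symmetric, and it has the announced
block decomposition. -/
structure WellDefined (t : ℝ) (s : State n) : Prop where
  log_summable : Summable (logTerm (s.P t))
  symm : (s.H t).IsSymm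
  blocks : s.H t = Matrix.fromBlocks
    ((2 : ℝ) • s.Vtilde t) ((s.Ltilde t)ᵀ + (s.Utilde t)ᵀ + t • s.D t)
    (s.Ltilde t + s.Utilde t + t • s.D t) ((2 : ℝ) • s.Atilde t)

/-- One step of the iterative method; `L` and `U` are the strictly triangular parts of `B`. -/
def step (V B : Matrix (Fin n) (Fin n) ℝ) (t : ℝ) (s : State n) : State n where
  A := s.A + (1 / 2 : ℝ) • 1 - s.Atilde t
  L := s.L + lowerPart B - s.Ltilde t
  U := s.U + upperPart B - s.Utilde t
  Vm := s.Vm + V - s.Vtilde t + (t / 2) • (s.D t * B - B * s.D t) + (t ^ 2 / 2) • (s.D t) ^ 2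

end State

/-- The sequence `k ↦ (A_{t,k}, L_{t,k}, U_{t,k}, V^{(m)}_{t,k})`. -/
def iter {n : ℕ} (V B : Matrix (Fin n) (Fin n) ℝ) (t : ℝ) : ℕ → State n
  | 0 => ⟨(1 / 2 : ℝ) • 1, lowerPart B, upperPart B, V⟩
  | k + 1 => (iter V B t k).step V B t

end ExactSplitting

end

/-! The proof transfers the operator identity to an identity between symplectic matrices, and solves
the latter by a fixed point argument in the small parameter `t`.

Every factor of the splitting is metaplectic: it is an isometry of `L²` that preserves Schwartz
functions and conjugates the operators `x_j` and `-i∂_j` by a real symplectic matrix. For such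
operators a quadratic Hamiltonian is conjugated exactly, without lower order terms
(`Metaplectic.weyl_comp`). Along a curve of these operators, the same symmetric-form generator `H`
can therefore be read on the operators, `∂ₜT = -iHʷT`, and on the matrices, `∂ₜM = J H M`, and both
readings obey the same product rule (`MetaplecticCurveAt.mul`). If the product of the block matrices
equals `exp(tF)`, with `F` the Hamiltonian field of the Schrödinger operator, then `J H = F`, and
the splitting operator solves the Schrödinger equation on Schwartz functions. Working with
derivatives and starting from the identity at `t = 0` also fixes the phase that the symplectic
matrix alone leaves undetermined. A local isometric solution on a dense invariant space extends to a
unitary group whose generator is the maximal realization of the operator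
(`LocalPropagator.hasDerivAt_extend_iff`). These facts are assembled in
`exists_group_eq_splittingOp`.

For the matrix equation, expand `P = 1 + t W` with `W` polynomial in `t` and the coefficients. To
first order in `t`, the Hamiltonian `-t⁻¹ J log P` has the coefficients themselves as its blocks, so
one step of the method has the form `p ↦ p₀ - t Φ(t, p)` with `Φ` analytic
(`State.Structured.step_eq`). For small `t` this map is a contraction of ratio `C|t|`, which gives
the geometric rate, and the inverse function theorem makes its fixed point analytic in `t`,
including at `t = 0` (`exists_fixedPoint`).

In general `log P` has a diagonal transport part `tD`, which the Schrödinger operator does not have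
because `B` is skew. Conjugation by the phase block of `D/2` removes it, at the price of changing
`V` by `(t/2)[D, B] + (t²/2)D²`; this is the origin of the correction in the recursion and of the
outer phases `-D/2` and `V⁽ᵐ⁾ + D/2` (`State.splittingBlock_eq_exp`). -/

namespace ExactSplitting

/-! ### From a local isometric solution to a unitary group with maximal generator -/

section LocalPropagator

variable {𝓓 𝓗 : Type*} [AddCommGroup 𝓓] [Module ℂ 𝓓] [NormedAddCommGroup 𝓗]
  [InnerProductSpace ℂ 𝓗]

/-- A family of isometries defined near `t = 0` which preserves the range of `ι`, where it solves
the evolution equation `∂ₜ u = G u`. -/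
structure LocalPropagator (ι : 𝓓 →ₗ[ℂ] 𝓗) (G : 𝓓 →ₗ[ℂ] 𝓓) (r : ℝ)
    (T : ℝ → 𝓗 →L[ℂ] 𝓗) : Prop where
  pos : 0 < r
  inj : Function.Injective ι
  dense : DenseRange ι
  isometric : ∀ t, |t| < r → ∀ u, ‖T t u‖ = ‖u‖
  zero : T 0 = 1
  deriv : ∀ t, |t| < r → ∀ φ, ∃ ψ, T t (ι φ) = ι ψ ∧
    HasDerivAt (fun t => T t (ι φ)) (ι (G ψ)) t

namespace LocalPropagator

variable {ι : 𝓓 →ₗ[ℂ] 𝓗} {G : 𝓓 →ₗ[ℂ] 𝓓} {r : ℝ} {T : ℝ → 𝓗 →L[ℂ] 𝓗}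

lemma hasDerivAt_zero (h : LocalPropagator ι G r T) (φ : 𝓓) :
    HasDerivAt (fun t => T t (ι φ)) (ι (G φ)) 0 := by
  obtain ⟨ψ, h1, h2⟩ := h.deriv 0 (by simpa using h.pos) φ
  rw [h.zero, one_apply_eq_self] at h1
  rwa [← h.inj h1] at h2

lemma inner_map (h : LocalPropagator ι G r T) {t : ℝ} (ht : |t| < r) (u v : 𝓗) :
    inner ℂ (T t u) (T t v) = inner ℂ u v :=
  (LinearMap.norm_map_iff_inner_map_map (T t)).1 (h.isometric t ht) u v

lemma eventually_lt (h : LocalPropagator ι G r T) : ∀ᶠ t in nhds (0 : ℝ), |t| < r :=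
  continuous_abs.continuousAt.eventually_lt_const (by simpa using h.pos)

/-- Since `T t` preserves inner products, the derivative at `0` of `⟨T t φ, T t ψ⟩` vanishes. -/
lemma skew (h : LocalPropagator ι G r T) (φ ψ : 𝓓) :
    inner ℂ (ι φ) (ι (G ψ)) + inner ℂ (ι (G φ)) (ι ψ) = 0 := by
  have h1 := (h.hasDerivAt_zero φ).inner ℂ (h.hasDerivAt_zero ψ)
  have h2 : HasDerivAt (fun t => inner ℂ (T t (ι φ)) (T t (ι ψ))) 0 0 := by
    refine (hasDerivAt_const (0 : ℝ) (inner ℂ (ι φ) (ι ψ))).congr_of_eventuallyEq ?_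
    filter_upwards [h.eventually_lt] with t ht using h.inner_map ht _ _
  have h3 := h1.unique h2
  simpa [h.zero] using h3

lemma ext_dense (h : LocalPropagator ι G r T) {f g : 𝓗 →L[ℂ] 𝓗} (hfg : ∀ φ, f (ι φ) = g (ι φ)) :
    f = g :=
  ContinuousLinearMap.coeFn_injective
    (h.dense.equalizer f.continuous g.continuous (funext hfg))

/-- Uniqueness for the evolution equation: `T (τ + s) φ` and `T τ (T s φ)` solve it with the same
value at `τ = 0`, and the squared norm of their difference has zero derivative because `G` is skew.
-/
lemma mul_eq (h : LocalPropagator ι G r T) {s t : ℝ} (hst : |t| + |s| < r) :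
    T (t + s) = T t * T s := by
  have hs : |s| < r := (le_add_of_nonneg_left (abs_nonneg t)).trans_lt hst
  refine h.ext_dense fun φ => ?_
  obtain ⟨φs, hφs, -⟩ := h.deriv s hs φ
  set f : ℝ → 𝓗 := fun τ => T (τ + s) (ι φ) - T τ (ι φs) with hf
  have hd : ∀ τ, |τ| + |s| < r → HasDerivAt (fun τ => ‖f τ‖ ^ 2) 0 τ := by
    intro τ hτ
    obtain ⟨a, ha, ha'⟩ := h.deriv (τ + s) ((abs_add_le _ _).trans_lt hτ) φ
    obtain ⟨b, hb, hb'⟩ := h.deriv τ (by linarith [abs_nonneg s]) φs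
    have h1 : HasDerivAt f (ι (G (a - b))) τ := by
      rw [map_sub, map_sub]
      exact (ha'.comp_add_const τ s).sub hb'
    have h2 : f τ = ι (a - b) := by simp [hf, ha, hb]
    have h3 := (h1.inner ℂ h1)
    rw [h2, h.skew] at h3
    have h4 := Complex.reCLM.hasFDerivAt.comp_hasDerivAt τ h3
    simp only [map_zero] at h4
    refine h4.congr_of_eventuallyEq (Filter.Eventually.of_forall fun x => ?_)
    simp only [Function.comp]
    rw [inner_self_eq_norm_sq_to_K]
    norm_cast
  have hconv : Convex ℝ {τ : ℝ | |τ| + |s| < r} := by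
    have : {τ : ℝ | |τ| + |s| < r} = Metric.ball 0 (r - |s|) := by
      ext τ; simp [lt_sub_iff_add_lt]
    rw [this]; exact convex_ball _ _
  have hc := hconv.norm_image_sub_le_of_norm_hasDerivWithin_le
    (f := fun τ => ‖f τ‖ ^ 2) (f' := fun _ => 0) (C := 0) (x := 0) (y := t)
    (fun τ hτ => (hd τ hτ).hasDerivWithinAt) (by simp) 
    (show |(0 : ℝ)| + |s| < r by simpa using hs) hst
  have h0 : f 0 = 0 := by simp [hf, h.zero, hφs]
  have h1 : f t = 0 := by simpa [h0] using hc
  rw [mul_apply_eq_comp, hφs]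
  exact sub_eq_zero.1 h1

lemma eq_pow (h : LocalPropagator ι G r T) {σ : ℝ} (m : ℕ) (hm : m * |σ| < r) :
    T (m * σ) = T σ ^ m := by
  induction m with
  | zero => simp [h.zero]
  | succ m ih =>
    push_cast at hm ⊢
    rw [pow_succ, ← ih (by nlinarith [abs_nonneg σ]), ← h.mul_eq, add_mul, one_mul]
    rw [abs_mul, Nat.abs_cast]; linarith

/-- The number of steps used to reach time `t`. -/
noncomputable def numSteps (r t : ℝ) : ℕ := ⌊|t| / r⌋₊ + 1

/-- The extension to all times of a local propagator. -/
noncomputable def extend (r : ℝ) (T : ℝ → 𝓗 →L[ℂ] 𝓗) (t : ℝ) : 𝓗 →L[ℂ] 𝓗 :=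
  T (t / numSteps r t) ^ numSteps r t

/-- Refining a subdivision of `[0, t]` does not change the product; any two subdivisions are then
compared through a common refinement. -/
lemma pow_eq_pow (h : LocalPropagator ι G r T) {t : ℝ} {k l : ℕ} (hk : 0 < k) (hl : 0 < l)
    (htk : |t| < k * r) : T (t / k) ^ k = T (t / (k * l)) ^ (k * l) := by
  have hk' : (0 : ℝ) < k := by exact_mod_cast hk
  have hl' : (0 : ℝ) < l := by exact_mod_cast hl
  have h1 := h.eq_pow (σ := t / (k * l)) l (by
    rw [abs_div, abs_mul, Nat.abs_cast, Nat.abs_cast]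
    field_simp
    linarith)
  rw [mul_comm k l, pow_mul, ← h1]
  congr 2
  field_simp

lemma extend_eq (h : LocalPropagator ι G r T) {t : ℝ} {k : ℕ} (hk : 0 < k)
    (htk : |t| < k * r) : extend r T t = T (t / k) ^ k := by
  have h1 : |t| < numSteps r t * r := by
    rw [← div_lt_iff₀ h.pos, numSteps]
    exact_mod_cast Nat.lt_floor_add_one _
  have h2 : 0 < numSteps r t := Nat.succ_pos _
  rw [extend, h.pow_eq_pow h2 hk h1, h.pow_eq_pow hk h2 htk, mul_comm k, mul_comm (k : ℝ)]

lemma extend_eq_self (h : LocalPropagator ι G r T) {t : ℝ} (ht : |t| < r) :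
    extend r T t = T t := by
  simpa using h.extend_eq (k := 1) one_pos (by simpa using ht)

lemma extend_add (h : LocalPropagator ι G r T) (s t : ℝ) :
    extend r T (s + t) = extend r T s * extend r T t := by
  obtain ⟨k, hk⟩ := exists_nat_gt ((|s| + |t|) / r)
  rw [div_lt_iff₀ h.pos] at hk
  have hk0 : 0 < k := by
    rcases Nat.eq_zero_or_pos k with rfl | hk0
    · simp only [CharP.cast_eq_zero, zero_mul] at hk
      linarith [abs_nonneg s, abs_nonneg t]
    · exact hk0
  have hk' : (0 : ℝ) < k := by exact_mod_cast hk0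
  have hb : |s / k| + |t / k| < r := by
    rw [abs_div, abs_div, Nat.abs_cast, ← add_div, div_lt_iff₀ hk']; linarith
  rw [h.extend_eq hk0 ((abs_add_le s t).trans_lt hk),
    h.extend_eq (t := s) hk0 (by linarith [abs_nonneg t]),
    h.extend_eq (t := t) hk0 (by linarith [abs_nonneg s]), add_div, h.mul_eq hb]
  refine Commute.mul_pow ?_ k
  -- The group law used in both orders makes the two short-time operators commute, so the power of
  -- the product splits.
  rw [commute_iff_eq, ← h.mul_eq hb, ← h.mul_eq (by linarith), add_comm]

lemma extend_zero (h : LocalPropagator ι G r T) : extend r T 0 = 1 := by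
  rw [h.extend_eq_self (by simpa using h.pos), h.zero]

/-- Continuity holds on the dense range of `ι` by differentiability, and passes to all vectors
because the `T t` are isometries. -/
lemma tendsto_zero (h : LocalPropagator ι G r T) (u : 𝓗) :
    Filter.Tendsto (fun t => T t u) (nhds 0) (nhds u) := by
  rw [Metric.tendsto_nhds]
  intro ε hε
  obtain ⟨φ, hφ⟩ := h.dense.exists_dist_lt u (ε := ε / 3) (by positivity)
  have h1 : Filter.Tendsto (fun t => T t (ι φ)) (nhds 0) (nhds (ι φ)) := by
    simpa [h.zero] using (h.hasDerivAt_zero φ).continuousAt.tendsto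
  filter_upwards [h.eventually_lt, (Metric.tendsto_nhds.1 h1) (ε / 3) (by positivity)] with t ht h2
  have h3 : dist (T t u) (T t (ι φ)) = dist u (ι φ) := by
    rw [dist_eq_norm, dist_eq_norm, ← map_sub, h.isometric t ht]
  calc dist (T t u) u ≤ dist (T t u) (T t (ι φ)) + dist (T t (ι φ)) (ι φ) + dist (ι φ) u :=
        dist_triangle4 _ _ _ _
    _ < ε := by rw [h3, dist_comm (ι φ) u]; linarith

lemma continuous_extend (h : LocalPropagator ι G r T) (u : 𝓗) :
    Continuous fun t => extend r T t u := by
  rw [continuous_iff_continuousAt]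
  intro t
  have h1 : Filter.Tendsto (fun s => extend r T s u) (nhds 0) (nhds u) := by
    refine (h.tendsto_zero u).congr' ?_
    filter_upwards [h.eventually_lt] with s hs
    rw [h.extend_eq_self hs]
  have h2 : Filter.Tendsto (fun s => s - t) (nhds t) (nhds 0) := by
    simpa using (continuous_id.sub continuous_const).tendsto (X := ℝ) (f := fun s => s - t) t
  have h3 := ((extend r T t).continuous.tendsto u).comp (h1.comp h2)
  refine h3.congr fun s => ?_
  simp only [Function.comp]
  rw [← mul_apply_eq_comp, ← h.extend_add, add_sub_cancel]

lemma map_neg_mul (h : LocalPropagator ι G r T) {t : ℝ} (ht : |t| < r) (u : 𝓗) :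
    T (-t) (T t u) = u := by
  have h1 := h.extend_add (-t) t
  rw [neg_add_cancel, h.extend_zero, h.extend_eq_self ht, h.extend_eq_self (by rwa [abs_neg])] at h1
  rw [← mul_apply_eq_comp, ← h1, one_apply_eq_self]

lemma inner_map_right (h : LocalPropagator ι G r T) {t : ℝ} (ht : |t| < r) (u v : 𝓗) :
    inner ℂ u (T t v) = inner ℂ (T (-t) u) v := by
  rw [← h.inner_map (t := -t) (by rwa [abs_neg]), h.map_neg_mul ht]

/-- The adjoint of `T t` is `T (-t)`, which keeps `ψ` in the range of `ι`. The weak relation `hw`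
can thus be applied to the evolved test vector at every time, not only at `0`. -/
lemma hasDerivAt_inner (h : LocalPropagator ι G r T) (ψ : 𝓓) (u w : 𝓗)
    (hw : ∀ ψ, inner ℂ (ι ψ) w = -inner ℂ (ι (G ψ)) u) {t : ℝ} (ht : |t| < r) :
    HasDerivAt (fun t => inner ℂ (ι ψ) (T t u)) (inner ℂ (ι ψ) (T t w)) t := by
  obtain ⟨χ, h1, h2⟩ := h.deriv (-t) (by rwa [abs_neg]) ψ
  have h3 : HasDerivAt (fun t => inner ℂ (T (-t) (ι ψ)) u) (inner ℂ (ι ψ) (T t w)) t := by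
    have h4 := (h2.scomp t (hasDerivAt_neg t)).inner ℂ (hasDerivAt_const t u)
    rw [h.inner_map_right ht, h1, hw]
    simpa using h4
  refine h3.congr_of_eventuallyEq ?_
  filter_upwards [continuous_abs.continuousAt.eventually_lt_const ht] with s hs
  exact h.inner_map_right hs _ _

lemma norm_le_of_inner_le (h : LocalPropagator ι G r T) {v : 𝓗} {c : ℝ} (hc0 : 0 ≤ c)
    (hc : ∀ ψ, ‖inner ℂ (ι ψ) v‖ ≤ c * ‖ι ψ‖) : ‖v‖ ≤ c := by
  have h1 : ∀ x : 𝓗, ‖inner ℂ x v‖ ≤ c * ‖x‖ := by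
    intro x
    refine h.dense.induction_on x (isClosed_le ?_ ?_) hc <;> fun_prop
  have h2 := h1 v
  rw [inner_self_eq_norm_sq_to_K, norm_pow] at h2
  simp only [Complex.coe_algebraMap, Complex.norm_real, norm_norm] at h2
  rcases eq_or_lt_of_le (norm_nonneg v) with h0 | h0
  · rwa [← h0]
  · nlinarith

/-- The generator of the extended group is the maximal realization of `G`, described by duality. -/
lemma hasDerivAt_extend_iff (h : LocalPropagator ι G r T) (u w : 𝓗) :
    HasDerivAt (fun t => extend r T t u) w 0 ↔
      ∀ ψ, inner ℂ (ι ψ) w = -inner ℂ (ι (G ψ)) u := by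
  have hev : (fun t => extend r T t u) =ᶠ[nhds 0] fun t => T t u := by
    filter_upwards [h.eventually_lt] with t ht
    rw [h.extend_eq_self ht]
  rw [hev.hasDerivAt_iff]
  constructor
  · intro hd ψ
    have h1 := (hasDerivAt_const (0 : ℝ) (ι ψ)).inner ℂ hd
    have h2 : HasDerivAt (fun t => T t (ι ψ)) (ι (G ψ)) (-0) := by
      rw [neg_zero]; exact h.hasDerivAt_zero ψ
    have h3 := (h2.scomp (0 : ℝ) (hasDerivAt_neg 0)).inner ℂ (hasDerivAt_const (0 : ℝ) u)
    have h4 : (fun t => inner ℂ (ι ψ) (T t u)) =ᶠ[nhds 0]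
        fun t => inner ℂ (((fun t => T t (ι ψ)) ∘ Neg.neg) t) u := by
      filter_upwards [h.eventually_lt] with s hs
      exact h.inner_map_right hs _ _
    have h5 := h1.unique (h4.hasDerivAt_iff.2 h3)
    simpa using h5
  · intro hw
    rw [hasDerivAt_iff_isLittleO, Asymptotics.isLittleO_iff]
    intro ε hε
    obtain ⟨δ, hδ, hδ'⟩ := Metric.eventually_nhds_iff.1
      ((h.eventually_lt).and ((Metric.tendsto_nhds.1 (h.tendsto_zero w)) ε hε))
    refine Metric.eventually_nhds_iff.2 ⟨δ, hδ, fun t ht => ?_⟩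
    rw [h.zero, one_apply_eq_self, sub_zero]
    -- The difference quotient is estimated by duality. The mean value inequality for `⟨ψ, T s u⟩ -
    -- s⟨ψ, w⟩`, whose derivative is `⟨ψ, T s w - w⟩`, gives a bound proportional to `‖ι ψ‖`,
    -- uniform in `ψ`; the weak derivative is therefore a strong one.
    refine h.norm_le_of_inner_le (by positivity) fun ψ => ?_
    have h1 : ∀ s ∈ Metric.ball (0 : ℝ) δ, HasDerivWithinAt
        (fun s : ℝ => inner ℂ (ι ψ) (T s u) - s • inner ℂ (ι ψ) w)
        (inner ℂ (ι ψ) (T s w) - inner ℂ (ι ψ) w) (Metric.ball 0 δ) s := by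
      intro s hs
      have h2 := (h.hasDerivAt_inner ψ u w hw (hδ' hs).1).sub
        ((hasDerivAt_id s).smul_const (inner ℂ (ι ψ) w))
      rw [one_smul] at h2
      exact h2.hasDerivWithinAt
    have h2 := (convex_ball (0 : ℝ) δ).norm_image_sub_le_of_norm_hasDerivWithin_le h1
      (C := ‖ι ψ‖ * ε) (fun s hs => ?_) (Metric.mem_ball_self hδ) ht
    · simp only [h.zero, one_apply_eq_self, zero_smul, sub_zero] at h2
      calc ‖inner ℂ (ι ψ) (T t u - u - t • w)‖
          = ‖inner ℂ (ι ψ) (T t u) - t • inner ℂ (ι ψ) w - inner ℂ (ι ψ) u‖ := by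
            rw [inner_sub_right, inner_sub_right, inner_smul_right_eq_smul]
            congr 1; ring
        _ ≤ ‖ι ψ‖ * ε * ‖t‖ := h2
        _ = ε * ‖t‖ * ‖ι ψ‖ := by ring
    · rw [← inner_sub_right]
      refine (norm_inner_le_norm _ _).trans ?_
      gcongr
      rw [← dist_eq_norm]
      exact (hδ' hs).2.le

end LocalPropagator
end LocalPropagator
end ExactSplitting

namespace ExactSplitting

noncomputable section

/-! ### Quadratic differential operators on Schwartz functions -/

/-- Schwartz functions on `ℝⁿ`. -/
abbrev Schw (n : ℕ) : Type := 𝓢(EuclideanSpace ℝ (Fin n), ℂ)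

/-- The inclusion of Schwartz functions in `L²`. -/
def toL2 (n : ℕ) : Schw n →ₗ[ℂ] L2 n := (toLpCLM ℂ ℂ 2 volume : Schw n →L[ℂ] L2 n)

variable {n : ℕ}

lemma coeFn_toL2 (φ : Schw n) : toL2 n φ =ᵐ[volume] φ := φ.coeFn_toLp 2 volume

lemma toL2_injective : Function.Injective (toL2 n) := injective_toLp 2 volume

lemma denseRange_toL2 : DenseRange (toL2 n) :=
  denseRange_toLpCLM ENNReal.ofNat_ne_top

/-- The position operators `x_j` and the momentum operators `-i ∂_j`. -/
def phaseVar : Fin n ⊕ Fin n → Schw n →ₗ[ℂ] Schw n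
  | Sum.inl j => (SchwartzMap.smulLeftCLM ℂ fun x : EuclideanSpace ℝ (Fin n) => ((x j : ℝ) : ℂ) :
      Schw n →L[ℂ] Schw n)
  | Sum.inr j => (-Complex.I) •
      (lineDerivOpCLM ℂ (Schw n) (EuclideanSpace.single j (1 : ℝ)) : Schw n →ₗ[ℂ] Schw n)

lemma hasTemperateGrowth_coord (j : Fin n) :
    (fun x : EuclideanSpace ℝ (Fin n) => ((x j : ℝ) : ℂ)).HasTemperateGrowth :=
  (Complex.ofRealCLM.comp (EuclideanSpace.proj j : EuclideanSpace ℝ (Fin n) →L[ℝ] ℝ)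
    ).hasTemperateGrowth

lemma phaseVar_inl (j : Fin n) (φ : Schw n) (x : EuclideanSpace ℝ (Fin n)) :
    phaseVar (Sum.inl j) φ x = (x j : ℂ) * φ x := by
  simp [phaseVar, SchwartzMap.smulLeftCLM_apply_apply (hasTemperateGrowth_coord j)]

lemma phaseVar_inr (j : Fin n) (φ : Schw n) (x : EuclideanSpace ℝ (Fin n)) :
    phaseVar (Sum.inr j) φ x = -Complex.I * fderiv ℝ φ x (EuclideanSpace.single j 1) := by
  simp [phaseVar, SchwartzMap.lineDerivOp_apply_eq_fderiv]

/-- The Weyl quantization of the quadratic form `z ↦ ᵗz H z / 2` on the phase space. -/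
def weyl (H : Matrix (Fin n ⊕ Fin n) (Fin n ⊕ Fin n) ℝ) : Schw n →ₗ[ℂ] Schw n :=
  (1 / 2 : ℂ) • ∑ a, ∑ b, (H a b : ℂ) • (phaseVar a ∘ₗ phaseVar b)

lemma weyl_apply (H : Matrix (Fin n ⊕ Fin n) (Fin n ⊕ Fin n) ℝ) (φ : Schw n) :
    weyl H φ = (1 / 2 : ℂ) • ∑ a, ∑ b, (H a b : ℂ) • phaseVar a (phaseVar b φ) := by
  simp [weyl, LinearMap.sum_apply]

/-- The skew-adjoint operator `-i H^w`. -/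
def quadGen (H : Matrix (Fin n ⊕ Fin n) (Fin n ⊕ Fin n) ℝ) : Schw n →ₗ[ℂ] Schw n :=
  (-Complex.I) • weyl H

lemma quadGen_add (H K : Matrix (Fin n ⊕ Fin n) (Fin n ⊕ Fin n) ℝ) :
    quadGen (H + K) = quadGen H + quadGen K := by
  simp only [quadGen, weyl, Matrix.add_apply, Complex.ofReal_add, add_smul,
    Finset.sum_add_distrib, smul_add]

lemma quadGen_zero : quadGen (0 : Matrix (Fin n ⊕ Fin n) (Fin n ⊕ Fin n) ℝ) = 0 := by
  simp [quadGen, weyl]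

/-! ### Metaplectic operators -/

/-- `T` is an isometry of `L²`, acting as `Q` on Schwartz functions, which conjugates the position
and momentum operators by the symplectic matrix `M`. -/
structure Metaplectic (T : L2 n →L[ℂ] L2 n) (Q : Schw n →ₗ[ℂ] Schw n)
    (M : Matrix (Fin n ⊕ Fin n) (Fin n ⊕ Fin n) ℝ) : Prop where
  isometric : ∀ u, ‖T u‖ = ‖u‖
  map : ∀ φ, T (toL2 n φ) = toL2 n (Q φ)
  covariant : ∀ a φ, phaseVar a (Q φ) = ∑ b, (M a b : ℂ) • Q (phaseVar b φ)
  symplectic : Mᵀ * sympJ n * M = sympJ n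

lemma sympJ_mul_self : sympJ n * sympJ n = -1 := by
  simp [sympJ, Matrix.fromBlocks_multiply, ← Matrix.fromBlocks_one, Matrix.fromBlocks_neg]

/-- Because `J² = -1`, the relation `ᵗM J M = J` displays the inverse of `M` as `-J ᵗM J`. -/
lemma symplectic_left_inv {M : Matrix (Fin n ⊕ Fin n) (Fin n ⊕ Fin n) ℝ}
    (h : Mᵀ * sympJ n * M = sympJ n) : (-(sympJ n * Mᵀ * sympJ n)) * M = 1 := by
  rw [neg_mul, mul_assoc, mul_assoc, ← mul_assoc Mᵀ, h, sympJ_mul_self, neg_neg]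

lemma symplectic_right_inv {M : Matrix (Fin n ⊕ Fin n) (Fin n ⊕ Fin n) ℝ}
    (h : Mᵀ * sympJ n * M = sympJ n) : M * (-(sympJ n * Mᵀ * sympJ n)) = 1 :=
  mul_eq_one_comm.1 (symplectic_left_inv h)

lemma symplectic_transpose {M : Matrix (Fin n ⊕ Fin n) (Fin n ⊕ Fin n) ℝ}
    (h : Mᵀ * sympJ n * M = sympJ n) : M * sympJ n * Mᵀ = sympJ n := by
  have h1 := congrArg (· * sympJ n) (symplectic_right_inv h)
  simp only [mul_neg, neg_mul, mul_assoc, sympJ_mul_self, mul_one, one_mul, neg_neg] at h1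
  rw [mul_assoc, h1]

lemma symplectic_mul {M N : Matrix (Fin n ⊕ Fin n) (Fin n ⊕ Fin n) ℝ}
    (hM : Mᵀ * sympJ n * M = sympJ n) (hN : Nᵀ * sympJ n * N = sympJ n) :
    (M * N)ᵀ * sympJ n * (M * N) = sympJ n := by
  calc (M * N)ᵀ * sympJ n * (M * N) = Nᵀ * (Mᵀ * sympJ n * M) * N := by
        rw [Matrix.transpose_mul]; simp only [mul_assoc]
    _ = sympJ n := by rw [hM, hN]

lemma sum_comm_four {ι A : Type*} [Fintype ι] [AddCommMonoid A] (f : ι → ι → ι → ι → A) :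
    ∑ a, ∑ b, ∑ c, ∑ d, f a b c d = ∑ d, ∑ c, ∑ b, ∑ a, f a b c d := by
  calc ∑ a, ∑ b, ∑ c, ∑ d, f a b c d = ∑ a, ∑ d, ∑ b, ∑ c, f a b c d := by
        refine Finset.sum_congr rfl fun a _ => ?_
        rw [Finset.sum_comm_cycle]
    _ = _ := by
        rw [Finset.sum_comm]
        refine Finset.sum_congr rfl fun d _ => ?_
        rw [Finset.sum_comm_cycle]
        exact Finset.sum_congr rfl fun c _ => Finset.sum_comm

namespace Metaplectic

variable {T T₁ T₂ : L2 n →L[ℂ] L2 n} {Q Q₁ Q₂ : Schw n →ₗ[ℂ] Schw n}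
  {M M₁ M₂ : Matrix (Fin n ⊕ Fin n) (Fin n ⊕ Fin n) ℝ}

lemma one : Metaplectic (1 : L2 n →L[ℂ] L2 n) LinearMap.id 1 where
  isometric u := rfl
  map φ := rfl
  covariant a φ := by simp [Matrix.one_apply, ite_smul]
  symplectic := by simp

lemma mul (h₁ : Metaplectic T₁ Q₁ M₁) (h₂ : Metaplectic T₂ Q₂ M₂) :
    Metaplectic (T₁ * T₂) (Q₁ ∘ₗ Q₂) (M₁ * M₂) where
  isometric u := by rw [mul_apply_eq_comp, h₁.isometric, h₂.isometric]
  map φ := by rw [mul_apply_eq_comp, h₂.map, h₁.map, LinearMap.comp_apply]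
  covariant a φ := by
    simp only [LinearMap.comp_apply, h₁.covariant, h₂.covariant, map_sum, map_smul,
      Finset.smul_sum, smul_smul, Matrix.mul_apply, Complex.ofReal_sum, Complex.ofReal_mul,
      Finset.sum_smul]
    rw [Finset.sum_comm]
  symplectic := symplectic_mul h₁.symplectic h₂.symplectic

/-- Exact Egorov theorem for quadratic symbols: moving two phase variables through `Q` replaces each
by a linear combination and keeps their order, so no commutator appears. -/
lemma weyl_comp (h : Metaplectic T Q M) (H : Matrix (Fin n ⊕ Fin n) (Fin n ⊕ Fin n) ℝ)
    (φ : Schw n) : weyl H (Q φ) = Q (weyl (Mᵀ * H * M) φ) := by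
  simp only [weyl_apply, map_smul, map_sum, h.covariant, Finset.smul_sum, smul_smul,
    Matrix.mul_apply, Matrix.transpose_apply, Complex.ofReal_sum, Complex.ofReal_mul,
    Finset.sum_smul, Finset.sum_mul]
  rw [sum_comm_four]
  refine Finset.sum_congr rfl fun d _ => Finset.sum_congr rfl fun c _ =>
    Finset.sum_congr rfl fun b _ => Finset.sum_congr rfl fun a _ => ?_
  congr 1
  ring

lemma quadGen_comp (h : Metaplectic T Q M) (H : Matrix (Fin n ⊕ Fin n) (Fin n ⊕ Fin n) ℝ)
    (φ : Schw n) : quadGen H (Q φ) = Q (quadGen (Mᵀ * H * M) φ) := by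
  simp [quadGen, h.weyl_comp]

end Metaplectic

/-- A curve of metaplectic operators which is differentiable at `t`, together with the
corresponding curve of symplectic matrices. -/
structure MetaplecticCurveAt (T : ℝ → L2 n →L[ℂ] L2 n)
    (M : ℝ → Matrix (Fin n ⊕ Fin n) (Fin n ⊕ Fin n) ℝ) (t : ℝ) : Prop where
  isometric : ∀ᶠ s in nhds t, ∀ u, ‖T s u‖ = ‖u‖
  deriv : ∃ H Q, Metaplectic (T t) Q (M t) ∧ HasDerivAt M (sympJ n * H * M t) t ∧
    ∀ φ, HasDerivAt (fun s => T s (toL2 n φ)) (toL2 n (quadGen H (Q φ))) t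

/-! ### Product rule for curves of metaplectic operators -/

namespace MetaplecticCurveAt

variable {T T₁ T₂ : ℝ → L2 n →L[ℂ] L2 n}
  {M M₁ M₂ : ℝ → Matrix (Fin n ⊕ Fin n) (Fin n ⊕ Fin n) ℝ} {t : ℝ}

lemma const {T : L2 n →L[ℂ] L2 n} {Q : Schw n →ₗ[ℂ] Schw n}
    {M : Matrix (Fin n ⊕ Fin n) (Fin n ⊕ Fin n) ℝ} (h : Metaplectic T Q M) (t : ℝ) :
    MetaplecticCurveAt (fun _ => T) (fun _ => M) t where
  isometric := Filter.Eventually.of_forall fun _ => h.isometric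
  deriv := ⟨0, Q, h, by simpa using hasDerivAt_const t M,
    fun φ => by simpa [quadGen_zero] using hasDerivAt_const t (T (toL2 n φ))⟩

lemma tendsto (h : MetaplecticCurveAt T M t) (u : L2 n) :
    Filter.Tendsto (fun s => T s u) (nhds t) (nhds (T t u)) := by
  obtain ⟨H, Q, -, -, hd⟩ := h.deriv
  rw [Metric.tendsto_nhds]
  intro ε hε
  obtain ⟨φ, hφ⟩ := denseRange_toL2.exists_dist_lt u (ε := ε / 3) (by positivity)
  have hd' : ∀ s, (∀ u, ‖T s u‖ = ‖u‖) → dist (T s u) (T s (toL2 n φ)) < ε / 3 := by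
    intro s hs
    rw [dist_eq_norm] at hφ ⊢
    rwa [← map_sub, hs]
  filter_upwards [h.isometric, (Metric.tendsto_nhds.1 (hd φ).continuousAt.tendsto) (ε / 3)
    (by positivity)] with s hs h2
  calc dist (T s u) (T t u) ≤ dist (T s u) (T s (toL2 n φ)) +
        dist (T s (toL2 n φ)) (T t (toL2 n φ)) + dist (T t (toL2 n φ)) (T t u) :=
        dist_triangle4 _ _ _ _
    _ < ε := by
      have h3 := hd' s hs
      have h4 := hd' t h.isometric.self_of_nhds
      rw [dist_comm] at h4
      linarith

/-- The curve `T` is differentiable only strongly, on particular vectors. Isometry transports the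
remainder of `f` without loss, and strong continuity at `f'` handles the cross term. -/
lemma hasDerivAt_apply (h : MetaplecticCurveAt T M t) {f : ℝ → L2 n} {f' v : L2 n}
    (hf : HasDerivAt f f' t) (hv : HasDerivAt (fun s => T s (f t)) v t) :
    HasDerivAt (fun s => T s (f s)) (v + T t f') t := by
  rw [hasDerivAt_iff_isLittleO] at hf hv ⊢
  have h1 : (fun s => T s (f s - f t - (s - t) • f')) =o[nhds t] fun s => s - t := by
    refine (Asymptotics.isLittleO_norm_left.1 ?_)
    refine (Asymptotics.isLittleO_norm_left.2 hf).congr' ?_ Filter.EventuallyEq.rfl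
    filter_upwards [h.isometric] with s hs
    rw [hs]
  have h2 : (fun s => (s - t) • (T s f' - T t f')) =o[nhds t] fun s => s - t := by
    have h3 : (fun s => T s f' - T t f') =o[nhds t] fun _ => (1 : ℝ) := by
      rw [Asymptotics.isLittleO_one_iff]
      simpa using (h.tendsto f').sub_const (T t f')
    simpa using (Asymptotics.isBigO_refl (fun s : ℝ => s - t) (nhds t)).smul_isLittleO h3
  refine ((h1.add h2).add hv).congr_left fun s => ?_
  simp only [map_sub, ContinuousLinearMap.map_smul_of_tower, smul_sub, smul_add]
  abel

lemma mul (h₁ : MetaplecticCurveAt T₁ M₁ t) (h₂ : MetaplecticCurveAt T₂ M₂ t) :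
    MetaplecticCurveAt (fun s => T₁ s * T₂ s) (fun s => M₁ s * M₂ s) t := by
  obtain ⟨H₁, Q₁, hm₁, hM₁, hd₁⟩ := h₁.deriv
  obtain ⟨H₂, Q₂, hm₂, hM₂, hd₂⟩ := h₂.deriv
  set N := -(sympJ n * (M₁ t)ᵀ * sympJ n) with hN
  have hNM : N * M₁ t = 1 := symplectic_left_inv hm₁.symplectic
  have hMN : (M₁ t)ᵀ * Nᵀ = 1 := by rw [← Matrix.transpose_mul, hNM, Matrix.transpose_one]
  have hH : (M₁ t)ᵀ * (Nᵀ * H₂ * N) * M₁ t = H₂ := by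
    rw [← mul_assoc, ← mul_assoc, hMN, one_mul, mul_assoc, hNM, mul_one]
  -- Here `N` is the inverse of `M₁ t`. The second generator must be moved to the left of the first
  -- factor, which turns `H₂` into its pullback by `N`.
  refine ⟨?_, H₁ + Nᵀ * H₂ * N, Q₁ ∘ₗ Q₂, hm₁.mul hm₂, ?_, fun φ => ?_⟩
  · filter_upwards [h₁.isometric, h₂.isometric] with s h1 h2 u
    rw [mul_apply_eq_comp, h1, h2]
  · refine (hM₁.mul hM₂).congr_deriv ?_
    have h3 : M₁ t * sympJ n * H₂ = sympJ n * (Nᵀ * H₂ * N) * M₁ t := by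
      calc M₁ t * sympJ n * H₂ = M₁ t * sympJ n * ((M₁ t)ᵀ * (Nᵀ * H₂ * N) * M₁ t) := by rw [hH]
        _ = (M₁ t * sympJ n * (M₁ t)ᵀ) * (Nᵀ * H₂ * N) * M₁ t := by simp only [mul_assoc]
        _ = _ := by rw [symplectic_transpose hm₁.symplectic]
    rw [← mul_assoc (M₁ t), ← mul_assoc (M₁ t), h3, mul_add, add_mul]
    simp only [mul_assoc]
  · have h3 := h₁.hasDerivAt_apply (hd₂ φ) (v := toL2 n (quadGen H₁ (Q₁ (Q₂ φ)))) (by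
      simp only [hm₂.map]; exact hd₁ _)
    refine h3.congr_deriv ?_
    rw [hm₁.map, ← map_add, LinearMap.comp_apply, quadGen_add, LinearMap.add_apply,
      hm₁.quadGen_comp (Nᵀ * H₂ * N), hH]

lemma list_prod {ι : Type*} (l : List ι) {T : ι → ℝ → L2 n →L[ℂ] L2 n}
    {M : ι → ℝ → Matrix (Fin n ⊕ Fin n) (Fin n ⊕ Fin n) ℝ}
    (h : ∀ i ∈ l, MetaplecticCurveAt (T i) (M i) t) :
    MetaplecticCurveAt (fun s => (l.map fun i => T i s).prod)
      (fun s => (l.map fun i => M i s).prod) t := by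
  induction l with
  | nil => simpa using const Metaplectic.one t
  | cons i l ih =>
    simp only [List.map_cons, List.prod_cons]
    exact (h i (by simp)).mul (ih fun j hj => h j (by simp [hj]))

end MetaplecticCurveAt

end

end ExactSplitting

namespace ExactSplitting

noncomputable section

variable {n : ℕ}

/-! ### Quadratic forms -/

lemma quadForm_eq_sum (C : Matrix (Fin n) (Fin n) ℝ) (x : EuclideanSpace ℝ (Fin n)) :
    quadForm C x = ∑ i, ∑ j, x i * (C i j * x j) := by
  simp [quadForm, dotProduct, Matrix.mulVec, Finset.mul_sum]

lemma linCoord_eq_sum (C : Matrix (Fin n) (Fin n) ℝ) (j : Fin n) (x : EuclideanSpace ℝ (Fin n)) :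
    linCoord C j x = ∑ k, C j k * x k := by
  simp [linCoord, dotProduct, Matrix.mulVec]

lemma quadForm_sub (C D : Matrix (Fin n) (Fin n) ℝ) (x : EuclideanSpace ℝ (Fin n)) :
    quadForm (C - D) x = quadForm C x - quadForm D x := by
  simp [quadForm, Matrix.sub_mulVec]

lemma quadForm_smul (c : ℝ) (C : Matrix (Fin n) (Fin n) ℝ) (x : EuclideanSpace ℝ (Fin n)) :
    quadForm (c • C) x = c * quadForm C x := by
  simp [quadForm, Matrix.smul_mulVec]

lemma quadForm_smul_right (c : ℝ) (C : Matrix (Fin n) (Fin n) ℝ) (x : EuclideanSpace ℝ (Fin n)) :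
    quadForm C (c • x) = c ^ 2 * quadForm C x := by
  simp [quadForm, Matrix.mulVec_smul]
  ring

lemma quadForm_line {C : Matrix (Fin n) (Fin n) ℝ} (hC : C.IsSymm) (j : Fin n)
    (x : EuclideanSpace ℝ (Fin n)) (τ : ℝ) :
    quadForm C (x + τ • EuclideanSpace.single j 1)
      = quadForm C x + τ * (2 * linCoord C j x) + τ ^ 2 * C j j := by
  have h1 : x.ofLp ⬝ᵥ C *ᵥ (Pi.single j 1) = linCoord C j x := by
    rw [Matrix.dotProduct_mulVec, ← Matrix.mulVec_transpose, hC.eq]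
    simp [linCoord]
  have h2 : (Pi.single j 1 : Fin n → ℝ) ⬝ᵥ C *ᵥ (Pi.single j 1) = C j j := by simp
  have h3 : (Pi.single j 1 : Fin n → ℝ) ⬝ᵥ C *ᵥ x.ofLp = linCoord C j x := by simp [linCoord]
  simp only [quadForm, WithLp.ofLp_add, WithLp.ofLp_smul, PiLp.ofLp_single,
    Matrix.mulVec_add, Matrix.mulVec_smul, add_dotProduct, dotProduct_add, smul_dotProduct,
    dotProduct_smul, h1, h2, h3, smul_eq_mul]
  ring

lemma norm_mulVec_le (C : Matrix (Fin n) (Fin n) ℝ) (x : EuclideanSpace ℝ (Fin n)) :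
    ‖Matrix.toEuclideanLin C x‖ ≤ ‖C‖ * ‖x‖ :=
  Matrix.l2_opNorm_mulVec C x

lemma abs_quadForm_le (C : Matrix (Fin n) (Fin n) ℝ) (x : EuclideanSpace ℝ (Fin n)) :
    |quadForm C x| ≤ ‖C‖ * ‖x‖ ^ 2 := by
  have h1 : quadForm C x = inner ℝ (Matrix.toEuclideanLin C x) x := by
    simp [quadForm, EuclideanSpace.inner_eq_star_dotProduct, Matrix.toLpLin_apply]
  rw [h1]
  calc |inner ℝ (Matrix.toEuclideanLin C x) x| ≤ ‖Matrix.toEuclideanLin C x‖ * ‖x‖ :=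
        abs_real_inner_le_norm _ _
    _ ≤ ‖C‖ * ‖x‖ * ‖x‖ := by gcongr; exact norm_mulVec_le C x
    _ = _ := by ring

lemma hasTemperateGrowth_coord_real (j : Fin n) :
    (fun x : EuclideanSpace ℝ (Fin n) => x j).HasTemperateGrowth :=
  (EuclideanSpace.proj j : EuclideanSpace ℝ (Fin n) →L[ℝ] ℝ).hasTemperateGrowth

lemma hasTemperateGrowth_linCoord (C : Matrix (Fin n) (Fin n) ℝ) (j : Fin n) :
    (linCoord C j).HasTemperateGrowth := by
  have h1 : linCoord C j = fun x => ∑ k, C j k * x k := funext (linCoord_eq_sum C j)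
  rw [h1]
  exact Function.HasTemperateGrowth.sum fun k _ =>
    (Function.HasTemperateGrowth.const (C j k)).mul (hasTemperateGrowth_coord_real k)

lemma hasTemperateGrowth_quadForm (C : Matrix (Fin n) (Fin n) ℝ) :
    (quadForm C).HasTemperateGrowth := by
  have h1 : quadForm C = fun x => ∑ i, x i * linCoord C i x := by
    ext x; simp [quadForm_eq_sum, linCoord_eq_sum, Finset.mul_sum]
  rw [h1]
  exact Function.HasTemperateGrowth.sum fun k _ =>
    (hasTemperateGrowth_coord_real k).mul (hasTemperateGrowth_linCoord C k)

lemma hasTemperateGrowth_ofReal {f : EuclideanSpace ℝ (Fin n) → ℝ} (hf : f.HasTemperateGrowth) :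
    (fun x => (f x : ℂ)).HasTemperateGrowth :=
  Function.HasTemperateGrowth.comp (g := Complex.ofReal)
    Complex.ofRealCLM.hasTemperateGrowth hf

lemma iteratedDeriv_exp_phase (k : ℕ) : iteratedDeriv k (fun θ : ℝ => Complex.exp (-Complex.I * θ))
    = fun θ : ℝ => (-Complex.I) ^ k * Complex.exp (-Complex.I * θ) := by
  induction k with
  | zero => simp
  | succ k ih =>
    ext θ
    rw [iteratedDeriv_succ, ih]
    have h1 : HasDerivAt (fun θ : ℝ => Complex.exp (-Complex.I * θ))
        (Complex.exp (-Complex.I * θ) * (-Complex.I * 1)) θ :=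
      ((hasDerivAt_id (θ : ℂ)).comp_ofReal.const_mul (-Complex.I)).cexp
    rw [(h1.const_mul _).deriv]
    ring

lemma hasTemperateGrowth_exp_phase :
    (fun θ : ℝ => Complex.exp (-Complex.I * θ)).HasTemperateGrowth := by
  refine ⟨?_, fun k => ⟨0, 1, fun θ => ?_⟩⟩
  · exact (contDiff_const.mul Complex.ofRealCLM.contDiff).cexp
  · rw [norm_iteratedFDeriv_eq_norm_iteratedDeriv, iteratedDeriv_exp_phase, norm_mul, norm_pow,
      norm_neg, Complex.norm_I, one_pow, one_mul, pow_zero, mul_one]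
    exact norm_exp_phase_le θ

/-! ### Derivatives along lines, and in `L²` -/

lemma phaseVar_inr_eq_of_hasDerivAt {φ : Schw n} {j : Fin n} {x : EuclideanSpace ℝ (Fin n)}
    {d : ℂ} (h : HasDerivAt (fun τ : ℝ => φ (x + τ • EuclideanSpace.single j 1)) d 0) :
    phaseVar (Sum.inr j) φ x = -Complex.I * d := by
  have h1 : HasLineDerivAt ℝ φ d x (EuclideanSpace.single j 1) := h
  rw [phaseVar_inr, ← (φ.differentiableAt).lineDeriv_eq_fderiv, h1.lineDeriv]

lemma hasDerivAt_line (φ : Schw n) (x v : EuclideanSpace ℝ (Fin n)) :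
    HasDerivAt (fun τ : ℝ => φ (x + τ • v)) (fderiv ℝ φ x v) 0 :=
  (φ.hasFDerivAt x).hasLineDerivAt v

/-- A pointwise first order remainder dominated by a fixed square integrable profile, with a
coefficient `o(s - t)`, is enough for differentiability in `L²`. -/
lemma hasDerivAt_Lp_of_bound {F : ℝ → L2 n} {F' w : L2 n} {c : ℝ → ℝ} {t : ℝ}
    (hc : c =o[nhds t] fun s => s - t)
    (h : ∀ᶠ s in nhds t, ∀ᵐ x ∂volume, ‖F s x - F t x - ((s - t : ℝ) : ℂ) * F' x‖ ≤ c s * ‖w x‖) :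
    HasDerivAt F F' t := by
  rw [hasDerivAt_iff_isLittleO]
  refine Asymptotics.IsBigO.trans_isLittleO (Asymptotics.IsBigO.of_bound ‖w‖ ?_) hc
  filter_upwards [h] with s hs
  have h1 : ‖F s - F t - (s - t) • F'‖ ≤ |c s| * ‖w‖ := by
    refine Lp.norm_le_mul_norm_of_ae_le_mul ?_
    filter_upwards [hs, Lp.coeFn_sub (F s - F t) ((s - t) • F'), Lp.coeFn_sub (F s) (F t),
      Lp.coeFn_smul (s - t) F'] with x h1 h2 h3 h4
    rw [h2, Pi.sub_apply, h3, h4, Pi.sub_apply, Pi.smul_apply, Complex.real_smul]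
    exact h1.trans (by gcongr; exact le_abs_self _)
  rw [mul_comm]
  exact h1

/-! ### Multiplication by Gaussian phases -/

/-- The function `x ↦ e^{-i q(x)}`, where `q` is the quadratic form of matrix `C`. -/
def phaseFun (C : Matrix (Fin n) (Fin n) ℝ) (x : EuclideanSpace ℝ (Fin n)) : ℂ :=
  Complex.exp (-Complex.I * (quadForm C x : ℂ))

lemma hasTemperateGrowth_phaseFun (C : Matrix (Fin n) (Fin n) ℝ) :
    (phaseFun C).HasTemperateGrowth :=
  hasTemperateGrowth_exp_phase.comp (hasTemperateGrowth_quadForm C)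

lemma norm_phaseFun (C : Matrix (Fin n) (Fin n) ℝ) (x : EuclideanSpace ℝ (Fin n)) :
    ‖phaseFun C x‖ = 1 := by
  simp [phaseFun, Complex.norm_exp]

/-- Multiplication by `e^{-i q(x)}` on Schwartz functions. -/
def phaseSchw (C : Matrix (Fin n) (Fin n) ℝ) : Schw n →ₗ[ℂ] Schw n :=
  (SchwartzMap.smulLeftCLM ℂ (phaseFun C) : Schw n →L[ℂ] Schw n)

lemma phaseSchw_apply (C : Matrix (Fin n) (Fin n) ℝ) (φ : Schw n)
    (x : EuclideanSpace ℝ (Fin n)) : phaseSchw C φ x = phaseFun C x * φ x := by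
  simp [phaseSchw, SchwartzMap.smulLeftCLM_apply_apply (hasTemperateGrowth_phaseFun C)]

lemma coeFn_mulOp (g : EuclideanSpace ℝ (Fin n) → ℂ) (hg : Continuous g) (hb : ∀ x, ‖g x‖ ≤ 1)
    (u : L2 n) : mulOp g hg hb u =ᵐ[volume] fun x => g x * u x :=
  (memLp_mul g hg hb u).coeFn_toLp

lemma coeFn_phaseOp (t : ℝ) (C : Matrix (Fin n) (Fin n) ℝ) (u : L2 n) :
    phaseOp t C u =ᵐ[volume] fun x => phaseFun (t • C) x * u x := by
  filter_upwards [coeFn_mulOp _ _ _ u] with x hx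
  rw [phaseOp, hx, phaseFun, quadForm_smul]

lemma phaseOp_toL2 (t : ℝ) (C : Matrix (Fin n) (Fin n) ℝ) (φ : Schw n) :
    phaseOp t C (toL2 n φ) = toL2 n (phaseSchw (t • C) φ) := by
  refine Lp.ext ?_
  filter_upwards [coeFn_phaseOp t C (toL2 n φ), coeFn_toL2 φ, coeFn_toL2 (phaseSchw (t • C) φ)]
    with x h1 h2 h3
  rw [h1, h2, h3, phaseSchw_apply]

/-- The symplectic matrix of `e^{-i t v(x)}`. -/
def phaseBlock (t : ℝ) (C : Matrix (Fin n) (Fin n) ℝ) :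
    Matrix (Fin n ⊕ Fin n) (Fin n ⊕ Fin n) ℝ :=
  Matrix.fromBlocks 1 0 (-((2 * t) • C)) 1

/-- For symmetric `C` the gradient of the quadratic form is `2 C x`, so differentiating the phase
shifts the momentum by `-2 (C x)_j`. -/
lemma phaseVar_inr_phaseSchw {C : Matrix (Fin n) (Fin n) ℝ} (hC : C.IsSymm) (j : Fin n)
    (φ : Schw n) (x : EuclideanSpace ℝ (Fin n)) :
    phaseVar (Sum.inr j) (phaseSchw C φ) x
      = phaseFun C x * (phaseVar (Sum.inr j) φ x - 2 * linCoord C j x * φ x) := by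
  have h1 : HasDerivAt (fun τ : ℝ => quadForm C (x + τ • EuclideanSpace.single j 1))
      (2 * linCoord C j x) 0 := by
    simp only [quadForm_line hC]
    have h2 := (((hasDerivAt_id (0 : ℝ)).mul_const (2 * linCoord C j x)).const_add
      (quadForm C x)).add (((hasDerivAt_id (0 : ℝ)).pow 2).mul_const (C j j))
    exact h2.congr_deriv (by simp)
  have h2 : HasDerivAt (fun τ : ℝ => phaseSchw C φ (x + τ • EuclideanSpace.single j 1))
      (phaseFun C x * (-Complex.I * (2 * linCoord C j x)) * φ x +
        phaseFun C x * fderiv ℝ φ x (EuclideanSpace.single j 1)) 0 := by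
    simp only [phaseSchw_apply]
    have h3 := ((h1.ofReal_comp.const_mul (-Complex.I)).cexp).mul
      (hasDerivAt_line φ x (EuclideanSpace.single j 1))
    exact h3.congr_deriv (by simp [phaseFun])
  rw [phaseVar_inr_eq_of_hasDerivAt h2, phaseVar_inr]
  linear_combination (2 * phaseFun C x * (linCoord C j x) * φ x) * Complex.I_sq

lemma metaplectic_phaseOp (t : ℝ) {C : Matrix (Fin n) (Fin n) ℝ} (hC : C.IsSymm) :
    Metaplectic (phaseOp t C) (phaseSchw (t • C)) (phaseBlock t C) where
  isometric u := by
    refine le_antisymm (Lp.norm_le_norm_of_ae_le ?_) (Lp.norm_le_norm_of_ae_le ?_) <;>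
    · filter_upwards [coeFn_phaseOp t C u] with x hx
      rw [hx, norm_mul, norm_phaseFun, one_mul]
  map φ := phaseOp_toL2 t C φ
  covariant a φ := by
    ext x
    rcases a with j | j
    · simp [phaseBlock, Fintype.sum_sum_type, Matrix.one_apply, ite_smul, phaseVar_inl,
        phaseSchw_apply]
      ring
    · rw [phaseVar_inr_phaseSchw (hC.smul t)]
      simp [phaseBlock, Fintype.sum_sum_type, Matrix.one_apply, ite_smul, phaseVar_inl,
        phaseSchw_apply, linCoord_eq_sum]
      rw [mul_sub, sub_eq_neg_add]
      congr 2
      simp only [Finset.mul_sum, Finset.sum_mul]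
      exact Finset.sum_congr rfl fun k _ => by ring
  symplectic := by
    simp [phaseBlock, sympJ, Matrix.fromBlocks_transpose, Matrix.fromBlocks_multiply, hC.eq]

/-- Taylor's formula when `|θ| ≤ 1`; otherwise the triangle inequality gives `2 + |θ|`, which is at
most `3 θ²`. -/
lemma norm_exp_phase_sub_le (θ : ℝ) :
    ‖Complex.exp (-Complex.I * θ) - 1 + Complex.I * θ‖ ≤ 3 * θ ^ 2 := by
  have hn : ‖-Complex.I * (θ : ℂ)‖ = |θ| := by simp
  rcases le_or_gt |θ| 1 with h | h
  · have h1 := Complex.norm_exp_sub_one_sub_id_le (x := -Complex.I * θ) (by rwa [hn])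
    rw [hn, sq_abs, neg_mul, sub_neg_eq_add] at h1
    rw [neg_mul]
    nlinarith [sq_nonneg θ]
  · calc ‖Complex.exp (-Complex.I * θ) - 1 + Complex.I * θ‖
        ≤ ‖Complex.exp (-Complex.I * θ)‖ + ‖(1 : ℂ)‖ + ‖Complex.I * θ‖ :=
          (norm_add_le _ _).trans (by gcongr; exact norm_sub_le _ _)
      _ ≤ 1 + 1 + |θ| := by
          gcongr
          · exact norm_exp_phase_le θ
          · simp
          · simp
      _ ≤ 3 * θ ^ 2 := by rw [← sq_abs]; nlinarith

/-- Block matrices, as a linear map. -/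
def fromBlocksₗ (n : ℕ) : (Matrix (Fin n) (Fin n) ℝ × Matrix (Fin n) (Fin n) ℝ ×
    Matrix (Fin n) (Fin n) ℝ × Matrix (Fin n) (Fin n) ℝ) →ₗ[ℝ]
    Matrix (Fin n ⊕ Fin n) (Fin n ⊕ Fin n) ℝ where
  toFun p := Matrix.fromBlocks p.1 p.2.1 p.2.2.1 p.2.2.2
  map_add' p q := by simp [Matrix.fromBlocks_add]
  map_smul' c p := by simp [Matrix.fromBlocks_smul]

lemma _root_.HasDerivAt.fromBlocks {A B C D : ℝ → Matrix (Fin n) (Fin n) ℝ}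
    {A' B' C' D' : Matrix (Fin n) (Fin n) ℝ} {t : ℝ} (hA : HasDerivAt A A' t)
    (hB : HasDerivAt B B' t) (hC : HasDerivAt C C' t) (hD : HasDerivAt D D' t) :
    HasDerivAt (fun s => Matrix.fromBlocks (A s) (B s) (C s) (D s))
      (Matrix.fromBlocks A' B' C' D') t :=
  (LinearMap.toContinuousLinearMap (fromBlocksₗ n)).hasFDerivAt.comp_hasDerivAt t
    (hA.prodMk (hB.prodMk (hC.prodMk hD)))

/-- Common shape of the remainders met below, for phases as well as for shears: a quadratic error in
the matrix plus its linearization error. -/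
lemma isLittleO_sq_add {X : Type*} [NormedAddCommGroup X] [NormedSpace ℝ X] {C : ℝ → X} {C' : X}
    {t : ℝ} (hC : HasDerivAt C C' t) (a b : ℝ) :
    (fun s => a * ‖C s - C t‖ ^ 2 + b * ‖C s - C t - (s - t) • C'‖) =o[nhds t]
      fun s => s - t := by
  refine Asymptotics.IsLittleO.add (Asymptotics.IsLittleO.const_mul_left ?_ a)
    (Asymptotics.IsLittleO.const_mul_left ?_ b)
  · have h1 : (fun s => ‖C s - C t‖) =O[nhds t] fun s => s - t := hC.isBigO_sub.norm_left
    have h2 : (fun s => ‖C s - C t‖) =o[nhds t] fun _ => (1 : ℝ) := by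
      rw [Asymptotics.isLittleO_one_iff]
      simpa using (hC.continuousAt.tendsto.sub_const (C t)).norm
    simpa [sq] using h1.mul_isLittleO h2
  · exact (hasDerivAt_iff_isLittleO.1 hC).norm_left

/-- Multiplication of a Schwartz function by the weight `(1 + |x|²)²`. -/
def weighted (φ : Schw n) : Schw n :=
  SchwartzMap.smulLeftCLM ℂ
    (fun x : EuclideanSpace ℝ (Fin n) => (((1 + ‖x‖ ^ 2) ^ 2 : ℝ) : ℂ)) φ

lemma norm_weighted (φ : Schw n) (x : EuclideanSpace ℝ (Fin n)) :
    ‖weighted φ x‖ = (1 + ‖x‖ ^ 2) ^ 2 * ‖φ x‖ := by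
  have h1 : (fun x : EuclideanSpace ℝ (Fin n) =>
      (((1 + ‖x‖ ^ 2) ^ 2 : ℝ) : ℂ)).HasTemperateGrowth := by
    refine hasTemperateGrowth_ofReal (Function.HasTemperateGrowth.pow ?_ 2)
    exact (Function.HasTemperateGrowth.const 1).add (Function.hasTemperateGrowth_norm_sq _)
  rw [weighted, SchwartzMap.smulLeftCLM_apply_apply h1, norm_smul, Complex.norm_real,
    Real.norm_of_nonneg (by positivity)]

lemma quadGen_fromBlocks_left (C : Matrix (Fin n) (Fin n) ℝ) (φ : Schw n)
    (x : EuclideanSpace ℝ (Fin n)) :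
    quadGen (Matrix.fromBlocks ((2 : ℝ) • C) 0 0 0) φ x = -Complex.I * quadForm C x * φ x := by
  simp [quadGen, weyl_apply, Fintype.sum_sum_type, phaseVar_inl, quadForm_eq_sum, Finset.sum_mul,
    Finset.mul_sum]
  refine Finset.sum_congr rfl fun i _ => Finset.sum_congr rfl fun j _ => ?_
  ring

/-- Factoring out the unimodular `phaseFun C` leaves the exponential of the small form of matrix `D
- C`. Its second order error grows like `|x|⁴`, hence the weight `(1 + |x|²)²`, which Schwartz decay
makes square integrable. -/
lemma phaseFun_remainder (C D E : Matrix (Fin n) (Fin n) ℝ) (s : ℝ) (φ : Schw n)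
    (x : EuclideanSpace ℝ (Fin n)) :
    ‖phaseFun D x * φ x - phaseFun C x * φ x
        - (s : ℂ) * (-Complex.I * quadForm E x * (phaseFun C x * φ x))‖
      ≤ (3 * ‖D - C‖ ^ 2 + 1 * ‖D - C - s • E‖) * ‖weighted φ x‖ := by
  have h1 : phaseFun D x = phaseFun C x * Complex.exp (-Complex.I * (quadForm (D - C) x : ℝ)) := by
    rw [phaseFun, phaseFun, ← Complex.exp_add, quadForm_sub]
    congr 1; push_cast; ring
  have h2 : phaseFun D x * φ x - phaseFun C x * φ x
        - (s : ℂ) * (-Complex.I * quadForm E x * (phaseFun C x * φ x))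
      = phaseFun C x * φ x * ((Complex.exp (-Complex.I * (quadForm (D - C) x : ℝ)) - 1
          + Complex.I * (quadForm (D - C) x : ℝ))
          - Complex.I * (quadForm (D - C - s • E) x : ℝ)) := by
    rw [h1, quadForm_sub _ (s • E), quadForm_smul]; push_cast; ring
  have h3 := abs_quadForm_le (D - C) x
  have h4 := abs_quadForm_le (D - C - s • E) x
  rw [h2, norm_mul, norm_mul, norm_phaseFun, one_mul, norm_weighted]
  calc ‖φ x‖ * _ ≤ ‖φ x‖ * (3 * (quadForm (D - C) x) ^ 2 + |quadForm (D - C - s • E) x|) := by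
        gcongr
        refine (norm_sub_le _ _).trans (add_le_add (norm_exp_phase_sub_le _) ?_)
        simp
    _ ≤ ‖φ x‖ * (3 * (‖D - C‖ * ‖x‖ ^ 2) ^ 2 + ‖D - C - s • E‖ * ‖x‖ ^ 2) := by
        rw [← sq_abs (quadForm (D - C) x)]
        gcongr
    _ = (3 * ‖D - C‖ ^ 2 * (‖x‖ ^ 2) ^ 2 + ‖D - C - s • E‖ * ‖x‖ ^ 2) * ‖φ x‖ := by ring
    _ ≤ (3 * ‖D - C‖ ^ 2 * (1 + ‖x‖ ^ 2) ^ 2 + ‖D - C - s • E‖ * (1 + ‖x‖ ^ 2) ^ 2) * ‖φ x‖ := by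
        gcongr
        · linarith
        · nlinarith [sq_nonneg ‖x‖]
    _ = _ := by ring

lemma metaplecticCurveAt_phaseOp {V : ℝ → Matrix (Fin n) (Fin n) ℝ} {t : ℝ}
    (hV : DifferentiableAt ℝ V t) (hs : ∀ᶠ s in nhds t, (V s).IsSymm) :
    MetaplecticCurveAt (fun s => phaseOp s (V s)) (fun s => phaseBlock s (V s)) t := by
  -- The phase depends on `s` both through `s` and through `V s`, so the generator comes from the
  -- derivative of `s • V s` and not from `V t`.
  set C : ℝ → Matrix (Fin n) (Fin n) ℝ := fun s => s • V s with hCdef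
  obtain ⟨C', hC'⟩ : ∃ C', HasDerivAt C C' t :=
    ⟨_, (differentiableAt_id.smul hV).hasDerivAt⟩
  refine ⟨hs.mono fun s h => (metaplectic_phaseOp s h).isometric,
    Matrix.fromBlocks ((2 : ℝ) • C') 0 0 0, _, metaplectic_phaseOp t hs.self_of_nhds, ?_,
    fun φ => ?_⟩
  · have h1 := (hasDerivAt_const t (1 : Matrix (Fin n) (Fin n) ℝ)).fromBlocks
      (hasDerivAt_const t (0 : Matrix (Fin n) (Fin n) ℝ)) ((hC'.const_smul (2 : ℝ)).neg)
      (hasDerivAt_const t (1 : Matrix (Fin n) (Fin n) ℝ))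
    have h2 : (fun s => phaseBlock s (V s)) = fun s => Matrix.fromBlocks 1 0 (-((2 : ℝ) • C s)) 1 := by
      ext1 s
      rw [phaseBlock, hCdef, smul_smul]
    rw [h2]
    refine h1.congr_deriv ?_
    simp [phaseBlock, sympJ, Matrix.fromBlocks_multiply]
  · refine hasDerivAt_Lp_of_bound (isLittleO_sq_add hC' 3 1) (w := toL2 n (weighted φ))
      (Filter.Eventually.of_forall fun s => ?_)
    filter_upwards [coeFn_phaseOp s (V s) (toL2 n φ), coeFn_phaseOp t (V t) (toL2 n φ),
      coeFn_toL2 φ, coeFn_toL2 (weighted φ),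
      coeFn_toL2 (quadGen (Matrix.fromBlocks ((2 : ℝ) • C') 0 0 0) (phaseSchw (t • V t) φ))]
      with x h1 h2 h3 h4 h5
    rw [h1, h2, h3, h4, h5, quadGen_fromBlocks_left, phaseSchw_apply]
    exact phaseFun_remainder (C t) (C s) C' (s - t) φ x

end

end ExactSplitting

namespace ExactSplitting

noncomputable section

variable {n : ℕ}

/-! ### Fourier transform and Fourier multipliers -/

/-- The symplectic matrix of the Fourier transform. -/
def fourierBlock (n : ℕ) : Matrix (Fin n ⊕ Fin n) (Fin n ⊕ Fin n) ℝ :=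
  Matrix.fromBlocks 0 ((2 * Real.pi)⁻¹ • 1) (-((2 * Real.pi) • 1)) 0

/-- The symplectic matrix of the inverse Fourier transform. -/
def fourierInvBlock (n : ℕ) : Matrix (Fin n ⊕ Fin n) (Fin n ⊕ Fin n) ℝ :=
  Matrix.fromBlocks 0 (-((2 * Real.pi)⁻¹ • 1)) ((2 * Real.pi) • 1) 0

lemma inner_single_eq (j : Fin n) : (fun x : EuclideanSpace ℝ (Fin n) =>
    inner ℝ x (EuclideanSpace.single j (1 : ℝ))) = fun x => x j := by
  ext x
  simp [EuclideanSpace.inner_single_right]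

lemma fourier_phaseVar_inr (j : Fin n) (φ : Schw n) (x : EuclideanSpace ℝ (Fin n)) :
    𝓕 (phaseVar (Sum.inr j) φ) x = 2 * Real.pi * (x j * 𝓕 φ x) := by
  have h1 : phaseVar (Sum.inr j) φ
      = (-Complex.I) • (∂_{EuclideanSpace.single j (1 : ℝ)} φ : Schw n) := rfl
  rw [h1, FourierTransform.fourier_smul, SchwartzMap.fourier_lineDerivOp_eq, inner_single_eq]
  simp [SchwartzMap.smulLeftCLM_apply_apply (hasTemperateGrowth_coord_real j)]
  linear_combination (-2 * Real.pi * (x j * 𝓕 φ x)) * Complex.I_sq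

lemma phaseVar_inr_fourier (j : Fin n) (φ : Schw n) :
    phaseVar (Sum.inr j) (𝓕 φ) = -(2 * Real.pi : ℂ) • 𝓕 (phaseVar (Sum.inl j) φ) := by
  have h1 : phaseVar (Sum.inr j) (𝓕 φ)
      = (-Complex.I) • (∂_{EuclideanSpace.single j (1 : ℝ)} (𝓕 φ) : Schw n) := rfl
  have h2 : phaseVar (Sum.inl j) φ = SchwartzMap.smulLeftCLM ℂ
      (fun x : EuclideanSpace ℝ (Fin n) => x j) φ :=
    SchwartzMap.smulLeftCLM_ofReal ℂ (hasTemperateGrowth_coord_real j) φ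
  rw [h1, SchwartzMap.lineDerivOp_fourier_eq, inner_single_eq, ← h2, FourierTransform.fourier_smul,
    smul_smul]
  congr 1
  linear_combination (2 * Real.pi) * Complex.I_sq

lemma metaplectic_fourier : Metaplectic
    ((Lp.fourierTransformₗᵢ (EuclideanSpace ℝ (Fin n)) ℂ).toContinuousLinearEquiv :
      L2 n →L[ℂ] L2 n) (fourierEquiv ℂ (Schw n)).toLinearMap (fourierBlock n) where
  isometric u := (Lp.fourierTransformₗᵢ (EuclideanSpace ℝ (Fin n)) ℂ).norm_map u
  map φ := SchwartzMap.toLp_fourier_eq φ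
  covariant a φ := by
    have hpi : (Real.pi : ℂ) ≠ 0 := by exact_mod_cast Real.pi_ne_zero
    ext x
    rcases a with j | j
    · have h := fourier_phaseVar_inr j φ x
      simp [fourierBlock, Fintype.sum_sum_type, Matrix.one_apply, ite_smul, phaseVar_inl, h]
      field_simp
    · have h := congrArg (fun f : Schw n => f x) (phaseVar_inr_fourier j φ)
      simp [fourierBlock, Fintype.sum_sum_type, Matrix.one_apply, ite_smul] at h ⊢
      exact h
  symplectic := by
    have hpi : Real.pi ≠ 0 := Real.pi_ne_zero
    have h1 : Real.pi⁻¹ * 2⁻¹ * (2 * Real.pi) = 1 := by field_simp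
    have h2 : 2 * Real.pi * (Real.pi⁻¹ * 2⁻¹) = 1 := by field_simp
    simp [fourierBlock, sympJ, Matrix.fromBlocks_transpose, Matrix.fromBlocks_multiply, smul_smul,
      h1, h2]

lemma metaplectic_fourierInv : Metaplectic
    ((Lp.fourierTransformₗᵢ (EuclideanSpace ℝ (Fin n)) ℂ).symm.toContinuousLinearEquiv :
      L2 n →L[ℂ] L2 n) (fourierEquiv ℂ (Schw n)).symm.toLinearMap
    (fourierInvBlock n) where
  isometric u := (Lp.fourierTransformₗᵢ (EuclideanSpace ℝ (Fin n)) ℂ).symm.norm_map u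
  map φ := SchwartzMap.toLp_fourierInv_eq φ
  covariant a φ := by
    have hpi : (Real.pi : ℂ) ≠ 0 := by exact_mod_cast Real.pi_ne_zero
    -- Writing the function as a Fourier transform reduces the covariance of the inverse to the
    -- rules already known for the direct transform.
    obtain ⟨φ, rfl⟩ : ∃ ψ : Schw n, φ = 𝓕 ψ := ⟨𝓕⁻ φ, (FourierTransform.fourier_fourierInv_eq φ).symm⟩
    have hinv : ∀ ψ : Schw n, (fourierEquiv ℂ (Schw n)).symm.toLinearMap ψ = 𝓕⁻ ψ := fun ψ => rfl
    rcases a with j | j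
    · simp [fourierInvBlock, Fintype.sum_sum_type, Matrix.one_apply, ite_smul, hinv,
        phaseVar_inr_fourier, FourierTransform.fourierInv_smul, FourierTransform.fourierInv_neg]
      ext x
      simp only [smul_apply, Complex.real_smul, smul_eq_mul]
      push_cast
      field_simp
    · have h : phaseVar (Sum.inl j) (𝓕 φ) = (2 * Real.pi : ℂ)⁻¹ • 𝓕 (phaseVar (Sum.inr j) φ) := by
        ext x
        rw [smul_apply, fourier_phaseVar_inr, phaseVar_inl, smul_eq_mul]
        field_simp
      simp [fourierInvBlock, Fintype.sum_sum_type, Matrix.one_apply, ite_smul, hinv, h,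
        FourierTransform.fourierInv_smul]
      ext x
      simp only [smul_apply, Complex.real_smul, smul_eq_mul]
      push_cast
      field_simp
  symplectic := by
    have hpi : Real.pi ≠ 0 := Real.pi_ne_zero
    have h1 : Real.pi⁻¹ * 2⁻¹ * (2 * Real.pi) = 1 := by field_simp
    have h2 : 2 * Real.pi * (Real.pi⁻¹ * 2⁻¹) = 1 := by field_simp
    simp [fourierInvBlock, sympJ, Matrix.fromBlocks_transpose, Matrix.fromBlocks_multiply,
      smul_smul, h1, h2]

/-- The factor `2π` between the two frequency conventions is absorbed in the matrix of the form, so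
Fourier multipliers become conjugated phases and need no separate analysis. -/
lemma fourierPhaseOp_eq (t : ℝ) (A : Matrix (Fin n) (Fin n) ℝ) : fourierPhaseOp t A =
    ((Lp.fourierTransformₗᵢ (EuclideanSpace ℝ (Fin n)) ℂ).symm.toContinuousLinearEquiv :
      L2 n →L[ℂ] L2 n) * phaseOp t ((2 * Real.pi) ^ 2 • A) *
    ((Lp.fourierTransformₗᵢ (EuclideanSpace ℝ (Fin n)) ℂ).toContinuousLinearEquiv :
      L2 n →L[ℂ] L2 n) := by
  simp only [fourierPhaseOp, phaseOp, quadForm_smul_right, quadForm_smul]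

lemma fourierBlock_conj (t : ℝ) (A : Matrix (Fin n) (Fin n) ℝ) :
    fourierInvBlock n * phaseBlock t ((2 * Real.pi) ^ 2 • A) * fourierBlock n
      = Matrix.fromBlocks 1 ((2 * t) • A) 0 1 := by
  have hpi : Real.pi ≠ 0 := Real.pi_ne_zero
  have h1 : Real.pi⁻¹ * 2⁻¹ * (2 * Real.pi) = 1 := by field_simp
  have h2 : 2 * Real.pi * (Real.pi⁻¹ * 2⁻¹) = 1 := by field_simp
  have h3 : Real.pi⁻¹ * 2⁻¹ * (2 * t * (2 * Real.pi) ^ 2 * (Real.pi⁻¹ * 2⁻¹)) = 2 * t := by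
    field_simp
  simp [fourierBlock, fourierInvBlock, phaseBlock, Matrix.fromBlocks_multiply, smul_smul,
    h1, h2, h3]

lemma metaplecticCurveAt_fourierPhaseOp {A : ℝ → Matrix (Fin n) (Fin n) ℝ} {t : ℝ}
    (hA : DifferentiableAt ℝ A t) (hs : ∀ᶠ s in nhds t, (A s).IsSymm) :
    MetaplecticCurveAt (fun s => fourierPhaseOp s (A s))
      (fun s => Matrix.fromBlocks 1 ((2 * s) • A s) 0 1) t := by
  have h1 := ((MetaplecticCurveAt.const metaplectic_fourierInv t).mul
    (metaplecticCurveAt_phaseOp (V := fun s => (2 * Real.pi) ^ 2 • A s) (hA.const_smul ((2 * Real.pi) ^ 2))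
      (hs.mono fun s h => h.smul _))).mul (MetaplecticCurveAt.const metaplectic_fourier t)
  simpa only [fourierPhaseOp_eq, fourierBlock_conj] using h1

end

end ExactSplitting

namespace ExactSplitting

noncomputable section

variable {n : ℕ}

/-! ### Composition with linear maps -/

/-- Second order Taylor bound from two uses of the mean value inequality on the segment: first for
the derivative, then for `φ` minus its linear part. The non-optimal constant `c` suffices. -/
lemma segment_remainder_le (φ : Schw n) {y h : EuclideanSpace ℝ (Fin n)} {c : ℝ}
    (hc : ∀ z ∈ segment ℝ y (y + h), ‖fderiv ℝ (fderiv ℝ φ) z‖ ≤ c) :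
    ‖φ (y + h) - φ y - fderiv ℝ φ y h‖ ≤ c * ‖h‖ ^ 2 := by
  have hd : ∀ z, HasFDerivAt (fderiv ℝ φ) (fderiv ℝ (fderiv ℝ φ) z) z := fun z =>
    (fderivCLM ℝ (EuclideanSpace ℝ (Fin n)) ℂ φ).hasFDerivAt z
  have hconv := convex_segment (𝕜 := ℝ) y (y + h)
  have hy : y ∈ segment ℝ y (y + h) := left_mem_segment ℝ _ _
  have hyh : y + h ∈ segment ℝ y (y + h) := right_mem_segment ℝ _ _
  have h0 : 0 ≤ c := (ContinuousLinearMap.opNorm_nonneg _).trans (hc y hy)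
  have hseg : ∀ z ∈ segment ℝ y (y + h), ‖z - y‖ ≤ ‖h‖ := by
    intro z hz
    rw [segment_eq_image'] at hz
    obtain ⟨θ, ⟨h1, h2⟩, rfl⟩ := hz
    rw [add_sub_cancel_left, add_sub_cancel_left, norm_smul, Real.norm_of_nonneg h1]
    exact mul_le_of_le_one_left (norm_nonneg _) h2
  have h1 : ∀ z ∈ segment ℝ y (y + h), ‖fderiv ℝ φ z - fderiv ℝ φ y‖ ≤ c * ‖h‖ := by
    intro z hz
    refine (hconv.norm_image_sub_le_of_norm_hasFDerivWithin_le
      (fun w _ => (hd w).hasFDerivWithinAt) hc hy hz).trans ?_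
    gcongr
    exact hseg z hz
  have h2 := hconv.norm_image_sub_le_of_norm_hasFDerivWithin_le
    (f := fun z => φ z - fderiv ℝ φ y z)
    (fun z _ => ((φ.hasFDerivAt z).sub (fderiv ℝ φ y).hasFDerivAt).hasFDerivWithinAt) h1 hy hyh
  simp only [map_add, add_sub_cancel_left] at h2
  calc _ = ‖φ (y + h) - (fderiv ℝ φ y y + fderiv ℝ φ y h) - (φ y - fderiv ℝ φ y y)‖ := by
        congr 1; ring
    _ ≤ _ := h2
    _ = _ := by ring

lemma exists_decay (φ : Schw n) (m : ℕ) : ∃ K : ℝ, 0 ≤ K ∧ ∀ z,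
    (1 + ‖z‖) ^ m * ‖fderiv ℝ φ z‖ ≤ K ∧ (1 + ‖z‖) ^ m * ‖fderiv ℝ (fderiv ℝ φ) z‖ ≤ K := by
  set φ₁ := fderivCLM ℝ (EuclideanSpace ℝ (Fin n)) ℂ φ
  set φ₂ := fderivCLM ℝ (EuclideanSpace ℝ (Fin n)) (EuclideanSpace ℝ (Fin n) →L[ℝ] ℂ) φ₁
  have h1 := SchwartzMap.one_add_le_sup_seminorm_apply (𝕜 := ℝ) (m := (m, 0)) le_rfl le_rfl φ₁
  have h2 := SchwartzMap.one_add_le_sup_seminorm_apply (𝕜 := ℝ) (m := (m, 0)) le_rfl le_rfl φ₂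
  simp only [norm_iteratedFDeriv_zero] at h1 h2
  exact ⟨max _ _, (by positivity : (0 : ℝ) ≤ _).trans ((h1 0).trans (le_max_left _ _)),
    fun z => ⟨(h1 z).trans (le_max_left _ _), (h2 z).trans (le_max_right _ _)⟩⟩

/-- When `G₀` is bounded below by `1/κ` and `G` is within `1/(2κ)` of it, every point of the segment
from `G₀ x` to `G x` has size at least comparable to `|x|`. Decay of the derivatives of `φ` along
the segment thus becomes decay in `x`, uniformly in `G`. -/
lemma comp_remainder_le (φ : Schw n) (k : ℕ) {κ : ℝ} (hκ : 1 ≤ κ) : ∃ K : ℝ, 0 ≤ K ∧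
    ∀ (G₀ G E : Matrix (Fin n) (Fin n) ℝ) (s : ℝ),
      (∀ x, ‖x‖ ≤ κ * ‖Matrix.toEuclideanLin G₀ x‖) → ‖G - G₀‖ ≤ (2 * κ)⁻¹ → ∀ x,
      (1 + ‖x‖) ^ k * ‖φ (Matrix.toEuclideanLin G x) - φ (Matrix.toEuclideanLin G₀ x)
        - s * fderiv ℝ φ (Matrix.toEuclideanLin G₀ x) (Matrix.toEuclideanLin E x)‖
      ≤ K * ‖G - G₀‖ ^ 2 + K * ‖G - G₀ - s • E‖ := by
  -- Two powers absorb the factor `|x|²` of the quadratic remainder, and `k` powers are left for the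
  -- weight.
  obtain ⟨K, hK, hdec⟩ := exists_decay φ (k + 2)
  refine ⟨(2 * κ) ^ (k + 2) * K, by positivity, fun G₀ G E s hG₀ hG x => ?_⟩
  set y := Matrix.toEuclideanLin G₀ x
  set h := Matrix.toEuclideanLin (G - G₀) x with hh
  have hyh : Matrix.toEuclideanLin G x = y + h := by simp [hh, y]
  have hx : 0 < 1 + ‖x‖ := by positivity
  have hhx : ‖h‖ ≤ ‖G - G₀‖ * ‖x‖ := norm_mulVec_le _ _
  have hseg : ∀ z ∈ segment ℝ y (y + h), 1 + ‖x‖ ≤ 2 * κ * (1 + ‖z‖) := by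
    intro z hz
    rw [segment_eq_image'] at hz
    obtain ⟨θ, ⟨h1, h2⟩, rfl⟩ := hz
    rw [add_sub_cancel_left]
    have h3 : ‖y‖ ≤ ‖y + θ • h‖ + ‖h‖ := by
      have h4 := norm_sub_le (y + θ • h) (θ • h)
      rw [add_sub_cancel_right, norm_smul, Real.norm_of_nonneg h1] at h4
      nlinarith [norm_nonneg h]
    have h5 : ‖h‖ ≤ (2 * κ)⁻¹ * ‖x‖ := hhx.trans (by gcongr)
    have h6 : 2 * κ * ((2 * κ)⁻¹ * ‖x‖) = ‖x‖ := by field_simp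
    have h7 := hG₀ x
    nlinarith
  have hbd : ∀ z ∈ segment ℝ y (y + h), ∀ b, (1 + ‖z‖) ^ (k + 2) * b ≤ K → 0 ≤ b →
      b ≤ (2 * κ) ^ (k + 2) * K / (1 + ‖x‖) ^ (k + 2) := by
    intro z hz b hb hb0
    rw [le_div_iff₀ (by positivity)]
    calc b * (1 + ‖x‖) ^ (k + 2) ≤ b * (2 * κ * (1 + ‖z‖)) ^ (k + 2) := by
          gcongr; exact hseg z hz
      _ = (2 * κ) ^ (k + 2) * ((1 + ‖z‖) ^ (k + 2) * b) := by
          rw [mul_pow (2 * κ)]; ring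
      _ ≤ _ := by gcongr
  have h1 := segment_remainder_le φ (fun z hz => hbd z hz _ (hdec z).2
    (ContinuousLinearMap.opNorm_nonneg _))
  have h2 := hbd y (left_mem_segment ℝ _ _) _ (hdec y).1
    (ContinuousLinearMap.opNorm_nonneg _)
  have h3 : φ (y + h) - φ y - s * fderiv ℝ φ y (Matrix.toEuclideanLin E x)
      = (φ (y + h) - φ y - fderiv ℝ φ y h)
        + fderiv ℝ φ y (Matrix.toEuclideanLin (G - G₀ - s • E) x) := by
    have h4 : Matrix.toEuclideanLin (G - G₀ - s • E) x = h - s • Matrix.toEuclideanLin E x := by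
      simp [hh]
    rw [h4, map_sub, map_smul, Complex.real_smul]
    ring
  rw [hyh, h3]
  set c := (2 * κ) ^ (k + 2) * K with hc
  have hc0 : 0 ≤ c := by positivity
  have h5 : ‖(φ (y + h) - φ y - fderiv ℝ φ y h)
        + fderiv ℝ φ y (Matrix.toEuclideanLin (G - G₀ - s • E) x)‖
      ≤ c / (1 + ‖x‖) ^ (k + 2) * (‖G - G₀‖ * ‖x‖) ^ 2
        + c / (1 + ‖x‖) ^ (k + 2) * (‖G - G₀ - s • E‖ * ‖x‖) := by
    refine (norm_add_le _ _).trans (add_le_add (h1.trans (by gcongr)) ?_)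
    refine ((fderiv ℝ φ y).le_opNorm _).trans ?_
    gcongr
    exact norm_mulVec_le _ _
  have h6 : (1 + ‖x‖) ^ k * (c / (1 + ‖x‖) ^ (k + 2)) = c / (1 + ‖x‖) ^ 2 := by
    field_simp
    ring
  have h7 : ‖x‖ ^ 2 / (1 + ‖x‖) ^ 2 ≤ 1 := by
    rw [div_le_one (by positivity)]; gcongr; linarith
  have h8 : ‖x‖ / (1 + ‖x‖) ^ 2 ≤ 1 := by
    rw [div_le_one (by positivity)]; nlinarith [norm_nonneg x]
  calc _ ≤ (1 + ‖x‖) ^ k * (c / (1 + ‖x‖) ^ (k + 2) * (‖G - G₀‖ * ‖x‖) ^ 2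
        + c / (1 + ‖x‖) ^ (k + 2) * (‖G - G₀ - s • E‖ * ‖x‖)) := by gcongr
    _ = c * ‖G - G₀‖ ^ 2 * (‖x‖ ^ 2 / (1 + ‖x‖) ^ 2)
        + c * ‖G - G₀ - s • E‖ * (‖x‖ / (1 + ‖x‖) ^ 2) := by
        rw [mul_add, ← mul_assoc, h6, ← mul_assoc, h6]; ring
    _ ≤ c * ‖G - G₀‖ ^ 2 * 1 + c * ‖G - G₀ - s • E‖ * 1 := by gcongr
    _ = _ := by ring

/-- An explicit square integrable weight. -/
lemma exists_weight : ∃ (k : ℕ) (w : L2 n), w =ᵐ[volume]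
    fun x : EuclideanSpace ℝ (Fin n) => (((1 + ‖x‖) ^ k)⁻¹ : ℝ) := by
  obtain ⟨k, hk⟩ := Measure.HasTemperateGrowth.exists_eLpNorm_lt_top
    (μ := (volume : Measure (EuclideanSpace ℝ (Fin n)))) 2 inferInstance
  have h1 : MemLp (fun x : EuclideanSpace ℝ (Fin n) => ((((1 + ‖x‖) ^ k)⁻¹ : ℝ) : ℂ)) 2 volume := by
    refine ⟨Continuous.aestronglyMeasurable ?_, ?_⟩
    · exact Complex.continuous_ofReal.comp
        (Continuous.inv₀ (by fun_prop) fun x => by positivity)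
    · refine (eLpNorm_congr_norm_ae (Filter.Eventually.of_forall fun x => ?_)).trans_lt hk
      rw [Complex.norm_real, Real.rpow_neg (by positivity), Real.rpow_natCast]
  exact ⟨k, h1.toLp, h1.coeFn_toLp⟩

end

end ExactSplitting

namespace ExactSplitting

noncomputable section

variable {n : ℕ}

/-! ### Shears -/

lemma rowPart_apply (j : Fin n) (C : Matrix (Fin n) (Fin n) ℝ) (a b : Fin n) :
    rowPart j C a b = if a = j then C j b else 0 := by
  rw [rowPart]
  split_ifs with h
  · subst h; simp
  · simp [Matrix.mul_apply, Ne.symm h]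

/-- Only row `j` is nonzero, and it meets row `j` of the other factor through the entry `C j j = 0`.
This nilpotency is why each one-coordinate transport is an exact shear. -/
lemma rowPart_mul_rowPart {j : Fin n} {C : Matrix (Fin n) (Fin n) ℝ} (hC : C j j = 0)
    (D : Matrix (Fin n) (Fin n) ℝ) : rowPart j C * rowPart j D = 0 := by
  ext a b
  simp only [Matrix.mul_apply, rowPart_apply, Matrix.zero_apply]
  refine Finset.sum_eq_zero fun k _ => ?_
  by_cases hk : k = j
  · subst hk; simp [hC]
  · simp [hk]

lemma rowPart_diag {j : Fin n} {C : Matrix (Fin n) (Fin n) ℝ} (hC : C j j = 0) (a : Fin n) :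
    rowPart j C a a = 0 := by
  rw [rowPart_apply]
  split_ifs with h
  · rw [h, hC]
  · rfl

lemma rowPart_smul (j : Fin n) (t : ℝ) (C : Matrix (Fin n) (Fin n) ℝ) :
    rowPart j (t • C) = t • rowPart j C := by
  simp [rowPart]

/-- Sylvester's identity `det (1 - X Y) = det (1 - Y X)`, with `X` the projection on coordinate `j`
and `Y X = 0`. Each shear thus preserves volume. -/
lemma det_one_sub_rowPart {j : Fin n} {C : Matrix (Fin n) (Fin n) ℝ} (hC : C j j = 0) :
    (1 - rowPart j C).det = 1 := by
  have h1 : rowPart j C = Matrix.single j j 1 * rowPart j C := by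
    rw [rowPart, ← mul_assoc, Matrix.single_mul_single_same, one_mul]
  have h2 : rowPart j C * Matrix.single j j 1 = 0 := by
    have : (Matrix.single j j 1 : Matrix (Fin n) (Fin n) ℝ) = rowPart j 1 := by simp [rowPart]
    rw [this, rowPart_mul_rowPart hC]
  rw [h1, Matrix.det_one_sub_mul_comm, h2, sub_zero, Matrix.det_one]

lemma one_add_mul_one_sub {N : Matrix (Fin n) (Fin n) ℝ} (hN : N * N = 0) :
    (1 + N) * (1 - N) = 1 := by
  rw [add_mul, mul_sub, mul_sub, hN]; simp

lemma one_sub_mul_one_add {N : Matrix (Fin n) (Fin n) ℝ} (hN : N * N = 0) :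
    (1 - N) * (1 + N) = 1 := by
  rw [sub_mul, mul_add, mul_add, hN]; simp

lemma exp_neg_of_sq_zero {N : Matrix (Fin n) (Fin n) ℝ} (hN : N * N = 0) :
    NormedSpace.exp (-N) = 1 - N := by
  rw [NormedSpace.exp_eq_tsum ℝ]
  simp only
  rw [tsum_eq_sum (s := Finset.range 2)]
  · simp [Finset.sum_range_succ, sub_eq_add_neg]
  · intro k hk
    simp only [Finset.mem_range, not_lt] at hk
    obtain ⟨l, rfl⟩ := Nat.exists_eq_add_of_le hk
    rw [pow_add, sq, neg_mul_neg, hN, zero_mul, smul_zero]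

lemma flowMap_neg {N : Matrix (Fin n) (Fin n) ℝ} (hN : N * N = 0) :
    flowMap (-N) = Matrix.toEuclideanLin (1 - N) := by
  rw [flowMap, exp_neg_of_sq_zero hN]

lemma toEuclideanLin_mul_apply (M N : Matrix (Fin n) (Fin n) ℝ) (x : EuclideanSpace ℝ (Fin n)) :
    Matrix.toEuclideanLin M (Matrix.toEuclideanLin N x) = Matrix.toEuclideanLin (M * N) x := by
  simp [Matrix.toLpLin_apply]

/-- The linear map `x ↦ (1 - N) x`, invertible when `N² = 0`. -/
def shearEquiv {N : Matrix (Fin n) (Fin n) ℝ} (hN : N * N = 0) :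
    EuclideanSpace ℝ (Fin n) ≃L[ℝ] EuclideanSpace ℝ (Fin n) :=
  LinearEquiv.toContinuousLinearEquiv
    { Matrix.toEuclideanLin (1 - N) with
      invFun := Matrix.toEuclideanLin (1 + N)
      left_inv := fun x => by
        have h : (1 + N) * (1 - N) = 1 := one_add_mul_one_sub hN
        change Matrix.toEuclideanLin (1 + N) (Matrix.toEuclideanLin (1 - N) x) = x
        rw [toEuclideanLin_mul_apply, h]; simp
      right_inv := fun x => by
        have h : (1 - N) * (1 + N) = 1 := one_sub_mul_one_add hN
        change Matrix.toEuclideanLin (1 - N) (Matrix.toEuclideanLin (1 + N) x) = x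
        rw [toEuclideanLin_mul_apply, h]; simp }

/-- Composition with `1 - N` on Schwartz functions. -/
def shearSchw {N : Matrix (Fin n) (Fin n) ℝ} (hN : N * N = 0) : Schw n →ₗ[ℂ] Schw n :=
  (SchwartzMap.compCLMOfContinuousLinearEquiv ℂ (shearEquiv hN) : Schw n →L[ℂ] Schw n)

lemma shearSchw_apply {N : Matrix (Fin n) (Fin n) ℝ} (hN : N * N = 0) (φ : Schw n)
    (x : EuclideanSpace ℝ (Fin n)) :
    shearSchw hN φ x = φ (Matrix.toEuclideanLin (1 - N) x) := rfl

lemma fderiv_shearSchw {N : Matrix (Fin n) (Fin n) ℝ} (hN : N * N = 0) (φ : Schw n)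
    (x v : EuclideanSpace ℝ (Fin n)) :
    fderiv ℝ (shearSchw hN φ) x v = fderiv ℝ φ (Matrix.toEuclideanLin (1 - N) x)
      (Matrix.toEuclideanLin (1 - N) v) := by
  have h1 : HasFDerivAt (shearSchw hN φ) ((fderiv ℝ φ (shearEquiv hN x)).comp
      (shearEquiv hN : EuclideanSpace ℝ (Fin n) →L[ℝ] EuclideanSpace ℝ (Fin n))) x :=
    (φ.hasFDerivAt (shearEquiv hN x)).comp x (shearEquiv hN).hasFDerivAt
  rw [h1.fderiv]
  rfl

lemma eq_sum_single (v : EuclideanSpace ℝ (Fin n)) :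
    v = ∑ a, v a • EuclideanSpace.single a (1 : ℝ) := by
  ext i
  simp [Finset.sum_apply, Pi.single_apply]

lemma fderiv_apply_eq_sum (φ : Schw n) (x v : EuclideanSpace ℝ (Fin n)) :
    fderiv ℝ φ x v = ∑ a, (v a : ℂ) * (Complex.I * phaseVar (Sum.inr a) φ x) := by
  conv_lhs => rw [eq_sum_single v]
  rw [map_sum]
  refine Finset.sum_congr rfl fun a _ => ?_
  rw [map_smul, phaseVar_inr, Complex.real_smul]
  linear_combination (v a : ℂ) * fderiv ℝ φ x (EuclideanSpace.single a 1) * Complex.I_sq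

/-- Canonical commutation relation between position and momentum; it is the only source of ordering
corrections in the file. -/
lemma phaseVar_inr_inl (a b : Fin n) (φ : Schw n) (x : EuclideanSpace ℝ (Fin n)) :
    phaseVar (Sum.inr a) (phaseVar (Sum.inl b) φ) x
      = x b * phaseVar (Sum.inr a) φ x - (if a = b then Complex.I * φ x else 0) := by
  have h1 : HasDerivAt (fun τ : ℝ => ((x + τ • EuclideanSpace.single a (1 : ℝ)) b : ℝ))
      (if a = b then 1 else 0) 0 := by
    have h2 := ((hasDerivAt_id (0 : ℝ)).mul_const
      ((EuclideanSpace.single a (1 : ℝ) : EuclideanSpace ℝ (Fin n)) b)).const_add (x b)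
    refine h2.congr_deriv ?_
    simp [eq_comm]
  have h2 : HasDerivAt (fun τ : ℝ => phaseVar (Sum.inl b) φ (x + τ • EuclideanSpace.single a 1))
      (((if a = b then 1 else 0 : ℝ) : ℂ) * φ x +
        x b * fderiv ℝ φ x (EuclideanSpace.single a 1)) 0 := by
    simp only [phaseVar_inl]
    refine (h1.ofReal_comp.mul (hasDerivAt_line φ x (EuclideanSpace.single a 1))).congr_deriv ?_
    simp
  rw [phaseVar_inr_eq_of_hasDerivAt h2, phaseVar_inr]
  split_ifs <;> push_cast <;> ring

/-- The two orderings of `x_b` and `-i∂_a` differ only for `a = b`, where the coefficient vanishes,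
so the Weyl quantization is the plain vector field without a divergence term. -/
lemma quadGen_fromBlocks_offDiag {N : Matrix (Fin n) (Fin n) ℝ} (hN : ∀ a, N a a = 0)
    (φ : Schw n) (x : EuclideanSpace ℝ (Fin n)) :
    quadGen (Matrix.fromBlocks 0 Nᵀ N 0) φ x
      = -fderiv ℝ φ x (Matrix.toEuclideanLin N x) := by
  have h1 : ∀ a b, (N a b : ℂ) * phaseVar (Sum.inr a) (phaseVar (Sum.inl b) φ) x
      = (N a b : ℂ) * (x b * phaseVar (Sum.inr a) φ x) := by
    intro a b
    rw [phaseVar_inr_inl]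
    split_ifs with h
    · subst h; simp [hN]
    · rw [sub_zero]
  have h2 : ∀ a b, (N b a : ℂ) * phaseVar (Sum.inl a) (phaseVar (Sum.inr b) φ) x
      = (N b a : ℂ) * (x a * phaseVar (Sum.inr b) φ x) := by
    intro a b
    rw [phaseVar_inl]
  have h3 : weyl (Matrix.fromBlocks 0 Nᵀ N 0) φ x
      = ∑ a, ∑ b, (N a b : ℂ) * (x b * phaseVar (Sum.inr a) φ x) := by
    simp only [weyl_apply, Fintype.sum_sum_type, Matrix.fromBlocks_apply₁₁,
      Matrix.fromBlocks_apply₁₂, Matrix.fromBlocks_apply₂₁, Matrix.fromBlocks_apply₂₂,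
      Matrix.zero_apply, Complex.ofReal_zero, zero_smul, Finset.sum_const_zero, zero_add,
      add_zero, Matrix.transpose_apply, smul_apply, add_apply, sum_apply, smul_eq_mul, h1, h2]
    rw [Finset.sum_comm]
    ring
  rw [quadGen, LinearMap.smul_apply, smul_apply, h3, fderiv_apply_eq_sum, smul_eq_mul,
    Finset.mul_sum, ← Finset.sum_neg_distrib]
  refine Finset.sum_congr rfl fun a _ => ?_
  simp only [Matrix.toLpLin_apply, Matrix.mulVec, dotProduct]
  push_cast
  simp only [Finset.mul_sum, Finset.sum_mul, ← Finset.sum_neg_distrib]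
  exact Finset.sum_congr rfl fun b _ => by ring

lemma coeFn_transportOp (N : Matrix (Fin n) (Fin n) ℝ) (u : L2 n) :
    transportOp N u =ᵐ[volume] fun x => u (flowMap N x) :=
  (memLp_comp_flowMap N u).coeFn_toLp

lemma transportOp_toL2 {N : Matrix (Fin n) (Fin n) ℝ} (hN : N * N = 0) (φ : Schw n) :
    transportOp (-N) (toL2 n φ) = toL2 n (shearSchw hN φ) := by
  refine Lp.ext ?_
  filter_upwards [coeFn_transportOp (-N) (toL2 n φ), coeFn_toL2 (shearSchw hN φ),
    (quasiMeasurePreserving_flowMap (-N)).ae (coeFn_toL2 φ)] with x h1 h2 h3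
  rw [h1, h2, h3, shearSchw_apply, flowMap_neg hN]

lemma norm_transportOp {N : Matrix (Fin n) (Fin n) ℝ} (hN : N * N = 0) (hd : (1 - N).det = 1)
    (u : L2 n) : ‖transportOp (-N) u‖ = ‖u‖ := by
  have h1 : LinearMap.det (flowMap (-N)) = 1 := by
    rw [flowMap_neg hN, ← hd]
    change LinearMap.det (Matrix.toLpLin 2 2 (1 - N)) = _
    rw [Matrix.toLpLin_eq_toLin, LinearMap.det_toLin]
  change ‖(memLp_comp_flowMap (-N) u).toLp‖ = _
  rw [Lp.norm_toLp, eLpNorm_comp_flowMap, h1, Lp.norm_def]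
  simp

lemma metaplectic_transportOp {N : Matrix (Fin n) (Fin n) ℝ} (hN : N * N = 0)
    (hd : (1 - N).det = 1) : Metaplectic (transportOp (-N)) (shearSchw hN)
      (Matrix.fromBlocks (1 + N) 0 0 (1 - Nᵀ)) where
  isometric := norm_transportOp hN hd
  map := transportOp_toL2 hN
  covariant a φ := by
    ext x
    rcases a with j | j
    · have h1 : (x j : ℂ) = ∑ k, ((1 + N : Matrix (Fin n) (Fin n) ℝ) j k : ℂ) * (Matrix.toEuclideanLin (1 - N) x k : ℂ) := by
        have h : (1 + N) * (1 - N) = 1 := one_add_mul_one_sub hN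
        have h2 := toEuclideanLin_mul_apply (1 + N) (1 - N) x
        rw [h] at h2
        have h3 : x j = Matrix.toEuclideanLin (1 + N) (Matrix.toEuclideanLin (1 - N) x) j := by
          rw [h2]; simp
        rw [h3]
        have h4 : Matrix.toEuclideanLin (1 + N) (Matrix.toEuclideanLin (1 - N) x) j
            = ∑ k, (1 + N : Matrix (Fin n) (Fin n) ℝ) j k * Matrix.toEuclideanLin (1 - N) x k := rfl
        rw [h4, Complex.ofReal_sum]
        exact Finset.sum_congr rfl fun k _ => Complex.ofReal_mul _ _
      simp only [Fintype.sum_sum_type, Matrix.fromBlocks_apply₁₁, Matrix.fromBlocks_apply₁₂,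
        Matrix.zero_apply, Complex.ofReal_zero, zero_smul, Finset.sum_const_zero, add_zero,
        sum_apply, smul_apply, phaseVar_inl, shearSchw_apply, smul_eq_mul]
      rw [h1, Finset.sum_mul]
      exact Finset.sum_congr rfl fun k _ => by ring
    · simp only [Fintype.sum_sum_type, Matrix.fromBlocks_apply₂₁, Matrix.fromBlocks_apply₂₂,
        Matrix.zero_apply, Complex.ofReal_zero, zero_smul, Finset.sum_const_zero, zero_add,
        sum_apply, smul_apply, shearSchw_apply, smul_eq_mul]
      rw [phaseVar_inr, fderiv_shearSchw, fderiv_apply_eq_sum, Finset.mul_sum]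
      refine Finset.sum_congr rfl fun k _ => ?_
      have h1 : (Matrix.toEuclideanLin (1 - N) (EuclideanSpace.single j 1)) k
          = (1 - Nᵀ) j k := by
        rw [← Matrix.transpose_one, ← Matrix.transpose_sub, Matrix.transpose_apply]
        simp [Matrix.toLpLin_apply, Matrix.one_apply]
      rw [h1]
      linear_combination (-((1 - Nᵀ) j k : ℝ) : ℂ) *
        phaseVar (Sum.inr k) φ (Matrix.toEuclideanLin (1 - N) x) * Complex.I_sq
  symplectic := by
    have h : (1 - N) * (1 + N) = 1 := one_sub_mul_one_add hN
    have h' : (1 + Nᵀ) * (1 - Nᵀ) = 1 := by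
      rw [← Matrix.transpose_one, ← Matrix.transpose_add, ← Matrix.transpose_sub,
        ← Matrix.transpose_mul, h]
    simp [sympJ, Matrix.fromBlocks_transpose, Matrix.fromBlocks_multiply, h']
    rw [← neg_sub 1 N, neg_mul, h]

/-- The products `N t * N'` and `N' * N t` vanish because, in the application, all matrices are
supported on one row with zero diagonal. The velocity then passes unchanged through the shear, both
in the transported function and in the block matrix. -/
lemma metaplecticCurveAt_transportOp_aux {N : ℝ → Matrix (Fin n) (Fin n) ℝ}
    {N' : Matrix (Fin n) (Fin n) ℝ} {t : ℝ} (hN : HasDerivAt N N' t)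
    (hsq : ∀ᶠ s in nhds t, N s * N s = 0 ∧ (1 - N s).det = 1)
    (h1 : N t * N' = 0) (h2 : N' * N t = 0) (h3 : ∀ a, N' a a = 0) :
    MetaplecticCurveAt (fun s => transportOp (-(N s)))
      (fun s => Matrix.fromBlocks (1 + N s) 0 0 (1 - (N s)ᵀ)) t := by
  have hsqt := hsq.self_of_nhds
  refine ⟨hsq.mono fun s h => norm_transportOp h.1 h.2, Matrix.fromBlocks 0 N'ᵀ N' 0, _,
    metaplectic_transportOp hsqt.1 hsqt.2, ?_, fun φ => ?_⟩
  · have hT : HasDerivAt (fun s => (N s)ᵀ) N'ᵀ t :=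
      (LinearMap.toContinuousLinearMap
        (Matrix.transposeLinearEquiv (Fin n) (Fin n) ℝ ℝ).toLinearMap).hasFDerivAt.comp_hasDerivAt t hN
    refine ((hN.const_add 1).fromBlocks (hasDerivAt_const t _) (hasDerivAt_const t _)
      (hT.const_sub 1)).congr_deriv ?_
    have h4 : N'ᵀ * (N t)ᵀ = 0 := by rw [← Matrix.transpose_mul, h1, Matrix.transpose_zero]
    simp [sympJ, Matrix.fromBlocks_multiply, mul_add, mul_sub, h2, h4]
  · obtain ⟨k, w, hw⟩ := exists_weight (n := n)
    -- Since `1 + N t` inverts `1 - N t`, its norm bounds `|x|` by the size of the image of `x`; the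
    -- extra `1` ensures `1 ≤ κ`.
    set κ : ℝ := 1 + ‖1 + N t‖ with hκ
    have hκ1 : 1 ≤ κ := by rw [hκ]; linarith [norm_nonneg (1 + N t)]
    obtain ⟨K, hK, hrem⟩ := comp_remainder_le φ k hκ1
    have hG : HasDerivAt (fun s => 1 - N s) (-N') t := hN.const_sub 1
    have hbd : ∀ x, ‖x‖ ≤ κ * ‖Matrix.toEuclideanLin (1 - N t) x‖ := by
      intro x
      have h : (1 + N t) * (1 - N t) = 1 := one_add_mul_one_sub hsqt.1
      have h4 := norm_mulVec_le (1 + N t) (Matrix.toEuclideanLin (1 - N t) x)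
      rw [toEuclideanLin_mul_apply, h] at h4
      have h5 : Matrix.toEuclideanLin (1 : Matrix (Fin n) (Fin n) ℝ) x = x := by simp
      rw [h5] at h4
      nlinarith [norm_nonneg (Matrix.toEuclideanLin (1 - N t) x)]
    have hnear : ∀ᶠ s in nhds t, ‖(1 - N s) - (1 - N t)‖ ≤ (2 * κ)⁻¹ := by
      have h4 : Filter.Tendsto (fun s => ‖(1 - N s) - (1 - N t)‖) (nhds t) (nhds 0) := by
        simpa using (hG.continuousAt.tendsto.sub_const (1 - N t)).norm
      exact h4.eventually_le_const (by positivity)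
    refine hasDerivAt_Lp_of_bound (isLittleO_sq_add hG K K) (w := w) ?_
    filter_upwards [hnear, hsq] with s hs hs2
    rw [transportOp_toL2 hs2.1, transportOp_toL2 hsqt.1]
    filter_upwards [coeFn_toL2 (shearSchw hs2.1 φ), coeFn_toL2 (shearSchw hsqt.1 φ), hw,
      coeFn_toL2 (quadGen (Matrix.fromBlocks 0 N'ᵀ N' 0) (shearSchw hsqt.1 φ))] with x h4 h5 h6 h7
    rw [h4, h5, h6, h7, quadGen_fromBlocks_offDiag h3, fderiv_shearSchw, toEuclideanLin_mul_apply,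
      sub_mul, one_mul, h1, sub_zero, shearSchw_apply, shearSchw_apply, Complex.norm_real,
      Real.norm_of_nonneg (by positivity), ← div_eq_mul_inv, le_div_iff₀ (by positivity), mul_comm]
    have h8 := hrem (1 - N t) (1 - N s) (-N') (s - t) hbd hs x
    simpa using h8

lemma metaplecticCurveAt_transportOp {C : ℝ → Matrix (Fin n) (Fin n) ℝ} {t : ℝ} (j : Fin n)
    (hC : DifferentiableAt ℝ C t) (h0 : ∀ᶠ s in nhds t, C s j j = 0) :
    MetaplecticCurveAt (fun s => transportOp (-(s • rowPart j (C s))))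
      (fun s => shearBlock s (rowPart j (C s))) t := by
  obtain ⟨D, hD⟩ : ∃ D, HasDerivAt (fun s => s • C s) D t :=
    ⟨_, (differentiableAt_id.smul hC).hasDerivAt⟩
  -- The diagonal entry vanishes near `t`, so its derivative vanishes too, and the velocity is again
  -- a row with zero diagonal.
  have hD0 : D j j = 0 := by
    have h1 : HasDerivAt (fun s => (s • C s) j j) (D j j) t :=
      (LinearMap.toContinuousLinearMap (Matrix.entryLinearMap ℝ ℝ j j)).hasFDerivAt.comp_hasDerivAt
        t hD
    refine h1.unique ((hasDerivAt_const t (0 : ℝ)).congr_of_eventuallyEq ?_)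
    filter_upwards [h0] with s hs
    simp [hs]
  have h2 : HasDerivAt (fun s => rowPart j (s • C s)) (rowPart j D) t := hD.const_mul _
  have h00 : ∀ᶠ s in nhds t, (s • C s) j j = 0 := h0.mono fun s hs => by simp [hs]
  have h3 := metaplecticCurveAt_transportOp_aux h2
    (h00.mono fun s hs => ⟨rowPart_mul_rowPart hs _, det_one_sub_rowPart hs⟩)
    (rowPart_mul_rowPart h00.self_of_nhds _) (rowPart_mul_rowPart hD0 _) (rowPart_diag hD0)
  simpa only [rowPart_smul, Matrix.transpose_smul, shearBlock] using h3

end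

end ExactSplitting

namespace ExactSplitting

noncomputable section

variable {n : ℕ}

/-! ### The Schrödinger operator as a quadratic operator -/

/-- Complex conjugation of Schwartz functions. -/
def conjSchw (φ : Schw n) : Schw n :=
  SchwartzMap.postcompCLM (𝕜 := ℝ) (Complex.conjCLE : ℂ →L[ℝ] ℂ) φ

lemma conjSchw_apply (φ : Schw n) (x : EuclideanSpace ℝ (Fin n)) :
    conjSchw φ x = starRingEnd ℂ (φ x) := rfl

lemma conjSchw_conjSchw (φ : Schw n) : conjSchw (conjSchw φ) = φ := by
  ext x
  simp [conjSchw_apply]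

/-- The inner product is conjugate linear in its first variable while the distributional pairing is
bilinear; conjugating the test function reconciles them. -/
lemma inner_toL2_eq (ψ : Schw n) (w : L2 n) :
    inner ℂ (toL2 n ψ) w = (w : 𝓢'(EuclideanSpace ℝ (Fin n), ℂ)) (conjSchw ψ) := by
  rw [Lp.toTemperedDistribution_apply, L2.inner_def]
  refine integral_congr_ae ?_
  filter_upwards [coeFn_toL2 ψ] with x hx
  rw [hx, conjSchw_apply, smul_eq_mul, RCLike.inner_apply, mul_comm]

lemma phaseVar_inl_conjSchw (j : Fin n) (φ : Schw n) :
    phaseVar (Sum.inl j) (conjSchw φ) = conjSchw (phaseVar (Sum.inl j) φ) := by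
  ext x
  simp [phaseVar_inl, conjSchw_apply]

lemma phaseVar_inr_conjSchw (j : Fin n) (φ : Schw n) :
    phaseVar (Sum.inr j) (conjSchw φ) = -conjSchw (phaseVar (Sum.inr j) φ) := by
  ext x
  have h1 : HasDerivAt (fun τ : ℝ => conjSchw φ (x + τ • EuclideanSpace.single j 1))
      (starRingEnd ℂ (fderiv ℝ φ x (EuclideanSpace.single j 1))) 0 :=
    (Complex.conjCLE : ℂ →L[ℝ] ℂ).hasFDerivAt.comp_hasDerivAt 0
      (hasDerivAt_line φ x (EuclideanSpace.single j 1))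
  rw [phaseVar_inr_eq_of_hasDerivAt h1, neg_apply, conjSchw_apply, phaseVar_inr]
  simp

/-- The transpose of the Schrödinger operator, on Schwartz functions. -/
def transposeSchrodinger (V B : Matrix (Fin n) (Fin n) ℝ) (φ : Schw n) : Schw n :=
  Complex.I • ((1 / 2 : ℂ) • Δ φ
      - SchwartzMap.smulLeftCLM ℂ (fun x => (quadForm V x : ℂ)) φ)
    + ∑ j : Fin n, ∂_{EuclideanSpace.single j (1 : ℝ)}
        (SchwartzMap.smulLeftCLM ℂ (fun x => (linCoord B j x : ℂ)) φ)

lemma schrodinger_apply (V B : Matrix (Fin n) (Fin n) ℝ)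
    (u : 𝓢'(EuclideanSpace ℝ (Fin n), ℂ)) (φ : Schw n) :
    schrodinger V B u φ = u (transposeSchrodinger V B φ) := by
  rw [schrodinger, transposeSchrodinger, map_add, map_smul, map_sub, map_smul, map_sum]
  simp

lemma lineDeriv_single (j : Fin n) (φ : Schw n) :
    ∂_{EuclideanSpace.single j (1 : ℝ)} φ = Complex.I • phaseVar (Sum.inr j) φ := by
  have h1 : phaseVar (Sum.inr j) φ
      = (-Complex.I) • (∂_{EuclideanSpace.single j (1 : ℝ)} φ : Schw n) := rfl
  rw [h1, smul_smul]
  simp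

lemma laplacian_eq_phaseVar (φ : Schw n) :
    Δ φ = -∑ j, phaseVar (Sum.inr j) (phaseVar (Sum.inr j) φ) := by
  rw [SchwartzMap.laplacian_eq_sum (EuclideanSpace.basisFun (Fin n) ℝ), ← Finset.sum_neg_distrib]
  refine Finset.sum_congr rfl fun j _ => ?_
  rw [EuclideanSpace.basisFun_apply, lineDeriv_single, lineDeriv_single, map_smul, smul_smul,
    Complex.I_mul_I, neg_one_smul]

lemma smulLeft_quadForm (V : Matrix (Fin n) (Fin n) ℝ) (φ : Schw n) :
    SchwartzMap.smulLeftCLM ℂ (fun x => (quadForm V x : ℂ)) φ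
      = ∑ i, ∑ j, (V i j : ℂ) • phaseVar (Sum.inl i) (phaseVar (Sum.inl j) φ) := by
  ext x
  rw [SchwartzMap.smulLeftCLM_apply_apply (hasTemperateGrowth_ofReal (hasTemperateGrowth_quadForm V)),
    quadForm_eq_sum]
  simp only [sum_apply, smul_apply, phaseVar_inl, smul_eq_mul, Complex.ofReal_sum,
    Complex.ofReal_mul, Finset.sum_mul]
  exact Finset.sum_congr rfl fun i _ => Finset.sum_congr rfl fun j _ => by ring

lemma smulLeft_linCoord (B : Matrix (Fin n) (Fin n) ℝ) (j : Fin n) (φ : Schw n) :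
    SchwartzMap.smulLeftCLM ℂ (fun x => (linCoord B j x : ℂ)) φ
      = ∑ k, (B j k : ℂ) • phaseVar (Sum.inl k) φ := by
  ext x
  rw [SchwartzMap.smulLeftCLM_apply_apply
    (hasTemperateGrowth_ofReal (hasTemperateGrowth_linCoord B j)), linCoord_eq_sum]
  simp only [sum_apply, smul_apply, phaseVar_inl, smul_eq_mul, Complex.ofReal_sum,
    Complex.ofReal_mul, Finset.sum_mul]
  exact Finset.sum_congr rfl fun i _ => by ring

/-- The linear Hamiltonian vector field of the Schrödinger operator. -/
def hamField (V B : Matrix (Fin n) (Fin n) ℝ) : Matrix (Fin n ⊕ Fin n) (Fin n ⊕ Fin n) ℝ :=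
  Matrix.fromBlocks B 1 (-((2 : ℝ) • V)) B

lemma neg_sympJ_mul_hamField (V B : Matrix (Fin n) (Fin n) ℝ) :
    -(sympJ n * hamField V B) = Matrix.fromBlocks ((2 : ℝ) • V) (-B) B 1 := by
  simp [sympJ, hamField, Matrix.fromBlocks_multiply, Matrix.fromBlocks_neg]

lemma diag_eq_zero_of_skew {B : Matrix (Fin n) (Fin n) ℝ} (hB : Bᵀ = -B) (i : Fin n) :
    B i i = 0 := by
  have := congrFun (congrFun hB i) i
  simp only [Matrix.transpose_apply, Matrix.neg_apply] at this
  linarith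

/-- Reindexing and skewness match the coefficients, and the commutators are weighted by the zero
diagonal of `B`. -/
lemma sum_skew_swap {B : Matrix (Fin n) (Fin n) ℝ} (hB : Bᵀ = -B) (φ : Schw n) :
    ∑ i, ∑ j, (-B i j : ℂ) • phaseVar (Sum.inl i) (phaseVar (Sum.inr j) φ)
      = ∑ i, ∑ j, (B i j : ℂ) • phaseVar (Sum.inr i) (phaseVar (Sum.inl j) φ) := by
  rw [Finset.sum_comm]
  refine Finset.sum_congr rfl fun i _ => Finset.sum_congr rfl fun j _ => ?_
  have h1 : -B j i = B i j := by
    have := congrFun (congrFun hB i) j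
    simp only [Matrix.transpose_apply, Matrix.neg_apply] at this
    linarith
  rw [← Complex.ofReal_neg, h1]
  ext x
  rw [smul_apply, smul_apply, phaseVar_inr_inl, phaseVar_inl]
  split_ifs with h
  · subst h; simp [diag_eq_zero_of_skew hB]
  · rw [sub_zero]

lemma quadGen_hamField {V B : Matrix (Fin n) (Fin n) ℝ} (hB : Bᵀ = -B) (φ : Schw n) :
    quadGen (-(sympJ n * hamField V B)) φ = (-Complex.I) •
      (∑ i, ∑ j, (V i j : ℂ) • phaseVar (Sum.inl i) (phaseVar (Sum.inl j) φ)
      + ∑ i, ∑ j, (B i j : ℂ) • phaseVar (Sum.inr i) (phaseVar (Sum.inl j) φ)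
      + (1 / 2 : ℂ) • ∑ j, phaseVar (Sum.inr j) (phaseVar (Sum.inr j) φ)) := by
  rw [quadGen, LinearMap.smul_apply, neg_sympJ_mul_hamField, weyl_apply]
  congr 1
  simp only [Fintype.sum_sum_type, Matrix.fromBlocks_apply₁₁, Matrix.fromBlocks_apply₁₂,
    Matrix.fromBlocks_apply₂₁, Matrix.fromBlocks_apply₂₂, Matrix.neg_apply, Complex.ofReal_neg,
    Finset.sum_add_distrib, sum_skew_swap hB, Matrix.smul_apply, smul_eq_mul, Complex.ofReal_mul,
    mul_smul, ← Finset.smul_sum]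
  have h1 : ∑ i, ∑ j, ((1 : Matrix (Fin n) (Fin n) ℝ) i j : ℂ) •
      phaseVar (Sum.inr i) (phaseVar (Sum.inr j) φ)
      = ∑ j, phaseVar (Sum.inr j) (phaseVar (Sum.inr j) φ) := by
    refine Finset.sum_congr rfl fun i _ => ?_
    simp [Matrix.one_apply, ite_smul]
  rw [h1]
  push_cast
  module

/-- The operator is formally skew-adjoint, so its bilinear transpose is minus its complex conjugate.
-/
lemma conjSchw_quadGen_hamField {V B : Matrix (Fin n) (Fin n) ℝ} (hB : Bᵀ = -B) (ψ : Schw n) :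
    transposeSchrodinger V B (conjSchw ψ)
      = -conjSchw (quadGen (-(sympJ n * hamField V B)) ψ) := by
  rw [quadGen_hamField hB, transposeSchrodinger, laplacian_eq_phaseVar, smulLeft_quadForm]
  simp only [smulLeft_linCoord, lineDeriv_single, map_sum, map_smul, phaseVar_inl_conjSchw,
    phaseVar_inr_conjSchw, map_neg, neg_neg]
  ext x
  simp only [conjSchw_apply, add_apply, sub_apply, smul_apply, neg_apply, sum_apply, smul_eq_mul,
    map_mul, map_add, map_sum, map_neg, Complex.conj_I, Complex.conj_ofReal, map_div₀, map_one,
    map_ofNat, mul_neg, Finset.sum_neg_distrib, ← Finset.mul_sum]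
  ring

/-- Links the distributional description of the maximal domain with the duality relation produced by
`LocalPropagator.hasDerivAt_extend_iff`. -/
lemma eq_schrodinger_iff {V B : Matrix (Fin n) (Fin n) ℝ} (hB : Bᵀ = -B) (u w : L2 n) :
    (w : 𝓢'(EuclideanSpace ℝ (Fin n), ℂ))
        = schrodinger V B (u : 𝓢'(EuclideanSpace ℝ (Fin n), ℂ)) ↔
      ∀ ψ, inner ℂ (toL2 n ψ) w
        = -inner ℂ (toL2 n (quadGen (-(sympJ n * hamField V B)) ψ)) u := by
  have h1 : ∀ ψ, schrodinger V B (u : 𝓢'(EuclideanSpace ℝ (Fin n), ℂ)) (conjSchw ψ)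
      = -inner ℂ (toL2 n (quadGen (-(sympJ n * hamField V B)) ψ)) u := by
    intro ψ
    rw [schrodinger_apply, conjSchw_quadGen_hamField hB, map_neg, inner_toL2_eq]
  constructor
  · intro h ψ
    rw [← h1, inner_toL2_eq, h]
  · intro h
    ext φ
    rw [← conjSchw_conjSchw φ, h1, ← inner_toL2_eq, h]

/-! ### The group generated by the Schrödinger operator -/

lemma phaseOp_zero (C : Matrix (Fin n) (Fin n) ℝ) : phaseOp 0 C = 1 := by
  ext1 u
  refine Lp.ext ?_
  filter_upwards [coeFn_phaseOp 0 C u] with x hx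
  rw [hx, one_apply_eq_self]
  simp [phaseFun, quadForm]

lemma transportOp_zero : transportOp (0 : Matrix (Fin n) (Fin n) ℝ) = 1 := by
  ext1 u
  refine Lp.ext ?_
  filter_upwards [coeFn_transportOp 0 u] with x hx
  rw [hx, one_apply_eq_self]
  simp [flowMap]

lemma fourierPhaseOp_zero (A : Matrix (Fin n) (Fin n) ℝ) : fourierPhaseOp 0 A = 1 := by
  rw [fourierPhaseOp_eq, phaseOp_zero, mul_one]
  ext1 u
  exact (Lp.fourierTransformₗᵢ (EuclideanSpace ℝ (Fin n)) ℂ).symm_apply_apply u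

lemma splittingOp_zero (A L U Vl Vr : Matrix (Fin n) (Fin n) ℝ) :
    splittingOp 0 A L U Vl Vr = 1 := by
  simp [splittingOp, phaseOp_zero, transportOp_zero, fourierPhaseOp_zero]

/-- The symplectic matrix of the splitting operator. -/
def splittingBlock (t : ℝ) (A L U Vl Vr : Matrix (Fin n) (Fin n) ℝ) :
    Matrix (Fin n ⊕ Fin n) (Fin n ⊕ Fin n) ℝ :=
  phaseBlock t Vl
    * ((List.finRange n).dropLast.map fun j => shearBlock t (rowPart j U)).prod
    * Matrix.fromBlocks 1 ((2 * t) • A) 0 1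
    * ((List.finRange n).tail.map fun j => shearBlock t (rowPart j L)).prod
    * phaseBlock t Vr

lemma hasDerivAt_exp_smul_hamField (V B : Matrix (Fin n) (Fin n) ℝ) (t : ℝ) :
    HasDerivAt (fun s : ℝ => NormedSpace.exp (s • hamField V B))
      (hamField V B * NormedSpace.exp (t • hamField V B)) t :=
  hasDerivAt_exp_smul_const' (hamField V B) t

/-- The matrix identity on an open interval determines the generator at every time, so the splitting
operator is a local propagator of the Schrödinger equation. Its extension to all times is the
required group. -/
theorem exists_group_eq_splittingOp {V B : Matrix (Fin n) (Fin n) ℝ} (hB : Bᵀ = -B) {t₀ : ℝ}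
    (ht₀ : 0 < t₀) {A L U Vl Vr : ℝ → Matrix (Fin n) (Fin n) ℝ}
    (dA : ∀ t ∈ Set.Ioo (-t₀) t₀, DifferentiableAt ℝ A t)
    (dL : ∀ t ∈ Set.Ioo (-t₀) t₀, DifferentiableAt ℝ L t)
    (dU : ∀ t ∈ Set.Ioo (-t₀) t₀, DifferentiableAt ℝ U t)
    (dVl : ∀ t ∈ Set.Ioo (-t₀) t₀, DifferentiableAt ℝ Vl t)
    (dVr : ∀ t ∈ Set.Ioo (-t₀) t₀, DifferentiableAt ℝ Vr t)
    (sA : ∀ t ∈ Set.Ioo (-t₀) t₀, (A t).IsSymm)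
    (sL : ∀ t ∈ Set.Ioo (-t₀) t₀, ∀ i, L t i i = 0)
    (sU : ∀ t ∈ Set.Ioo (-t₀) t₀, ∀ i, U t i i = 0)
    (sVl : ∀ t ∈ Set.Ioo (-t₀) t₀, (Vl t).IsSymm)
    (sVr : ∀ t ∈ Set.Ioo (-t₀) t₀, (Vr t).IsSymm)
    (hM : ∀ t ∈ Set.Ioo (-t₀) t₀, splittingBlock t (A t) (L t) (U t) (Vl t) (Vr t)
      = NormedSpace.exp (t • hamField V B)) :
    ∃ S : ℝ → (L2 n →L[ℂ] L2 n), IsGroupGeneratedBy (schrodinger V B) S ∧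
      ∀ t ∈ Set.Ioo (-t₀) t₀, S t = splittingOp t (A t) (L t) (U t) (Vl t) (Vr t) := by
  set T : ℝ → (L2 n →L[ℂ] L2 n) := fun t => splittingOp t (A t) (L t) (U t) (Vl t) (Vr t) with hT
  have hcurve : ∀ t ∈ Set.Ioo (-t₀) t₀, MetaplecticCurveAt T
      (fun t => splittingBlock t (A t) (L t) (U t) (Vl t) (Vr t)) t := by
    intro t ht
    have hev : ∀ {p : ℝ → Prop}, (∀ s ∈ Set.Ioo (-t₀) t₀, p s) → ∀ᶠ s in nhds t, p s :=
      fun hp => Filter.mem_of_superset (isOpen_Ioo.mem_nhds ht) hp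
    exact ((((metaplecticCurveAt_phaseOp (dVl t ht) (hev sVl)).mul
      (MetaplecticCurveAt.list_prod _ fun j _ => metaplecticCurveAt_transportOp j (dU t ht)
        (hev fun s hs => sU s hs j))).mul
      (metaplecticCurveAt_fourierPhaseOp (dA t ht) (hev sA))).mul
      (MetaplecticCurveAt.list_prod _ fun j _ => metaplecticCurveAt_transportOp j (dL t ht)
        (hev fun s hs => sL s hs j))).mul
      (metaplecticCurveAt_phaseOp (dVr t ht) (hev sVr))
  have hprop : LocalPropagator (toL2 n) (quadGen (-(sympJ n * hamField V B))) t₀ T := by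
    refine ⟨ht₀, toL2_injective, denseRange_toL2,
      fun t ht => (hcurve t (abs_lt.1 ht)).isometric.self_of_nhds, splittingOp_zero _ _ _ _ _,
      fun t ht φ => ?_⟩
    have ht' := abs_lt.1 ht
    obtain ⟨H, Q, hQ, hM', hd⟩ := (hcurve t ht').deriv
    refine ⟨Q φ, hQ.map φ, ?_⟩
    have h1 : HasDerivAt (fun t => splittingBlock t (A t) (L t) (U t) (Vl t) (Vr t))
        (hamField V B * NormedSpace.exp (t • hamField V B)) t :=
      (hasDerivAt_exp_smul_hamField V B t).congr_of_eventuallyEq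
        (Filter.mem_of_superset (isOpen_Ioo.mem_nhds ht') hM)
    have h2 := hM'.unique h1
    rw [hM t ht'] at h2
    -- The two expressions of the derivative of the block product share the invertible factor
    -- `exp(tF)`, which cancels; the generator of the splitting is thus constant in `t`.
    have h3 : sympJ n * H = hamField V B :=
      (Matrix.isUnit_exp (t • hamField V B)).mul_right_cancel h2
    have h4 : H = -(sympJ n * hamField V B) := by
      rw [← h3, ← mul_assoc, sympJ_mul_self, neg_mul, one_mul, neg_neg]
    rw [← h4]
    exact hd φ
  refine ⟨LocalPropagator.extend t₀ T, ⟨hprop.extend_zero, hprop.extend_add,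
    hprop.continuous_extend, fun u w => ?_⟩, fun t ht => hprop.extend_eq_self (abs_lt.2 ht)⟩
  exact (hprop.hasDerivAt_extend_iff u w).trans (eq_schrodinger_iff hB u w).symm

end

end ExactSplitting

namespace ExactSplitting

noncomputable section

/-! ### The logarithm near the identity -/

section BanachAlgebra

variable {𝔸 : Type*} [NormedRing 𝔸] [NormedAlgebra ℝ 𝔸]

/-- Commutation allows `exp (f s)` to be factored out, and only the derivative of `exp` at `0` is
needed. -/
lemma hasDerivAt_exp_of_commute [CompleteSpace 𝔸] {f : ℝ → 𝔸} {f' : 𝔸} {s : ℝ} (hf : HasDerivAt f f' s)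
    (hc : ∀ r, Commute (f s) (f r)) :
    HasDerivAt (fun r => NormedSpace.exp (f r)) (NormedSpace.exp (f s) * f') s := by
  have h1 : ∀ r, NormedSpace.exp (f r) = NormedSpace.exp (f s) * NormedSpace.exp (f r - f s) := by
    intro r
    let _ : NormedAlgebra ℚ 𝔸 := NormedAlgebra.restrictScalars ℚ ℝ 𝔸
    rw [← NormedSpace.exp_add_of_commute ((hc r).sub_right (Commute.refl _)), add_sub_cancel]
  have h2 : HasDerivAt (fun r => NormedSpace.exp (f r - f s)) f' s := by
    have h3 : HasFDerivAt (NormedSpace.exp : 𝔸 → 𝔸) (1 : 𝔸 →L[ℝ] 𝔸) (f s - f s) := by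
      rw [sub_self]; exact hasFDerivAt_exp_zero
    exact h3.comp_hasDerivAt s (hf.sub_const (f s))
  rw [funext h1]
  exact h2.const_mul _

/-- The power series of the logarithm at the identity. -/
def logSeries (Z : 𝔸) : 𝔸 := ∑' m : ℕ, ((-1 : ℝ) ^ m / ((m : ℝ) + 1)) • Z ^ (m + 1)

lemma norm_logSeries_term_le (Z : 𝔸) (m : ℕ) :
    ‖((-1 : ℝ) ^ m / ((m : ℝ) + 1)) • Z ^ (m + 1)‖ ≤ ‖Z‖ * ‖Z‖ ^ m := by
  rw [norm_smul, norm_div, norm_pow, norm_neg, norm_one, one_pow, ← pow_succ']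
  have h1 : (1 : ℝ) ≤ ‖(m : ℝ) + 1‖ := by
    rw [Real.norm_of_nonneg (by positivity)]; linarith [Nat.cast_nonneg (α := ℝ) m]
  calc 1 / ‖(m : ℝ) + 1‖ * ‖Z ^ (m + 1)‖ ≤ 1 * ‖Z‖ ^ (m + 1) := by
        gcongr
        · rw [div_le_one (by positivity)]; exact h1
        · exact norm_pow_le' Z (Nat.succ_pos m)
    _ = _ := one_mul _

lemma summable_logSeries [CompleteSpace 𝔸] {Z : 𝔸} (hZ : ‖Z‖ < 1) :
    Summable fun m : ℕ => ((-1 : ℝ) ^ m / ((m : ℝ) + 1)) • Z ^ (m + 1) :=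
  Summable.of_norm_bounded ((summable_geometric_of_lt_one (norm_nonneg _) hZ).mul_left ‖Z‖)
    (norm_logSeries_term_le Z)

lemma norm_logSeries_le [CompleteSpace 𝔸] {Z : 𝔸} (hZ : ‖Z‖ < 1) : ‖logSeries Z‖ ≤ ‖Z‖ * (1 - ‖Z‖)⁻¹ :=
  tsum_of_norm_bounded ((hasSum_geometric_of_lt_one (norm_nonneg _) hZ).mul_left ‖Z‖)
    (norm_logSeries_term_le Z)

lemma commute_logSeries {Z : 𝔸} (r s : ℝ) : Commute (logSeries (r • Z)) (logSeries (s • Z)) :=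
  Commute.tsum_left _ fun _ => Commute.tsum_right _ fun _ =>
    (((((Commute.refl Z).smul_left r).smul_right s).pow_pow _ _).smul_left _).smul_right _

lemma hasDerivAt_logSeries_term (Z : 𝔸) (m : ℕ) (r : ℝ) : HasDerivAt
    (fun r : ℝ => ((-1 : ℝ) ^ m / ((m : ℝ) + 1)) • (r • Z) ^ (m + 1))
    (Z * (-(r • Z)) ^ m) r := by
  have h2 : HasDerivAt (fun r : ℝ => (((-1 : ℝ) ^ m / ((m : ℝ) + 1)) * r ^ (m + 1)) • Z ^ (m + 1))
      ((((-1 : ℝ) ^ m / ((m : ℝ) + 1)) * (((m + 1 : ℕ) : ℝ) * r ^ m)) • Z ^ (m + 1)) r :=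
    ((hasDerivAt_pow (m + 1) r).const_mul _).smul_const _
  have h3 : Z * (-(r • Z)) ^ m = (((-1 : ℝ) ^ m / ((m : ℝ) + 1)) * (((m + 1 : ℕ) : ℝ) * r ^ m)) •
      Z ^ (m + 1) := by
    rw [← neg_smul, smul_pow, mul_smul_comm, ← pow_succ']
    congr 1
    push_cast
    rw [neg_pow]
    field_simp
  rw [h3]
  simp only [smul_pow, smul_smul]
  exact h2

lemma norm_mul_neg_smul_pow_le {Z : 𝔸} {R r : ℝ} (hr : |r| ≤ R) (m : ℕ) :
    ‖Z * (-(r • Z)) ^ m‖ ≤ ‖Z‖ * (R * ‖Z‖) ^ m * (1 + ‖(1 : 𝔸)‖) := by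
  have h3 : ‖-(r • Z)‖ ≤ R * ‖Z‖ := by
    rw [norm_neg, norm_smul]; gcongr; exact hr
  have hR : 0 ≤ R := (abs_nonneg r).trans hr
  rcases Nat.eq_zero_or_pos m with rfl | hm
  · simp only [pow_zero, mul_one]
    nlinarith [norm_nonneg Z, norm_nonneg (1 : 𝔸)]
  · calc ‖Z * (-(r • Z)) ^ m‖ ≤ ‖Z‖ * ‖(-(r • Z)) ^ m‖ := norm_mul_le _ _
      _ ≤ ‖Z‖ * (R * ‖Z‖) ^ m := by
          gcongr
          exact (norm_pow_le' _ hm).trans (by gcongr)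
      _ ≤ _ := le_mul_of_one_le_right (by positivity) (by linarith [norm_nonneg (1 : 𝔸)])

lemma hasDerivAt_logSeries_smul [CompleteSpace 𝔸] {Z : 𝔸} {R : ℝ} (hR1 : 1 < R) (hR2 : R * ‖Z‖ < 1)
    {s : ℝ} (hs : |s| ≤ 1) :
    HasDerivAt (fun s : ℝ => logSeries (s • Z)) (∑' m : ℕ, Z * (-(s • Z)) ^ m) s := by
  have hR0 : 0 < R := one_pos.trans hR1
  have hsum : Summable fun m : ℕ => ‖Z‖ * (R * ‖Z‖) ^ m * (1 + ‖(1 : 𝔸)‖) :=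
    ((summable_geometric_of_lt_one (mul_nonneg hR0.le (norm_nonneg Z)) hR2).mul_left _).mul_right _
  have h0 : Summable fun m : ℕ => ((-1 : ℝ) ^ m / ((m : ℝ) + 1)) • ((0 : ℝ) • Z) ^ (m + 1) :=
    summable_logSeries (by rw [zero_smul, norm_zero]; exact one_pos)
  exact hasDerivAt_tsum_of_isPreconnected hsum (Metric.isOpen_ball (x := (0 : ℝ)) (ε := R))
      (convex_ball (0 : ℝ) R).isPreconnected (fun m r _ => hasDerivAt_logSeries_term Z m r)
      (fun m r hr => norm_mul_neg_smul_pow_le (mem_ball_zero_iff.1 hr).le m)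
      (Metric.mem_ball_self hR0) h0 (mem_ball_zero_iff.2 (hs.trans_lt hR1))

lemma tsum_mul_neg_pow_mul {R : Type*} [NormedRing R] [CompleteSpace R] {Z Y : R}
    (hY : ‖Y‖ < 1) :
    (∑' m : ℕ, Z * (-Y) ^ m) * (1 + Y) = Z := by
  have h4 : ‖-Y‖ < 1 := (norm_neg Y).trans_lt hY
  have h5 : (∑' m : ℕ, (-Y) ^ m) * (1 - -Y) = 1 := geom_series_mul_neg (-Y) h4
  have h6 : ∑' m : ℕ, Z * (-Y) ^ m = Z * ∑' m : ℕ, (-Y) ^ m :=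
    (summable_geometric_of_norm_lt_one h4).tsum_mul_left Z
  rw [sub_neg_eq_add] at h5
  rw [h6, mul_assoc, h5, mul_one]

lemma exists_hasDerivAt_logSeries_smul [CompleteSpace 𝔸] {Z : 𝔸} (hZ : ‖Z‖ < 1) {s : ℝ} (hs : |s| ≤ 1) :
    ∃ d, HasDerivAt (fun s : ℝ => logSeries (s • Z)) d s ∧ d * (1 + s • Z) = Z := by
  -- Room beyond `1` makes `[-1, 1]` interior to a ball where the differentiated series converges
  -- uniformly; when `Z = 0` any `R` works.
  obtain ⟨R, hR1, hR2⟩ : ∃ R : ℝ, 1 < R ∧ R * ‖Z‖ < 1 := by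
    rcases eq_or_lt_of_le (norm_nonneg Z) with h | h
    · exact ⟨2, one_lt_two, by rw [← h, mul_zero]; exact one_pos⟩
    · obtain ⟨R, h1, h2⟩ := exists_between ((one_lt_inv₀ h).2 hZ)
      exact ⟨R, h1, by rwa [← lt_div_iff₀ h, one_div]⟩
  refine ⟨_, hasDerivAt_logSeries_smul hR1 hR2 hs, tsum_mul_neg_pow_mul ?_⟩
  rw [norm_smul]
  exact (mul_le_of_le_one_left (norm_nonneg _) hs).trans_lt hZ

/-- Along the ray `s ↦ 1 + s Z`, the product `exp(-log(1 + sZ)) (1 + sZ)` has zero derivative,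
because the derivative of the logarithm times `1 + sZ` is `Z`. It equals `1` at `s = 0`. -/
lemma exp_logSeries [CompleteSpace 𝔸] {Z : 𝔸} (hZ : ‖Z‖ < 1) : NormedSpace.exp (logSeries Z) = 1 + Z := by
  have h1 : ∀ s ∈ Set.Icc (-1 : ℝ) 1, HasDerivWithinAt
      (fun s : ℝ => NormedSpace.exp (-logSeries (s • Z)) * (1 + s • Z)) 0 (Set.Icc (-1) 1) s := by
    intro s hs
    obtain ⟨d, hd, hd'⟩ := exists_hasDerivAt_logSeries_smul hZ (abs_le.2 hs)
    have h2 := (hasDerivAt_exp_of_commute hd.neg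
      (fun r => ((commute_logSeries s r).neg_left).neg_right)).mul
      (((hasDerivAt_id s).smul_const Z).const_add 1)
    refine (h2.congr_deriv ?_).hasDerivWithinAt
    simp only [one_smul, id]
    rw [mul_assoc, neg_mul, hd', mul_neg, neg_add_cancel]
  have h2 := (convex_Icc (-1 : ℝ) 1).norm_image_sub_le_of_norm_hasDerivWithin_le (C := 0) h1
    (by simp) (x := 0) (y := 1) (by simp) (by simp)
  have h0 : logSeries (0 : 𝔸) = 0 := by simp [logSeries]
  simp only [one_smul, zero_smul, h0, neg_zero, NormedSpace.exp_zero, add_zero, mul_one, zero_mul,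
    norm_le_zero_iff] at h2
  have h3 := sub_eq_zero.1 h2
  let _ : NormedAlgebra ℚ 𝔸 := NormedAlgebra.restrictScalars ℚ ℝ 𝔸
  have h4 : NormedSpace.exp (logSeries Z) * NormedSpace.exp (-logSeries Z) = 1 := by
    rw [← NormedSpace.exp_add_of_commute (Commute.refl _).neg_right, add_neg_cancel,
      NormedSpace.exp_zero]
  calc NormedSpace.exp (logSeries Z)
      = NormedSpace.exp (logSeries Z) * (NormedSpace.exp (-logSeries Z) * (1 + Z)) := by
        rw [h3, mul_one]
    _ = 1 + Z := by rw [← mul_assoc, h4, one_mul]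

/-- The strict derivative of `exp` at `0` is the identity, so near `0` the map `exp - id` is
Lipschitz with constant `1/2`. -/
lemma exists_exp_injOn [CompleteSpace 𝔸] : ∃ ε > 0, ∀ X Y : 𝔸, ‖X‖ < ε → ‖Y‖ < ε →
    NormedSpace.exp X = NormedSpace.exp Y → X = Y := by
  have h1 : HasStrictFDerivAt (NormedSpace.exp : 𝔸 → 𝔸) (1 : 𝔸 →L[ℝ] 𝔸) 0 :=
    hasStrictFDerivAt_exp_zero
  obtain ⟨s, hs, h2⟩ := h1.approximates_deriv_on_nhds (c := 1 / 2) (Or.inr (by norm_num))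
  obtain ⟨ε, hε, hb⟩ := Metric.mem_nhds_iff.1 hs
  refine ⟨ε, hε, fun X Y hX hY h => ?_⟩
  have h3 := h2 X (hb (mem_ball_zero_iff.2 hX)) Y (hb (mem_ball_zero_iff.2 hY))
  rw [h, sub_self, zero_sub, norm_neg, one_apply_eq_self] at h3
  have h4 : ‖X - Y‖ ≤ 1 / 2 * ‖X - Y‖ := by simpa using h3
  exact sub_eq_zero.1 (norm_le_zero_iff.1 (by linarith))

/-- The function `ℓ` such that `log (1 + Z) = Z + Z² ℓ(Z)`. -/
def logTail (Z : 𝔸) : 𝔸 :=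
  FormalMultilinearSeries.ofScalarsSum (fun m : ℕ => (-1 : ℝ) ^ (m + 1) / ((m : ℝ) + 2)) Z

lemma analyticAt_logTail [CompleteSpace 𝔸] {Z : 𝔸} (hZ : ‖Z‖ < 1) : AnalyticAt ℝ (logTail : 𝔸 → 𝔸) Z := by
  set c : ℕ → ℝ := fun m : ℕ => (-1 : ℝ) ^ (m + 1) / ((m : ℝ) + 2) with hc
  have h1 : (1 : ℝ≥0∞) ≤ (FormalMultilinearSeries.ofScalars 𝔸 c).radius := by
    refine ENNReal.le_of_forall_nnreal_lt fun r hr => ?_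
    -- The coefficients are bounded by `1`; the term `‖1‖` accounts for the constant term of the
    -- series, as `‖1‖ = 1` is not assumed.
    refine FormalMultilinearSeries.le_radius_of_bound _ (1 + ‖(1 : 𝔸)‖) fun m => ?_
    have hr1 : (r : ℝ) ≤ 1 := by exact_mod_cast hr.le
    have hcm : ‖c m‖ ≤ 1 := by
      rw [hc, norm_div, norm_pow, norm_neg, norm_one, one_pow]
      have : (2 : ℝ) ≤ ‖(m : ℝ) + 2‖ := by
        rw [Real.norm_of_nonneg (by positivity)]; linarith [Nat.cast_nonneg (α := ℝ) m]
      rw [div_le_one (by positivity)]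
      linarith
    have hp : ‖ContinuousMultilinearMap.mkPiAlgebraFin ℝ m 𝔸‖ ≤ 1 + ‖(1 : 𝔸)‖ := by
      rcases Nat.eq_zero_or_pos m with rfl | hm
      · rw [ContinuousMultilinearMap.norm_mkPiAlgebraFin_zero]; linarith
      · exact (ContinuousMultilinearMap.norm_mkPiAlgebraFin_le_of_pos hm).trans
          (by linarith [norm_nonneg (1 : 𝔸)])
    rw [FormalMultilinearSeries.ofScalars_norm_eq_mul]
    calc ‖c m‖ * ‖ContinuousMultilinearMap.mkPiAlgebraFin ℝ m 𝔸‖ * (r : ℝ) ^ m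
        ≤ 1 * (1 + ‖(1 : 𝔸)‖) * 1 := by
          gcongr
          exact pow_le_one₀ r.2 hr1
      _ = _ := by ring
  have h2 := (FormalMultilinearSeries.ofScalars 𝔸 c).hasFPowerSeriesOnBall (one_pos.trans_le h1)
  refine h2.analyticAt_of_mem (Metric.eball_subset_eball h1 ?_)
  rw [Metric.mem_eball, edist_zero_right]
  rwa [← ofReal_norm, ENNReal.ofReal_lt_one]

lemma logSeries_eq [CompleteSpace 𝔸] {Z : 𝔸} (hZ : ‖Z‖ < 1) : logSeries Z = Z + Z ^ 2 * logTail Z := by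
  rw [logSeries, (summable_logSeries hZ).tsum_eq_zero_add, logTail,
    FormalMultilinearSeries.ofScalarsSum_eq_tsum]
  congr 1
  · simp
  · rw [← Summable.tsum_mul_left]
    · refine tsum_congr fun m => ?_
      rw [mul_smul_comm, ← pow_add]
      congr 1
      · push_cast; ring
      · congr 1; omega
    · rw [← summable_nat_add_iff 1]
      refine Summable.of_norm_bounded ((summable_geometric_of_lt_one (norm_nonneg _) hZ).mul_left
        ‖Z‖) fun m => ?_
      rw [norm_smul, norm_div, norm_pow, norm_neg, norm_one, one_pow, ← pow_succ']
      have h1 : (1 : ℝ) ≤ ‖((m + 1 : ℕ) : ℝ) + 2‖ := by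
        rw [Real.norm_of_nonneg (by positivity)]
        linarith [Nat.cast_nonneg (α := ℝ) (m + 1)]
      calc 1 / ‖((m + 1 : ℕ) : ℝ) + 2‖ * ‖Z ^ (m + 1)‖ ≤ 1 * ‖Z‖ ^ (m + 1) := by
            gcongr
            · rw [div_le_one (by positivity)]; exact h1
            · exact norm_pow_le' Z (Nat.succ_pos m)
        _ = _ := one_mul _

end BanachAlgebra

/-! ### The logarithm of symplectic matrices -/

lemma logTerm_eq {ι : Type} [Fintype ι] [DecidableEq ι] (Z : Matrix ι ι ℝ) (m : ℕ) :
    logTerm (1 + Z) m = ((-1 : ℝ) ^ m / ((m : ℝ) + 1)) • Z ^ (m + 1) := by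
  rw [logTerm, add_sub_cancel_left]

lemma matLog_eq {ι : Type} [Fintype ι] [DecidableEq ι] (Z : Matrix ι ι ℝ) :
    matLog (1 + Z) = logSeries Z := by
  simp only [matLog, logTerm_eq, logSeries]

variable {n : ℕ}

/-- With `X = log (1 + Z)`, the symplectic relation reads `exp(ᵗX) = exp(-J X J⁻¹)`. Both exponents
are small, so local injectivity of `exp` identifies them, and `ᵗX = -J X J⁻¹` says that `J X` is
symmetric. -/
lemma exists_isSymm_sympJ_mul_matLog : ∃ ε > 0, ∀ Z : Matrix (Fin n ⊕ Fin n) (Fin n ⊕ Fin n) ℝ,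
    ‖Z‖ < ε → (1 + Z)ᵀ * sympJ n * (1 + Z) = sympJ n → (sympJ n * matLog (1 + Z)).IsSymm := by
  obtain ⟨ε, hε, hinj⟩ := exists_exp_injOn (𝔸 := Matrix (Fin n ⊕ Fin n) (Fin n ⊕ Fin n) ℝ)
  -- This constant dominates both `1` and `‖J‖²`, so `c ‖X‖ < ε` puts `ᵗX` and `J X J` in the
  -- injectivity ball; the factor `2` below comes from `‖X‖ ≤ 2‖Z‖`.
  set c := 1 + ‖sympJ n‖ ^ 2 with hc
  have hc0 : 0 < c := by positivity
  refine ⟨min (1 / 2) (ε / (2 * c)), by positivity, fun Z hZ hs => ?_⟩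
  have hZ1 : ‖Z‖ < 1 / 2 := hZ.trans_le (min_le_left _ _)
  have hZ2 : ‖Z‖ < ε / (2 * c) := hZ.trans_le (min_le_right _ _)
  rw [matLog_eq]
  set X := logSeries Z with hX
  have hXn : c * ‖X‖ < ε := by
    have h1 := norm_logSeries_le (Z := Z) (by linarith)
    have h2 : (1 - ‖Z‖)⁻¹ ≤ 2 := by
      rw [inv_le_comm₀ (by linarith) (by norm_num)]; linarith
    have h3 : ‖X‖ ≤ ‖Z‖ * 2 := h1.trans (by gcongr)
    rw [lt_div_iff₀ (by positivity)] at hZ2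
    nlinarith
  have hexp : NormedSpace.exp X = 1 + Z := exp_logSeries (by linarith)
  have hJ : sympJ n * (-sympJ n) = 1 := by rw [mul_neg, sympJ_mul_self, neg_neg]
  have hJ' : (-sympJ n) * sympJ n = 1 := by rw [neg_mul, sympJ_mul_self, neg_neg]
  have hJt : (sympJ n)ᵀ = -sympJ n := by
    simp [sympJ, Matrix.fromBlocks_transpose, Matrix.fromBlocks_neg]
  have h1 : NormedSpace.exp (sympJ n * (-X) * (-sympJ n)) = (1 + Z)ᵀ := by
    have h2 : NormedSpace.exp (sympJ n * (-X) * (-sympJ n))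
        = sympJ n * NormedSpace.exp (-X) * (-sympJ n) :=
      Matrix.exp_units_conj ⟨sympJ n, -sympJ n, hJ, hJ'⟩ (-X)
    have h3 : (1 + Z) * NormedSpace.exp (-X) = 1 := by
      rw [← hexp, ← Matrix.exp_add_of_commute X (-X) (Commute.refl X).neg_right, add_neg_cancel,
        NormedSpace.exp_zero]
    rw [h2]
    calc sympJ n * NormedSpace.exp (-X) * (-sympJ n)
        = ((1 + Z)ᵀ * sympJ n * (1 + Z)) * NormedSpace.exp (-X) * (-sympJ n) := by rw [hs]
      _ = (1 + Z)ᵀ * (sympJ n * ((1 + Z) * NormedSpace.exp (-X)) * (-sympJ n)) := by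
          simp only [mul_assoc]
      _ = (1 + Z)ᵀ := by rw [h3, mul_one, hJ, mul_one]
  have h2 : NormedSpace.exp Xᵀ = (1 + Z)ᵀ := by rw [Matrix.exp_transpose, hexp]
  have h3 : Xᵀ = sympJ n * (-X) * (-sympJ n) := by
    refine hinj _ _ ?_ ?_ (h2.trans h1.symm)
    · have h4 : ‖Xᵀ‖ = ‖X‖ := by
        rw [← Matrix.conjTranspose_eq_transpose_of_trivial, Matrix.l2_opNorm_conjTranspose]
      rw [h4]
      nlinarith [norm_nonneg X, sq_nonneg ‖sympJ n‖]
    · calc ‖sympJ n * (-X) * (-sympJ n)‖ ≤ ‖sympJ n‖ * ‖X‖ * ‖sympJ n‖ := by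
            refine (norm_mul_le _ _).trans ?_
            rw [norm_neg]
            gcongr
            exact (norm_mul_le _ _).trans (by rw [norm_neg])
        _ ≤ c * ‖X‖ := by rw [hc]; nlinarith [norm_nonneg X]
        _ < ε := hXn
  rw [Matrix.IsSymm, Matrix.transpose_mul, h3, hJt]
  simp only [mul_neg, neg_mul, neg_neg, mul_assoc, sympJ_mul_self, mul_one]

end

end ExactSplitting

namespace ExactSplitting

noncomputable section

/-! ### An analytic fixed point -/

section FixedPoint

variable {X : Type*} [NormedAddCommGroup X] [NormedSpace ℝ X] [CompleteSpace X]

/-- The equation `x = x₀ - t Φ(t, x)` has an analytic solution near `t = 0`. -/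
lemma exists_analyticAt_fixedPoint {Φ : ℝ × X → X} {x₀ : X} (hΦ : AnalyticAt ℝ Φ (0, x₀)) :
    ∃ x : ℝ → X, AnalyticAt ℝ x 0 ∧ x 0 = x₀ ∧ ∀ᶠ t in nhds (0 : ℝ), x t = x₀ - t • Φ (t, x t) := by
  -- The differential of `F` at `(0, x₀)` is triangular with identity diagonal, whatever `Φ` is. The
  -- solution is the second component of the local inverse along `t ↦ (t, x₀)`.
  set F : ℝ × X → ℝ × X := fun z => (z.1, z.2 + z.1 • Φ z) with hF
  have hFa : AnalyticAt ℝ F (0, x₀) :=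
    analyticAt_fst.prod (analyticAt_snd.add (analyticAt_fst.smul hΦ))
  set e : (ℝ × X) ≃L[ℝ] (ℝ × X) := (ContinuousLinearEquiv.refl ℝ ℝ).skewProd
    (ContinuousLinearEquiv.refl ℝ X) (ContinuousLinearMap.toSpanSingleton ℝ (Φ (0, x₀))) with he
  have hd : HasFDerivAt F (e : (ℝ × X) →L[ℝ] (ℝ × X)) (0, x₀) := by
    have h1 := (hasFDerivAt_fst (𝕜 := ℝ) (p := ((0 : ℝ), x₀))).prodMk
      ((hasFDerivAt_snd (𝕜 := ℝ) (p := ((0 : ℝ), x₀))).add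
      ((hasFDerivAt_fst (𝕜 := ℝ) (p := ((0 : ℝ), x₀))).smul hΦ.differentiableAt.hasFDerivAt))
    refine h1.congr_fderiv ?_
    ext <;> simp [he]
  -- In `WithTop ℕ∞` the order `⊤` means analytic, so the local inverse is analytic as well.
  have hc : ContDiffAt ℝ ⊤ F (0, x₀) := hFa.contDiffAt
  have hn : (⊤ : WithTop ℕ∞) ≠ 0 := by simp
  have hs := hc.hasStrictFDerivAt' hd hn
  have hF0 : F (0, x₀) = (0, x₀) := by simp [hF]
  obtain ⟨g, hg, hg0, hev⟩ : ∃ g : ℝ × X → ℝ × X, AnalyticAt ℝ g (0, x₀) ∧ g (0, x₀) = (0, x₀) ∧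
      ∀ᶠ z in nhds ((0 : ℝ), x₀), F (g z) = z := by
    have h1 := hc.to_localInverse hd hn
    have h2 := hc.localInverse_apply_image hd hn
    have h3 := hs.eventually_right_inverse
    rw [hF0] at h1 h2 h3
    exact ⟨_, h1.analyticAt, h2, h3⟩
  have hι : AnalyticAt ℝ (fun t : ℝ => (t, x₀)) 0 := analyticAt_id.prod analyticAt_const
  refine ⟨fun t => (g (t, x₀)).2, ?_, congrArg Prod.snd hg0, ?_⟩
  · exact analyticAt_snd.comp (hg.fun_comp (f := fun t : ℝ => (t, x₀)) hι)
  · filter_upwards [hι.continuousAt.eventually hev] with t ht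
    have h1 := congrArg Prod.fst ht
    have h2 := congrArg Prod.snd ht
    simp only [hF] at h1 h2
    have h3 : g (t, x₀) = (t, (g (t, x₀)).2) :=
      Prod.ext h1 rfl
    rw [h1, h3] at h2
    exact eq_sub_of_add_eq h2

/-- A Lipschitz constant of `Φ` near `(0, x₀)` is multiplied by `|t|`, so the map contracts towards
the analytic solution. The property `Q` carries the side conditions needed at every point that the
iteration may visit. -/
lemma exists_fixedPoint {Φ : ℝ × X → X} {x₀ : X} (hΦ : AnalyticAt ℝ Φ (0, x₀))
    {Q : ℝ × X → Prop} (hQ : ∀ᶠ z in nhds (0, x₀), Q z) :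
    ∃ (τ ρ C : ℝ) (x : ℝ → X), 0 < τ ∧ 0 < ρ ∧ 1 ≤ C ∧ x 0 = x₀ ∧ ∀ t : ℝ, |t| < τ →
      AnalyticAt ℝ x t ∧ x t = x₀ - t • Φ (t, x t) ∧ x t ∈ Metric.closedBall x₀ ρ ∧
      ‖x₀ - x t‖ ≤ C * |t| ∧ ∀ y ∈ Metric.closedBall x₀ ρ, Q (t, y) ∧
        x₀ - t • Φ (t, y) ∈ Metric.closedBall x₀ ρ ∧
        ‖x₀ - t • Φ (t, y) - x t‖ ≤ C * |t| * ‖y - x t‖ := by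
  obtain ⟨x, hxa, hx0, hx⟩ := exists_analyticAt_fixedPoint hΦ
  obtain ⟨K, s, hs, hK⟩ := hΦ.hasStrictFDerivAt.exists_lipschitzOnWith
  set M := ‖Φ (0, x₀)‖ + 1 with hM
  have hM0 : 0 < M := by positivity
  have hb : ∀ᶠ z in nhds ((0 : ℝ), x₀), ‖Φ z‖ ≤ M :=
    (hΦ.continuousAt.norm.eventually_lt_const (lt_add_one _)).mono fun z hz => hz.le
  obtain ⟨r, hr, hball⟩ := Metric.eventually_nhds_iff_ball.1 ((hb.and hQ).and hs)
  have hxn : Metric.ball x₀ (r / 2) ∈ nhds (x 0) := by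
    rw [hx0]
    exact Metric.ball_mem_nhds x₀ (half_pos hr)
  obtain ⟨δ, hδ, hxt⟩ := Metric.eventually_nhds_iff_ball.1 ((hx.and hxa.eventually_analyticAt).and
    (hxa.continuousAt.eventually hxn))
  have hmem : ∀ t : ℝ, |t| < r → ∀ y ∈ Metric.closedBall x₀ (r / 2),
      ((t, y) : ℝ × X) ∈ Metric.ball ((0 : ℝ), x₀) r := by
    intro t ht y hy
    rw [← ball_prod_same]
    exact ⟨by simpa using ht, Metric.closedBall_subset_ball (half_lt_self hr) hy⟩
  -- The bound `r / 2 / M` keeps the image of the closed ball inside itself. In `C`, the constant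
  -- `K` gives the contraction and `M` the initial error.
  refine ⟨min (min δ r) (r / 2 / M), r / 2, max 1 (max K M), x, by positivity, half_pos hr,
    le_max_left _ _, hx0, fun t ht => ?_⟩
  have ht1 : |t| < δ := ht.trans_le ((min_le_left _ _).trans (min_le_left _ _))
  have ht2 : |t| < r := ht.trans_le ((min_le_left _ _).trans (min_le_right _ _))
  have ht3 : |t| * M ≤ r / 2 := by
    rw [← le_div_iff₀ hM0]
    exact (ht.trans_le (min_le_right _ _)).le
  obtain ⟨⟨hfix, han⟩, hxb⟩ := hxt t (by simpa using ht1)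
  have hxm : x t ∈ Metric.closedBall x₀ (r / 2) := Metric.ball_subset_closedBall hxb
  have hbd : ∀ y ∈ Metric.closedBall x₀ (r / 2), ‖t • Φ (t, y)‖ ≤ |t| * M := by
    intro y hy
    rw [norm_smul, Real.norm_eq_abs]
    exact mul_le_mul_of_nonneg_left (hball _ (hmem t ht2 y hy)).1.1 (abs_nonneg t)
  refine ⟨han, hfix, hxm, ?_, fun y hy => ⟨(hball _ (hmem t ht2 y hy)).1.2, ?_, ?_⟩⟩
  · have h1 : x₀ - x t = t • Φ (t, x t) := by
      nth_rewrite 1 [hfix]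
      rw [sub_sub_cancel]
    rw [h1, mul_comm]
    refine (hbd _ hxm).trans (mul_le_mul_of_nonneg_left ?_ (abs_nonneg t))
    exact (le_max_right _ _).trans (le_max_right _ _)
  · rw [mem_closedBall_iff_norm, sub_sub_cancel_left, norm_neg]
    exact (hbd y hy).trans ht3
  · have h1 : x₀ - t • Φ (t, y) - x t = t • (Φ (t, x t) - Φ (t, y)) := by
      nth_rewrite 1 [hfix]
      rw [smul_sub]; abel
    have h2 := hK.norm_sub_le (hball _ (hmem t ht2 _ hxm)).2 (hball _ (hmem t ht2 y hy)).2
    have h3 : ‖((t, x t) : ℝ × X) - (t, y)‖ = ‖y - x t‖ := by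
      rw [Prod.mk_sub_mk, sub_self, Prod.norm_mk, norm_zero, norm_sub_rev,
        max_eq_right (norm_nonneg _)]
    rw [h1, norm_smul, Real.norm_eq_abs, mul_comm _ |t|, mul_assoc]
    rw [h3] at h2
    refine mul_le_mul_of_nonneg_left (h2.trans ?_) (abs_nonneg t)
    gcongr
    exact (le_max_left _ _).trans (le_max_right _ _)

end FixedPoint

/-! ### The second order remainder of a product -/

section ProdRem

variable {𝔸 : Type*} [NormedRing 𝔸] [NormedAlgebra ℝ 𝔸]

/-- The remainder in `∏ (1 + t E) = 1 + t ∑ E + t² R`. -/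
def prodRem (t : ℝ) : List 𝔸 → 𝔸
  | [] => 0
  | E :: l => prodRem t l + E * (l.sum + t • prodRem t l)

lemma prod_one_add_smul (t : ℝ) (l : List 𝔸) :
    (l.map fun E => 1 + t • E).prod = 1 + t • (l.sum + t • prodRem t l) := by
  induction l with
  | nil => simp [prodRem]
  | cons E l ih =>
    rw [List.map_cons, List.prod_cons, ih, List.sum_cons, prodRem]
    simp only [add_mul, mul_add, smul_add, one_mul, mul_one, smul_mul_assoc, mul_smul_comm]
    abel

lemma analyticAt_list_sum {Y : Type*} [NormedAddCommGroup Y] [NormedSpace ℝ Y] {y : Y}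
    (l : List (Y → 𝔸)) (h : ∀ f ∈ l, AnalyticAt ℝ f y) :
    AnalyticAt ℝ (fun z => (l.map fun f => f z).sum) y := by
  induction l with
  | nil => exact analyticAt_const
  | cons f l ih =>
    simp only [List.map_cons, List.sum_cons]
    exact (h f List.mem_cons_self).add (ih fun g hg => h g (List.mem_cons_of_mem _ hg))

lemma analyticAt_prodRem {Y : Type*} [NormedAddCommGroup Y] [NormedSpace ℝ Y] {y : Y}
    {τ : Y → ℝ} (hτ : AnalyticAt ℝ τ y) (l : List (Y → 𝔸)) (h : ∀ f ∈ l, AnalyticAt ℝ f y) :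
    AnalyticAt ℝ (fun z => prodRem (τ z) (l.map fun f => f z)) y := by
  induction l with
  | nil => exact analyticAt_const
  | cons f l ih =>
    have hl : ∀ g ∈ l, AnalyticAt ℝ g y := fun g hg => h g (List.mem_cons_of_mem _ hg)
    simp only [List.map_cons, prodRem]
    exact (ih hl).add ((h f List.mem_cons_self).mul
      ((analyticAt_list_sum l hl).add (hτ.smul (ih hl))))

end ProdRem

end

end ExactSplitting

namespace ExactSplitting

noncomputable section

variable {n : ℕ}

/-! ### Expansion of the logarithm of the product -/

/-- The coefficients `(A, L, U, V^{(m)})` of a state. -/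
abbrev Params (n : ℕ) : Type :=
  Matrix (Fin n) (Fin n) ℝ × Matrix (Fin n) (Fin n) ℝ × Matrix (Fin n) (Fin n) ℝ ×
    Matrix (Fin n) (Fin n) ℝ

/-- The coefficients of a state, as an element of a normed space. -/
def State.toParams (s : State n) : Params n := (s.A, s.L, s.U, s.Vm)

/-- The state with given coefficients. -/
def Params.toState (p : Params n) : State n := ⟨p.1, p.2.1, p.2.2.1, p.2.2.2⟩

lemma analyticAt_linearMap_comp {Y E F : Type*} [NormedAddCommGroup Y] [NormedSpace ℝ Y]
    [NormedAddCommGroup E] [NormedSpace ℝ E] [FiniteDimensional ℝ E]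
    [NormedAddCommGroup F] [NormedSpace ℝ F] (T : E →ₗ[ℝ] F) {f : Y → E} {y : Y}
    (hf : AnalyticAt ℝ f y) : AnalyticAt ℝ (fun z => T (f z)) y :=
  (T.toContinuousLinearMap.analyticAt (f y)).fun_comp hf

/-- The infinitesimal generator of the shear blocks. -/
def shearGen : Matrix (Fin n) (Fin n) ℝ →ₗ[ℝ] Matrix (Fin n ⊕ Fin n) (Fin n ⊕ Fin n) ℝ where
  toFun N := Matrix.fromBlocks N 0 0 (-Nᵀ)
  map_add' N N' := by simp [Matrix.fromBlocks_add, add_comm]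
  map_smul' c N := by simp [Matrix.fromBlocks_smul]

lemma shearGen_apply (N : Matrix (Fin n) (Fin n) ℝ) :
    shearGen N = Matrix.fromBlocks N 0 0 (-Nᵀ) := rfl

/-- Extraction of a row, as a linear map. -/
def rowPartₗ (j : Fin n) : Matrix (Fin n) (Fin n) ℝ →ₗ[ℝ] Matrix (Fin n) (Fin n) ℝ where
  toFun := rowPart j
  map_add' N N' := by simp [rowPart, mul_add]
  map_smul' c N := by simp [rowPart]

/-- The generators of the factors of `P`, as functions of the coefficients. -/
def genFuns (n : ℕ) : List (Params n →ₗ[ℝ] Matrix (Fin n ⊕ Fin n) (Fin n ⊕ Fin n) ℝ) :=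
  (List.finRange n).dropLast.map (fun j => shearGen ∘ₗ rowPartₗ j ∘ₗ
      LinearMap.fst ℝ _ _ ∘ₗ LinearMap.snd ℝ _ _ ∘ₗ LinearMap.snd ℝ _ _)
    ++ [fromBlocksₗ n ∘ₗ LinearMap.prod 0 (LinearMap.prod ((2 : ℝ) • LinearMap.fst ℝ _ _) 0)]
    ++ (List.finRange n).tail.map (fun j => shearGen ∘ₗ rowPartₗ j ∘ₗ
      LinearMap.fst ℝ _ _ ∘ₗ LinearMap.snd ℝ _ _)
    ++ [fromBlocksₗ n ∘ₗ LinearMap.prod 0 (LinearMap.prod 0 (LinearMap.prod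
      (-((2 : ℝ) • (LinearMap.snd ℝ _ _ ∘ₗ LinearMap.snd ℝ _ _ ∘ₗ LinearMap.snd ℝ _ _))) 0))]

/-- The generators of the factors of `P`. -/
def gens (p : Params n) : List (Matrix (Fin n ⊕ Fin n) (Fin n ⊕ Fin n) ℝ) :=
  (genFuns n).map fun f => f p

lemma gens_eq (p : Params n) : gens p =
    (List.finRange n).dropLast.map (fun j => shearGen (rowPart j p.2.2.1))
      ++ [Matrix.fromBlocks 0 ((2 : ℝ) • p.1) 0 0]
      ++ (List.finRange n).tail.map (fun j => shearGen (rowPart j p.2.1))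
      ++ [Matrix.fromBlocks 0 0 (-((2 : ℝ) • p.2.2.2)) 0] := by
  simp only [gens, genFuns, List.map_append, List.map_map, List.map_cons, List.map_nil]
  rfl

lemma shearBlock_eq (t : ℝ) (N : Matrix (Fin n) (Fin n) ℝ) :
    shearBlock t N = 1 + t • shearGen N := by
  simp [shearBlock, shearGen_apply, ← Matrix.fromBlocks_one, Matrix.fromBlocks_smul,
    Matrix.fromBlocks_add, sub_eq_add_neg]

/-- The rescaled increment `t⁻¹ (P - 1)`. -/
def increment (z : ℝ × Params n) : Matrix (Fin n ⊕ Fin n) (Fin n ⊕ Fin n) ℝ :=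
  (gens z.2).sum + z.1 • prodRem z.1 (gens z.2)

lemma State.P_eq (t : ℝ) (s : State n) : s.P t = 1 + t • increment (t, s.toParams) := by
  rw [increment, ← prod_one_add_smul, gens_eq]
  simp only [List.map_append, List.map_map, List.map_cons, List.map_nil, List.prod_append,
    List.prod_cons, List.prod_nil, mul_one, State.P, State.toParams, shearBlock_eq,
    Function.comp_def]
  have h1 : Matrix.fromBlocks 1 ((2 * t) • s.A) (0 : Matrix (Fin n) (Fin n) ℝ) 1
      = 1 + t • Matrix.fromBlocks (0 : Matrix (Fin n) (Fin n) ℝ) ((2 : ℝ) • s.A) 0 0 := by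
    simp [← Matrix.fromBlocks_one, Matrix.fromBlocks_smul, Matrix.fromBlocks_add, smul_smul,
      mul_comm]
  have h2 : Matrix.fromBlocks 1 (0 : Matrix (Fin n) (Fin n) ℝ) (-((2 * t) • s.Vm)) 1
      = 1 + t • Matrix.fromBlocks (0 : Matrix (Fin n) (Fin n) ℝ) 0 (-((2 : ℝ) • s.Vm)) 0 := by
    simp [← Matrix.fromBlocks_one, Matrix.fromBlocks_smul, Matrix.fromBlocks_add, smul_smul,
      mul_comm]
  rw [h1, h2]

lemma analyticAt_sum_gens (z : ℝ × Params n) :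
    AnalyticAt ℝ (fun z : ℝ × Params n => (gens z.2).sum) z := by
  have h := analyticAt_list_sum (y := z) ((genFuns n).map fun f (w : ℝ × Params n) => f w.2) (by
    intro g hg
    obtain ⟨f, -, rfl⟩ := List.mem_map.1 hg
    exact analyticAt_linearMap_comp f analyticAt_snd)
  simp only [List.map_map, Function.comp_def] at h
  exact h

lemma analyticAt_prodRem_gens (z : ℝ × Params n) :
    AnalyticAt ℝ (fun z : ℝ × Params n => prodRem z.1 (gens z.2)) z := by
  have h := analyticAt_prodRem (y := z) analyticAt_fst
    ((genFuns n).map fun f (w : ℝ × Params n) => f w.2) (by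
    intro g hg
    obtain ⟨f, -, rfl⟩ := List.mem_map.1 hg
    exact analyticAt_linearMap_comp f analyticAt_snd)
  simp only [List.map_map, Function.comp_def] at h
  exact h

lemma analyticAt_increment (z : ℝ × Params n) : AnalyticAt ℝ (increment (n := n)) z :=
  (analyticAt_sum_gens z).add (analyticAt_fst.smul (analyticAt_prodRem_gens z))

/-- The remainder in `log P = t ∑ E + t² R`. -/
def logRem (z : ℝ × Params n) : Matrix (Fin n ⊕ Fin n) (Fin n ⊕ Fin n) ℝ :=
  prodRem z.1 (gens z.2) + increment z ^ 2 * logTail (z.1 • increment z)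

lemma analyticAt_logRem (p : Params n) : AnalyticAt ℝ (logRem (n := n)) (0, p) := by
  refine (analyticAt_prodRem_gens _).add (((analyticAt_increment _).pow 2).mul ?_)
  refine AnalyticAt.fun_comp (f := fun z : ℝ × Params n => z.1 • increment z) ?_
    (analyticAt_fst.smul (analyticAt_increment _))
  exact analyticAt_logTail (by simp)

/-- From `log (1 + t W) = t W + t² W² ℓ(t W)`: the factor `t²` is explicit, so division by `t`
leaves a remainder that stays analytic at `t = 0`. -/
lemma State.matLog_P {t : ℝ} {s : State n} (h : ‖t • increment (t, s.toParams)‖ < 1) :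
    matLog (s.P t) = t • (gens s.toParams).sum + t ^ 2 • logRem (t, s.toParams) := by
  rw [State.P_eq, matLog_eq, logSeries_eq h, logRem, smul_pow, smul_mul_assoc, smul_add, ← add_assoc]
  congr 1
  rw [increment, smul_add, smul_smul, ← sq]

/-- The states whose coefficients have the required structure. -/
structure State.Structured (s : State n) : Prop where
  symm_A : s.A.IsSymm
  strictLower_L : ∀ i j, i ≤ j → s.L i j = 0
  strictUpper_U : ∀ i j, j ≤ i → s.U i j = 0
  symm_Vm : s.Vm.IsSymm

lemma sum_map_rowPart_finRange (M : Matrix (Fin n) (Fin n) ℝ) :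
    ((List.finRange n).map fun j => rowPart j M).sum = M := by
  rw [← Fin.sum_univ_def]
  ext a b
  rw [Matrix.sum_apply]
  simp [rowPart_apply]

/-- The first row of a strictly lower triangular matrix is zero, so omitting the index `1` in the
product loses nothing. -/
lemma sum_map_rowPart_tail {L : Matrix (Fin n) (Fin n) ℝ} (hL : ∀ i j, i ≤ j → L i j = 0) :
    ((List.finRange n).tail.map fun j => rowPart j L).sum = L := by
  have h := sum_map_rowPart_finRange L
  cases n with
  | zero => exact Subsingleton.elim _ _
  | succ m =>
    rw [List.finRange_succ, List.map_cons, List.sum_cons] at h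
    have h0 : rowPart 0 L = 0 := by
      ext a b
      rw [rowPart_apply, hL 0 b (Fin.zero_le _), ite_self, Matrix.zero_apply]
    rw [h0, zero_add] at h
    rw [List.finRange_succ, List.tail_cons, h]

lemma sum_map_rowPart_dropLast {U : Matrix (Fin n) (Fin n) ℝ} (hU : ∀ i j, j ≤ i → U i j = 0) :
    ((List.finRange n).dropLast.map fun j => rowPart j U).sum = U := by
  have h := sum_map_rowPart_finRange U
  cases n with
  | zero => exact Subsingleton.elim _ _
  | succ m =>
    rw [List.finRange_succ_last, List.map_append, List.sum_append] at h
    have h0 : rowPart (Fin.last m) U = 0 := by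
      ext a b
      rw [rowPart_apply, hU _ b (Fin.le_last _), ite_self, Matrix.zero_apply]
    rw [List.map_singleton, List.sum_singleton, h0, add_zero] at h
    rw [List.finRange_succ_last, List.dropLast_concat, h]

lemma State.Structured.sum_gens {s : State n} (hs : s.Structured) :
    (gens s.toParams).sum = Matrix.fromBlocks (s.U + s.L) ((2 : ℝ) • s.A) (-((2 : ℝ) • s.Vm))
      (-(s.U + s.L)ᵀ) := by
  have h : ∀ (l : List (Fin n)) (M : Matrix (Fin n) (Fin n) ℝ),
      (l.map fun j => shearGen (rowPart j M)).sum = shearGen ((l.map fun j => rowPart j M).sum) := by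
    intro l M
    rw [map_list_sum, List.map_map]
    rfl
  rw [gens_eq]
  simp only [List.sum_append, h, List.sum_singleton, State.toParams,
    sum_map_rowPart_tail hs.strictLower_L, sum_map_rowPart_dropLast hs.strictUpper_U]
  simp [shearGen_apply, Matrix.fromBlocks_add, add_comm]

/-- The remainder in the expansion of the Hamiltonian `-t⁻¹ J log P`. -/
def hamRem (z : ℝ × Params n) : Matrix (Fin n ⊕ Fin n) (Fin n ⊕ Fin n) ℝ :=
  -(sympJ n * logRem z)

lemma analyticAt_hamRem (p : Params n) : AnalyticAt ℝ (hamRem (n := n)) (0, p) :=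
  (analyticAt_const.mul (analyticAt_logRem p)).neg

/-- The leading part of `log P` is the sum of the generators of the factors, and multiplying it by
`-J` returns the coefficients of the state. -/
lemma State.Structured.H_eq {t : ℝ} (ht : t ≠ 0) {s : State n} (hs : s.Structured)
    (h : ‖t • increment (t, s.toParams)‖ < 1) :
    s.H t = Matrix.fromBlocks ((2 : ℝ) • s.Vm) (s.U + s.L)ᵀ (s.U + s.L) ((2 : ℝ) • s.A)
      + t • hamRem (t, s.toParams) := by
  rw [State.H, State.matLog_P h, mul_add, mul_smul_comm, mul_smul_comm, smul_add, smul_smul,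
    smul_smul, inv_mul_cancel₀ ht, one_smul, sq, inv_mul_cancel_left₀ ht, neg_add, hamRem, smul_neg]
  congr 1
  rw [hs.sum_gens]
  simp [sympJ, Matrix.fromBlocks_multiply, Matrix.fromBlocks_neg]

/-- The diagonal part of the remainder. -/
def diagRem (z : ℝ × Params n) : Matrix (Fin n) (Fin n) ℝ :=
  Matrix.diagonal (hamRem z).toBlocks₂₁.diag

/-- The map `Φ` such that a step of the iterative method is `s ↦ s₀ - t Φ(t, s)`. -/
def stepRem (B : Matrix (Fin n) (Fin n) ℝ) (z : ℝ × Params n) : Params n :=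
  ((1 / 2 : ℝ) • (hamRem z).toBlocks₂₂, lowerPart (hamRem z).toBlocks₂₁,
    upperPart (hamRem z).toBlocks₂₁,
    (1 / 2 : ℝ) • (hamRem z).toBlocks₁₁ - (1 / 2 : ℝ) • (diagRem z * B - B * diagRem z)
      - (z.1 / 2) • diagRem z ^ 2)

/-- The blocks of a matrix, as linear maps. -/
def toBlocksₗ (n : ℕ) : Matrix (Fin n ⊕ Fin n) (Fin n ⊕ Fin n) ℝ →ₗ[ℝ]
    (Matrix (Fin n) (Fin n) ℝ × Matrix (Fin n) (Fin n) ℝ × Matrix (Fin n) (Fin n) ℝ) where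
  toFun M := (M.toBlocks₁₁, M.toBlocks₂₁, M.toBlocks₂₂)
  map_add' _ _ := rfl
  map_smul' _ _ := rfl

/-- The strictly lower, strictly upper and diagonal parts of a matrix, as linear maps. -/
def triangularₗ (n : ℕ) : Matrix (Fin n) (Fin n) ℝ →ₗ[ℝ]
    (Matrix (Fin n) (Fin n) ℝ × Matrix (Fin n) (Fin n) ℝ × Matrix (Fin n) (Fin n) ℝ) where
  toFun M := (lowerPart M, upperPart M, Matrix.diagonal M.diag)
  map_add' M N := by
    refine Prod.ext ?_ (Prod.ext ?_ ?_)
    · ext i j; simp only [lowerPart, Matrix.of_apply, Matrix.add_apply, Prod.fst_add]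
      split_ifs <;> simp
    · ext i j; simp only [upperPart, Matrix.of_apply, Matrix.add_apply, Prod.fst_add, Prod.snd_add]
      split_ifs <;> simp
    · simp
  map_smul' c M := by
    refine Prod.ext ?_ (Prod.ext ?_ ?_)
    · ext i j; simp [lowerPart]
    · ext i j; simp [upperPart]
    · simp [Matrix.diagonal_smul]

lemma analyticAt_diagRem (p : Params n) : AnalyticAt ℝ (diagRem (n := n)) (0, p) := by
  have h1 := analyticAt_linearMap_comp (toBlocksₗ n) (analyticAt_hamRem p)
  have h2 := analyticAt_linearMap_comp (triangularₗ n) (analyticAt_fst.fun_comp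
    (analyticAt_snd.fun_comp h1))
  exact analyticAt_snd.fun_comp (analyticAt_snd.fun_comp h2)

lemma analyticAt_stepRem (B : Matrix (Fin n) (Fin n) ℝ) (p : Params n) :
    AnalyticAt ℝ (stepRem B) (0, p) := by
  have h1 := analyticAt_linearMap_comp (toBlocksₗ n) (analyticAt_hamRem p)
  have h2 := analyticAt_linearMap_comp (triangularₗ n) (analyticAt_fst.fun_comp
    (analyticAt_snd.fun_comp h1))
  have hD := analyticAt_diagRem p
  have h3 : AnalyticAt ℝ (fun z : ℝ × Params n => (hamRem z).toBlocks₂₂) (0, p) :=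
    analyticAt_snd.fun_comp (analyticAt_snd.fun_comp h1)
  have h4 : AnalyticAt ℝ (fun z : ℝ × Params n => (hamRem z).toBlocks₁₁) (0, p) :=
    analyticAt_fst.fun_comp h1
  have h5 : AnalyticAt ℝ (fun z : ℝ × Params n => lowerPart (hamRem z).toBlocks₂₁) (0, p) :=
    analyticAt_fst.fun_comp h2
  have h6 : AnalyticAt ℝ (fun z : ℝ × Params n => upperPart (hamRem z).toBlocks₂₁) (0, p) :=
    analyticAt_fst.fun_comp (analyticAt_snd.fun_comp h2)
  have h7 : AnalyticAt ℝ (fun z : ℝ × Params n => z.1 / 2) (0, p) := analyticAt_fst.div_const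
  have h8 : AnalyticAt ℝ (fun z : ℝ × Params n => diagRem z * B - B * diagRem z) (0, p) :=
    (hD.mul analyticAt_const).sub (analyticAt_const.mul hD)
  exact (h3.const_smul (c := (1 / 2 : ℝ))).prod (h5.prod (h6.prod
    (((h4.const_smul (c := (1 / 2 : ℝ))).sub (h8.const_smul (c := (1 / 2 : ℝ)))).sub
      (h7.smul (hD.pow 2)))))

end

end ExactSplitting

namespace ExactSplitting

noncomputable section

variable {n : ℕ}

/-! ### One step of the iterative method -/

lemma symplectic_list_prod (l : List (Matrix (Fin n ⊕ Fin n) (Fin n ⊕ Fin n) ℝ))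
    (h : ∀ M ∈ l, Mᵀ * sympJ n * M = sympJ n) : l.prodᵀ * sympJ n * l.prod = sympJ n := by
  induction l with
  | nil => simp
  | cons M l ih =>
    rw [List.prod_cons]
    exact symplectic_mul (h M List.mem_cons_self)
      (ih fun N hN => h N (List.mem_cons_of_mem _ hN))

lemma symplectic_shearBlock_rowPart (t : ℝ) {j : Fin n} {M : Matrix (Fin n) (Fin n) ℝ}
    (hM : M j j = 0) :
    (shearBlock t (rowPart j M))ᵀ * sympJ n * shearBlock t (rowPart j M) = sympJ n := by
  have h0 : (t • M) j j = 0 := by simp [hM]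
  have h := (metaplectic_transportOp (rowPart_mul_rowPart h0 (t • M))
    (det_one_sub_rowPart h0)).symplectic
  rwa [rowPart_smul, Matrix.transpose_smul] at h

namespace State.Structured

variable {s : State n}

lemma symplectic_P (hs : s.Structured) (t : ℝ) : (s.P t)ᵀ * sympJ n * s.P t = sympJ n := by
  refine symplectic_mul (symplectic_mul (symplectic_mul ?_ ?_) ?_)
    (metaplectic_phaseOp t hs.symm_Vm).symplectic
  · refine symplectic_list_prod _ fun M hM => ?_
    obtain ⟨j, -, rfl⟩ := List.mem_map.1 hM
    exact symplectic_shearBlock_rowPart t (hs.strictUpper_U j j le_rfl)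
  · simp [sympJ, Matrix.fromBlocks_transpose, Matrix.fromBlocks_multiply, hs.symm_A.eq]
  · refine symplectic_list_prod _ fun M hM => ?_
    obtain ⟨j, -, rfl⟩ := List.mem_map.1 hM
    exact symplectic_shearBlock_rowPart t (hs.strictLower_L j j le_rfl)

end State.Structured

lemma lowerPart_add_upperPart_add_diagonal (M : Matrix (Fin n) (Fin n) ℝ) :
    lowerPart M + upperPart M + Matrix.diagonal M.diag = M := by
  ext i j
  simp only [lowerPart, upperPart, Matrix.add_apply, Matrix.of_apply, Matrix.diagonal_apply,
    Matrix.diag_apply]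
  rcases lt_trichotomy i j with h | rfl | h
  · simp [h, h.not_gt, h.ne]
  · simp
  · simp [h, h.not_gt, h.ne']

lemma transpose_diagonal_part (M : Matrix (Fin n) (Fin n) ℝ) :
    (Matrix.diagonal M.diag)ᵀ = Matrix.diagonal M.diag := Matrix.diagonal_transpose _

lemma State.wellDefined_of_isSymm {t : ℝ} (ht : t ≠ 0) {s : State n}
    (hsum : Summable (logTerm (s.P t))) (hsymm : (s.H t).IsSymm) : s.WellDefined t := by
  refine ⟨hsum, hsymm, ?_⟩
  have h21 : s.Ltilde t + s.Utilde t + t • s.D t = (s.H t).toBlocks₂₁ := by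
    rw [Ltilde, Utilde, D, smul_smul, mul_inv_cancel₀ ht, one_smul,
      lowerPart_add_upperPart_add_diagonal]
  have hD : (s.D t)ᵀ = s.D t := by rw [D, Matrix.transpose_smul, transpose_diagonal_part]
  have h12 : (s.Ltilde t)ᵀ + (s.Utilde t)ᵀ + t • s.D t = (s.H t).toBlocks₁₂ := by
    have h : (s.Ltilde t)ᵀ + (s.Utilde t)ᵀ + t • s.D t = ((s.H t).toBlocks₂₁)ᵀ := by
      rw [← h21, Matrix.transpose_add, Matrix.transpose_add, Matrix.transpose_smul, hD]
    rw [h]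
    ext i j
    exact congrFun (congrFun hsymm (Sum.inl i)) (Sum.inr j)
  rw [h21, h12, Vtilde, Atilde, smul_smul, smul_smul]
  norm_num [Matrix.fromBlocks_toBlocks]

lemma State.Structured.wellDefined {t : ℝ} (ht : t ≠ 0) {s : State n} (hs : s.Structured)
    (h1 : ‖t • increment (t, s.toParams)‖ < 1)
    (h2 : (1 + t • increment (t, s.toParams))ᵀ * sympJ n * (1 + t • increment (t, s.toParams))
      = sympJ n → (sympJ n * matLog (1 + t • increment (t, s.toParams))).IsSymm) :
    s.WellDefined t := by
  have h := hs.symplectic_P t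
  rw [State.P_eq] at h
  refine State.wellDefined_of_isSymm ht ?_ ?_
  · rw [State.P_eq, funext (logTerm_eq _)]
    exact summable_logSeries h1
  · rw [State.H, State.P_eq]
    exact ((h2 h).smul _).neg

namespace State

lemma WellDefined.symm_Atilde {t : ℝ} {s : State n} (h : s.WellDefined t) :
    (s.Atilde t).IsSymm := by
  refine Matrix.IsSymm.smul ?_ _
  ext i j
  exact congrFun (congrFun h.symm (Sum.inr i)) (Sum.inr j)

lemma WellDefined.symm_Vtilde {t : ℝ} {s : State n} (h : s.WellDefined t) :
    (s.Vtilde t).IsSymm := by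
  refine Matrix.IsSymm.smul ?_ _
  ext i j
  exact congrFun (congrFun h.symm (Sum.inl i)) (Sum.inl j)

lemma isSymm_D (t : ℝ) (s : State n) : (s.D t).IsSymm := by
  rw [Matrix.IsSymm, D, Matrix.transpose_smul, transpose_diagonal_part]

/-- The only new point is the commutator: `[D, B]` is symmetric because `D` is symmetric and `B` is
skew. -/
lemma Structured.step {V B : Matrix (Fin n) (Fin n) ℝ} (hV : V.IsSymm) (hB : Bᵀ = -B) {t : ℝ}
    {s : State n} (hs : s.Structured) (h : s.WellDefined t) : (s.step V B t).Structured where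
  symm_A := (hs.symm_A.add (Matrix.isSymm_one.smul _)).sub h.symm_Atilde
  strictLower_L i j hij := by
    simp [State.step, hs.strictLower_L i j hij, Ltilde, lowerPart, hij.not_gt]
  strictUpper_U i j hij := by
    simp [State.step, hs.strictUpper_U i j hij, Utilde, upperPart, hij.not_gt]
  symm_Vm := by
    have hD := isSymm_D t s
    refine ((((hs.symm_Vm.add hV).sub h.symm_Vtilde).add (Matrix.IsSymm.smul ?_ _))).add
      (Matrix.IsSymm.smul (hD.pow 2) _)
    rw [Matrix.IsSymm, Matrix.transpose_sub, Matrix.transpose_mul, Matrix.transpose_mul, hB, hD.eq]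
    noncomm_ring

lemma structured_initial {V : Matrix (Fin n) (Fin n) ℝ} (hV : V.IsSymm)
    (B : Matrix (Fin n) (Fin n) ℝ) :
    (⟨(1 / 2 : ℝ) • 1, lowerPart B, upperPart B, V⟩ : State n).Structured where
  symm_A := Matrix.isSymm_one.smul _
  strictLower_L i j hij := by simp [lowerPart, hij.not_gt]
  strictUpper_U i j hij := by simp [upperPart, hij.not_gt]
  symm_Vm := hV

lemma lowerPart_of_structured {s : State n} (hs : s.Structured) (t : ℝ)
    (M : Matrix (Fin n) (Fin n) ℝ) : lowerPart (s.U + s.L + t • M) = s.L + t • lowerPart M := by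
  ext i j
  simp only [lowerPart, Matrix.of_apply, Matrix.add_apply, Matrix.smul_apply]
  split_ifs with h
  · rw [hs.strictUpper_U i j h.le, zero_add]
  · rw [hs.strictLower_L i j (not_lt.1 h), smul_zero, add_zero]

lemma upperPart_of_structured {s : State n} (hs : s.Structured) (t : ℝ)
    (M : Matrix (Fin n) (Fin n) ℝ) : upperPart (s.U + s.L + t • M) = s.U + t • upperPart M := by
  ext i j
  simp only [upperPart, Matrix.of_apply, Matrix.add_apply, Matrix.smul_apply]
  split_ifs with h
  · rw [hs.strictLower_L i j h.le, add_zero]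
  · rw [hs.strictUpper_U i j (not_lt.1 h), smul_zero, add_zero]

/-- `U + L` has zero diagonal, so the diagonal of the lower left block is already of order `t`, and
the division by `t` defining `D` is harmless. -/
lemma Structured.D_eq {t : ℝ} (ht : t ≠ 0) {s : State n} (hs : s.Structured)
    (h : ‖t • increment (t, s.toParams)‖ < 1) : s.D t = diagRem (t, s.toParams) := by
  have h1 : (s.H t).toBlocks₂₁ = s.U + s.L + t • (hamRem (t, s.toParams)).toBlocks₂₁ := by
    rw [hs.H_eq ht h]; rfl
  rw [D, h1, diagRem, ← Matrix.diagonal_smul]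
  congr 1
  ext i
  simp [hs.strictUpper_U i i le_rfl, hs.strictLower_L i i le_rfl, ht]

/-- The leading part of each tilde quantity is the current coefficient and cancels it; the current
state survives only through terms of order `t`. -/
lemma Structured.step_eq (V B : Matrix (Fin n) (Fin n) ℝ) {t : ℝ} (ht : t ≠ 0) {s : State n}
    (hs : s.Structured) (h : ‖t • increment (t, s.toParams)‖ < 1) :
    (s.step V B t).toParams = (⟨(1 / 2 : ℝ) • 1, lowerPart B, upperPart B, V⟩ : State n).toParams
      - t • stepRem B (t, s.toParams) := by
  have hH := hs.H_eq ht h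
  have h11 : (s.H t).toBlocks₁₁ = (2 : ℝ) • s.Vm + t • (hamRem (t, s.toParams)).toBlocks₁₁ := by
    rw [hH]; rfl
  have h21 : (s.H t).toBlocks₂₁ = s.U + s.L + t • (hamRem (t, s.toParams)).toBlocks₂₁ := by
    rw [hH]; rfl
  have h22 : (s.H t).toBlocks₂₂ = (2 : ℝ) • s.A + t • (hamRem (t, s.toParams)).toBlocks₂₂ := by
    rw [hH]; rfl
  refine Prod.ext ?_ (Prod.ext ?_ (Prod.ext ?_ ?_))
  · simp only [toParams, State.step, Atilde, h22, stepRem, Prod.fst_sub, Prod.smul_fst]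
    module
  · simp only [toParams, State.step, Ltilde, h21, stepRem, Prod.fst_sub, Prod.snd_sub,
      Prod.smul_fst, Prod.smul_snd, lowerPart_of_structured hs]
    abel
  · simp only [toParams, State.step, Utilde, h21, stepRem, Prod.fst_sub, Prod.snd_sub,
      Prod.smul_fst, Prod.smul_snd, upperPart_of_structured hs]
    abel
  · simp only [toParams, State.step, Vtilde, h11, stepRem, Prod.snd_sub, Prod.smul_snd,
      hs.D_eq ht h]
    module

end State

/-! ### Fixed points of the iterative method -/

/-- At a fixed point of the iterative method, the product of the elementary blocks is the
Hamiltonian flow. -/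
lemma State.splittingBlock_eq_exp {V B : Matrix (Fin n) (Fin n) ℝ} (hB : Bᵀ = -B) {t : ℝ}
    (ht : t ≠ 0) {s : State n} (hwd : s.WellDefined t) (hfix : s.step V B t = s)
    (h : ‖t • increment (t, s.toParams)‖ < 1) :
    splittingBlock t s.A s.L s.U (-((1 / 2 : ℝ) • s.D t)) (s.Vm + (1 / 2 : ℝ) • s.D t)
      = NormedSpace.exp (t • hamField V B) := by
  set d := s.D t with hd
  have hA : s.Atilde t = (1 / 2 : ℝ) • 1 := by
    have := congrArg State.A hfix
    simp only [State.step] at this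
    rw [add_sub_assoc, add_eq_left, sub_eq_zero] at this
    exact this.symm
  have hL : s.Ltilde t = lowerPart B := by
    have := congrArg State.L hfix
    simp only [State.step] at this
    rw [add_sub_assoc, add_eq_left, sub_eq_zero] at this
    exact this.symm
  have hU : s.Utilde t = upperPart B := by
    have := congrArg State.U hfix
    simp only [State.step] at this
    rw [add_sub_assoc, add_eq_left, sub_eq_zero] at this
    exact this.symm
  have hV : s.Vtilde t = V + (t / 2) • (d * B - B * d) + (t ^ 2 / 2) • d ^ 2 := by
    have := congrArg State.Vm hfix
    simp only [State.step, ← hd] at this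
    rw [add_sub_assoc, add_assoc, add_assoc, add_eq_left] at this
    rw [← sub_eq_zero, ← neg_eq_zero, ← this]
    abel
  have hBd : lowerPart B + upperPart B = B := by
    have h1 := lowerPart_add_upperPart_add_diagonal B
    have h2 : B.diag = 0 := funext fun i => diag_eq_zero_of_skew hB i
    rwa [h2, show Matrix.diagonal (0 : Fin n → ℝ) = 0 from Matrix.diagonal_zero, add_zero] at h1
  have hB' : (lowerPart B)ᵀ + (upperPart B)ᵀ = -B := by
    rw [← Matrix.transpose_add, hBd, hB]
  have hH := hwd.blocks
  -- At a fixed point every block of `-t⁻¹ J log P` is known explicitly in terms of `V`, `B` and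
  -- `d`.
  rw [hA, hL, hU, hV, hBd, hB', ← hd] at hH
  have hlog : matLog (s.P t) = t • (sympJ n * s.H t) := by
    rw [State.H, mul_neg, mul_smul_comm, ← mul_assoc, sympJ_mul_self, neg_one_mul, smul_neg,
      smul_neg, smul_neg, neg_neg, smul_smul, mul_inv_cancel₀ ht, one_smul]
  have hinv : phaseBlock t ((1 / 2 : ℝ) • d) * phaseBlock t (-((1 / 2 : ℝ) • d)) = 1 := by
    simp [phaseBlock, Matrix.fromBlocks_multiply, ← Matrix.fromBlocks_one]
  have hinv' : phaseBlock t (-((1 / 2 : ℝ) • d)) * phaseBlock t ((1 / 2 : ℝ) • d) = 1 := by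
    simp [phaseBlock, Matrix.fromBlocks_multiply, ← Matrix.fromBlocks_one]
  -- Conjugating the field by the shear of matrix `-t d` adds `± t d` to its diagonal blocks and
  -- replaces `2V` by `2V + t[d, B] + t² d²`, which is exactly what the fixed point equations
  -- prescribe.
  have hconj : matLog (s.P t) = phaseBlock t ((1 / 2 : ℝ) • d) * (t • hamField V B)
      * phaseBlock t (-((1 / 2 : ℝ) • d)) := by
    have h1 : phaseBlock t ((1 / 2 : ℝ) • d) = Matrix.fromBlocks 1 0 (-(t • d)) 1 := by
      rw [phaseBlock, smul_smul]; ring_nf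
    have h2 : phaseBlock t (-((1 / 2 : ℝ) • d)) = Matrix.fromBlocks 1 0 (t • d) 1 := by
      rw [phaseBlock, smul_neg, neg_neg, smul_smul]; ring_nf
    rw [hlog, hH, mul_smul_comm, smul_mul_assoc, h1, h2, hamField, sympJ]
    congr 1
    simp only [Matrix.fromBlocks_multiply, zero_mul, one_mul, zero_add, add_zero, mul_one, neg_mul,
      mul_zero]
    congr 1
    · rw [smul_smul]; norm_num
    · simp only [add_mul, neg_mul, smul_mul_assoc, mul_smul_comm, smul_add, smul_smul, sq, smul_sub,
        smul_neg]
      module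
    · abel
  have hexp : NormedSpace.exp (matLog (s.P t)) = s.P t := by
    rw [State.P_eq, matLog_eq, exp_logSeries h]
  have hP : s.P t = phaseBlock t ((1 / 2 : ℝ) • d) * NormedSpace.exp (t • hamField V B)
      * phaseBlock t (-((1 / 2 : ℝ) • d)) := by
    rw [← hexp, hconj]
    exact Matrix.exp_units_conj ⟨phaseBlock t ((1 / 2 : ℝ) • d),
      phaseBlock t (-((1 / 2 : ℝ) • d)), hinv, hinv'⟩ _
  have hsplit : splittingBlock t s.A s.L s.U (-((1 / 2 : ℝ) • d)) (s.Vm + (1 / 2 : ℝ) • d)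
      = phaseBlock t (-((1 / 2 : ℝ) • d)) * s.P t * phaseBlock t ((1 / 2 : ℝ) • d) := by
    have h1 : phaseBlock t (s.Vm + (1 / 2 : ℝ) • d)
        = phaseBlock t s.Vm * phaseBlock t ((1 / 2 : ℝ) • d) := by
      simp only [phaseBlock, Matrix.fromBlocks_multiply]
      simp [add_comm]
    rw [splittingBlock, h1, State.P, phaseBlock, phaseBlock, phaseBlock]
    simp only [mul_assoc]
  rw [hsplit, hP]
  calc _ = (phaseBlock t (-((1 / 2 : ℝ) • d)) * phaseBlock t ((1 / 2 : ℝ) • d))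
        * NormedSpace.exp (t • hamField V B)
        * (phaseBlock t (-((1 / 2 : ℝ) • d)) * phaseBlock t ((1 / 2 : ℝ) • d)) := by
        simp only [mul_assoc]
    _ = _ := by rw [hinv', one_mul, mul_one]

end

end ExactSplitting

namespace ExactSplitting

noncomputable section

variable {n : ℕ}

/-! ### Convergence of the iterative method -/

/-- Lets the fixed point inherit symmetry and triangularity from the iterates that converge to it.
-/
lemma isClosed_structured : IsClosed {p : Params n | p.toState.Structured} := by
  have h : {p : Params n | p.toState.Structured} =
      ({p : Params n | p.1ᵀ = p.1} ∩ {p | ∀ i j, i ≤ j → p.2.1 i j = 0}) ∩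
        ({p | ∀ i j, j ≤ i → p.2.2.1 i j = 0} ∩ {p | p.2.2.2ᵀ = p.2.2.2}) := by
    ext p
    exact ⟨fun h => ⟨⟨h.symm_A, h.strictLower_L⟩, h.strictUpper_U, h.symm_Vm⟩,
      fun h => ⟨h.1.1, h.1.2, h.2.1, h.2.2⟩⟩
  rw [h]
  refine ((isClosed_eq ?_ ?_).inter ?_).inter (IsClosed.inter ?_ (isClosed_eq ?_ ?_))
  · fun_prop
  · fun_prop
  · simp only [Set.ofPred_forall]
    refine isClosed_iInter fun i => isClosed_iInter fun j => isClosed_iInter fun _ =>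
      isClosed_eq ?_ continuous_const
    fun_prop
  · simp only [Set.ofPred_forall]
    refine isClosed_iInter fun i => isClosed_iInter fun j => isClosed_iInter fun _ =>
      isClosed_eq ?_ continuous_const
    fun_prop
  · fun_prop
  · fun_prop

/-- The analytic fixed points of the iterative method, and the geometric convergence towards
them. -/
lemma exists_analytic_limit {V B : Matrix (Fin n) (Fin n) ℝ} (hV : V.IsSymm) (hB : Bᵀ = -B) :
    ∃ (t₀ C K : ℝ) (x : ℝ → Params n), 0 < t₀ ∧ 1 ≤ C ∧ 0 ≤ K ∧ ∀ t : ℝ, |t| < t₀ →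
      AnalyticAt ℝ x t ∧ AnalyticAt ℝ (fun s => diagRem (s, x s)) t ∧
      (x t).toState.Structured ∧
      splittingBlock t (x t).1 (x t).2.1 (x t).2.2.1 (-((1 / 2 : ℝ) • diagRem (t, x t)))
        ((x t).2.2.2 + (1 / 2 : ℝ) • diagRem (t, x t)) = NormedSpace.exp (t • hamField V B) ∧
      (t ≠ 0 → ∀ k, (iter V B t k).WellDefined t ∧
        ‖x t - (iter V B t k).toParams‖ ≤ (C * |t|) ^ k * (C * |t|) ∧
        ‖diagRem (t, x t) - (iter V B t k).D t‖ ≤ K * ‖x t - (iter V B t k).toParams‖) := by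
  obtain ⟨ε, hε, hlog⟩ := exists_isSymm_sympJ_mul_matLog (n := n)
  set x₀ : Params n := (⟨(1 / 2 : ℝ) • 1, lowerPart B, upperPart B, V⟩ : State n).toParams with hx₀
  obtain ⟨K, S, hS, hK⟩ := (analyticAt_diagRem x₀).hasStrictFDerivAt.exists_lipschitzOnWith
  have hsmall : ∀ᶠ z in nhds ((0 : ℝ), x₀), ‖z.1 • increment z‖ < min 1 ε := by
    have hc : ContinuousAt (fun z : ℝ × Params n => ‖z.1 • increment z‖) (0, x₀) :=
      (continuousAt_fst.smul (analyticAt_increment _).continuousAt).norm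
    refine hc.eventually_lt_const ?_
    simpa using hε
  -- The side conditions on the ball are: convergence of the logarithm with symmetry of its
  -- Hamiltonian, analyticity of the diagonal remainder, and its Lipschitz bound.
  obtain ⟨τ, ρ, C, x, hτ, hρ, hC, hx0, hx⟩ := exists_fixedPoint (analyticAt_stepRem B x₀)
    ((hsmall.and (analyticAt_diagRem x₀).eventually_analyticAt).and hS)
  have hC0 : 0 < C := one_pos.trans_le hC
  have hstep : ∀ t : ℝ, |t| < τ → t ≠ 0 → ∀ s : State n, s.toParams ∈ Metric.closedBall x₀ ρ →
      s.Structured → s.WellDefined t ∧ (s.step V B t).Structured ∧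
        (s.step V B t).toParams = x₀ - t • stepRem B (t, s.toParams) ∧
        s.D t = diagRem (t, s.toParams) := by
    intro t ht ht0 s hs hss
    obtain ⟨-, -, -, -, hy⟩ := hx t ht
    have h1 := (hy _ hs).1.1.1
    have hw := hss.wellDefined ht0 (h1.trans_le (min_le_left _ _))
      (hlog _ (h1.trans_le (min_le_right _ _)))
    exact ⟨hw, hss.step hV hB hw, hss.step_eq V B ht0 (h1.trans_le (min_le_left _ _)),
      hss.D_eq ht0 (h1.trans_le (min_le_left _ _))⟩
  have hiter : ∀ t : ℝ, |t| < τ → t ≠ 0 → ∀ k, (iter V B t k).Structured ∧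
      (iter V B t k).toParams ∈ Metric.closedBall x₀ ρ ∧
      ‖(iter V B t k).toParams - x t‖ ≤ (C * |t|) ^ k * (C * |t|) := by
    intro t ht ht0 k
    obtain ⟨-, -, -, h0, hy⟩ := hx t ht
    induction k with
    | zero =>
      refine ⟨State.structured_initial hV B, Metric.mem_closedBall_self hρ.le, ?_⟩
      rw [pow_zero, one_mul]
      exact h0
    | succ k ih =>
      obtain ⟨h1, h2, h3⟩ := ih
      obtain ⟨-, h4, h5, -⟩ := hstep t ht ht0 _ h2 h1
      obtain ⟨-, h6, h7⟩ := hy _ h2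
      refine ⟨h4, ?_, ?_⟩
      · rw [iter, h5]; exact h6
      · rw [iter, h5, pow_succ', mul_assoc]
        exact h7.trans (mul_le_mul_of_nonneg_left h3 (by positivity))
  -- The bound `C⁻¹` gives `C|t| < 1`, which makes the iterates converge to `x t`.
  refine ⟨min τ C⁻¹, C, K, x, by positivity, hC, K.2, fun t ht => ?_⟩
  have htτ : |t| < τ := ht.trans_le (min_le_left _ _)
  have htC : C * |t| < 1 := by
    rw [mul_comm, ← lt_div_iff₀ hC0, one_div]
    exact ht.trans_le (min_le_right _ _)
  obtain ⟨hxa, hxf, hxm, -, hy⟩ := hx t htτ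
  have hQ := (hy _ hxm).1
  have hstr : (x t).toState.Structured := by
    -- At `t = 0` the recursion would divide by zero, but there `x 0` is the initial state.
    rcases eq_or_ne t 0 with rfl | ht0
    · rw [hx0]; exact State.structured_initial hV B
    · have hlim : Filter.Tendsto (fun k => (iter V B t k).toParams) Filter.atTop (nhds (x t)) := by
        rw [tendsto_iff_norm_sub_tendsto_zero]
        refine squeeze_zero (fun _ => norm_nonneg _) (fun k => (hiter t htτ ht0 k).2.2) ?_
        simpa using (tendsto_pow_atTop_nhds_zero_of_lt_one (by positivity) htC).mul_const (C * |t|)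
      exact isClosed_structured.mem_of_tendsto hlim
        (Filter.Eventually.of_forall fun k => (hiter t htτ ht0 k).1)
  refine ⟨hxa, hQ.1.2.fun_comp (f := fun s => (s, x s)) (analyticAt_id.prod hxa), hstr, ?_,
    fun ht0 k => ?_⟩
  · rcases eq_or_ne t 0 with rfl | ht0
    · have h1 : ∀ M : Matrix (Fin n) (Fin n) ℝ, phaseBlock 0 M = 1 := fun M => by simp [phaseBlock]
      have h2 : ∀ M : Matrix (Fin n) (Fin n) ℝ, shearBlock 0 M = 1 := fun M => by simp [shearBlock]
      simp [splittingBlock, h1, h2]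
    · obtain ⟨hw, -, h5, hD⟩ := hstep t htτ ht0 (x t).toState hxm hstr
      have hfix : (x t).toState.step V B t = (x t).toState := by
        have h6 : ((x t).toState.step V B t).toParams = x t := h5.trans hxf.symm
        exact congrArg Params.toState h6
      have h7 := State.splittingBlock_eq_exp hB ht0 hw hfix (hQ.1.1.trans_le (min_le_left _ _))
      rw [hD] at h7
      exact h7
  · obtain ⟨h1, h2, h3⟩ := hiter t htτ ht0 k
    obtain ⟨hw, -, -, hD⟩ := hstep t htτ ht0 _ h2 h1
    refine ⟨hw, by rwa [norm_sub_rev], ?_⟩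
    have h4 := hK.norm_sub_le hQ.2 (hy _ h2).1.2
    have h5 : ‖((t, x t) : ℝ × Params n) - (t, (iter V B t k).toParams)‖
        = ‖x t - (iter V B t k).toParams‖ := by
      rw [Prod.mk_sub_mk, sub_self, Prod.norm_mk, norm_zero, max_eq_right (norm_nonneg _)]
    rw [h5] at h4
    rw [hD]
    exact h4

end

end ExactSplitting

/-! ### Assembly of the exact splitting and of the error estimate -/

theorem mainTheorem9 (n : ℕ) (hn : 1 ≤ n) (V B : Matrix (Fin n) (Fin n) ℝ)
    (hV : V.IsSymm) (hB : Bᵀ = -B) :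
    ∃ (t₀ : ℝ) (A L U Vl Vr : ℝ → Matrix (Fin n) (Fin n) ℝ),
      0 < t₀ ∧ ExactSplitting.IsExactSplitting V B t₀ A L U Vl Vr ∧
      ∃ τ₀ ∈ Set.Ioo 0 t₀, ∀ t : ℝ, 0 < |t| → |t| < τ₀ → ∀ k : ℕ,
        (ExactSplitting.iter V B t k).WellDefined t ∧
        ‖A t - (ExactSplitting.iter V B t k).A‖ + ‖L t - (ExactSplitting.iter V B t k).L‖
            + ‖U t - (ExactSplitting.iter V B t k).U‖
            + ‖Vl t + (1 / 2 : ℝ) • (ExactSplitting.iter V B t k).D t‖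
            + ‖Vr t - (ExactSplitting.iter V B t k).Vm
                - (1 / 2 : ℝ) • (ExactSplitting.iter V B t k).D t‖
          ≤ (|t| / τ₀) ^ k := by
  obtain ⟨t₀, C, K, x, ht₀, hC, hK, hx⟩ := ExactSplitting.exists_analytic_limit hV hB
  set d : ℝ → Matrix (Fin n) (Fin n) ℝ := fun t => ExactSplitting.diagRem (t, x t) with hd
  have hC0 : 0 < C := one_pos.trans_le hC
  have hx' := fun t (ht : t ∈ Set.Ioo (-t₀) t₀) => hx t (abs_lt.2 ht)
  have aA : AnalyticOnNhd ℝ (fun t => (x t).1) (Set.Ioo (-t₀) t₀) := fun t ht =>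
    analyticAt_fst.fun_comp (hx' t ht).1
  have aL : AnalyticOnNhd ℝ (fun t => (x t).2.1) (Set.Ioo (-t₀) t₀) := fun t ht =>
    analyticAt_fst.fun_comp (analyticAt_snd.fun_comp (hx' t ht).1)
  have aU : AnalyticOnNhd ℝ (fun t => (x t).2.2.1) (Set.Ioo (-t₀) t₀) := fun t ht =>
    analyticAt_fst.fun_comp (analyticAt_snd.fun_comp (analyticAt_snd.fun_comp (hx' t ht).1))
  have aVl : AnalyticOnNhd ℝ (fun t => -((1 / 2 : ℝ) • d t)) (Set.Ioo (-t₀) t₀) := fun t ht =>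
    ((hx' t ht).2.1.const_smul (c := (1 / 2 : ℝ))).neg
  have aVr : AnalyticOnNhd ℝ (fun t => (x t).2.2.2 + (1 / 2 : ℝ) • d t) (Set.Ioo (-t₀) t₀) :=
    fun t ht => (analyticAt_snd.fun_comp (analyticAt_snd.fun_comp
      (analyticAt_snd.fun_comp (hx' t ht).1))).add ((hx' t ht).2.1.const_smul (c := (1 / 2 : ℝ)))
  have hdiag : ∀ t, (d t).IsDiag := fun t => Matrix.isDiag_diagonal _
  have sVl : ∀ t, (-((1 / 2 : ℝ) • d t)).IsDiag := fun t => ((hdiag t).smul _).neg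
  have sVr : ∀ t ∈ Set.Ioo (-t₀) t₀, ((x t).2.2.2 + (1 / 2 : ℝ) • d t).IsSymm := fun t ht =>
    (hx' t ht).2.2.1.symm_Vm.add ((hdiag t).isSymm.smul _)
  refine ⟨t₀, fun t => (x t).1, fun t => (x t).2.1, fun t => (x t).2.2.1,
    fun t => -((1 / 2 : ℝ) • d t), fun t => (x t).2.2.2 + (1 / 2 : ℝ) • d t, ht₀,
    ⟨aA, aL, aU, aVl, aVr, fun t ht => (hx' t ht).2.2.1.symm_A,
      -- In `4 + K`, the four units come from `A`, `L`, `U` and `V⁽ᵐ⁾`, and `K` from the two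
      -- occurrences of `D/2`. Since the error after `k` steps is of order `(C|t|)^(k+1)`, its spare
      -- factor `C|t|` absorbs this constant when `|t| < (C(4 + K))⁻¹`.
      fun t ht => (hx' t ht).2.2.1.strictLower_L, fun t ht => (hx' t ht).2.2.1.strictUpper_U,
      fun t _ => sVl t, sVr, ?_⟩, min (t₀ / 2) (C * (4 + K))⁻¹,
      ⟨by positivity, (min_le_left _ _).trans_lt (half_lt_self ht₀)⟩, fun t ht0 ht k => ?_⟩
  · exact ExactSplitting.exists_group_eq_splittingOp hB ht₀
      (fun t ht => (aA t ht).differentiableAt) (fun t ht => (aL t ht).differentiableAt)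
      (fun t ht => (aU t ht).differentiableAt) (fun t ht => (aVl t ht).differentiableAt)
      (fun t ht => (aVr t ht).differentiableAt) (fun t ht => (hx' t ht).2.2.1.symm_A)
      (fun t ht i => (hx' t ht).2.2.1.strictLower_L i i le_rfl)
      (fun t ht i => (hx' t ht).2.2.1.strictUpper_U i i le_rfl) (fun t _ => (sVl t).isSymm) sVr
      (fun t ht => (hx' t ht).2.2.2.1)
  · have htt₀ : |t| < t₀ := (ht.trans_le (min_le_left _ _)).trans (half_lt_self ht₀)
    obtain ⟨hw, h1, h2⟩ := (hx t htt₀).2.2.2.2 (abs_pos.1 ht0) k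
    refine ⟨hw, ?_⟩
    set s := ExactSplitting.iter V B t k
    set e := ‖x t - s.toParams‖
    set τ₀ := min (t₀ / 2) (C * (4 + K))⁻¹
    have hτ₀ : 0 < τ₀ := by positivity
    have hA : ‖(x t).1 - s.A‖ ≤ e := norm_fst_le (x t - s.toParams)
    have h3 : ‖(x t - s.toParams).2‖ ≤ e := norm_snd_le _
    have hL : ‖(x t).2.1 - s.L‖ ≤ e := (norm_fst_le (x t - s.toParams).2).trans h3
    have h4 : ‖(x t - s.toParams).2.2‖ ≤ e := (norm_snd_le _).trans h3
    have hU : ‖(x t).2.2.1 - s.U‖ ≤ e := (norm_fst_le (x t - s.toParams).2.2).trans h4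
    have hVm : ‖(x t).2.2.2 - s.Vm‖ ≤ e := (norm_snd_le (x t - s.toParams).2.2).trans h4
    have hD : ‖(1 / 2 : ℝ) • (d t - s.D t)‖ ≤ 1 / 2 * (K * e) := by
      rw [norm_smul]
      norm_num
      exact h2
    have hl : ‖-((1 / 2 : ℝ) • d t) + (1 / 2 : ℝ) • s.D t‖ ≤ 1 / 2 * (K * e) := by
      rw [← norm_neg, neg_add, neg_neg, ← sub_eq_add_neg, ← smul_sub]
      exact hD
    have hr : ‖(x t).2.2.2 + (1 / 2 : ℝ) • d t - s.Vm - (1 / 2 : ℝ) • s.D t‖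
        ≤ e + 1 / 2 * (K * e) := by
      have h5 : (x t).2.2.2 + (1 / 2 : ℝ) • d t - s.Vm - (1 / 2 : ℝ) • s.D t
          = ((x t).2.2.2 - s.Vm) + (1 / 2 : ℝ) • (d t - s.D t) := by
        rw [smul_sub]; abel
      rw [h5]
      exact (norm_add_le _ _).trans (add_le_add hVm hD)
    have hCt : C * (4 + K) * |t| ≤ 1 := by
      rw [mul_comm, ← le_div_iff₀ (by positivity), one_div]
      exact (ht.trans_le (min_le_right _ _)).le
    have hCτ : C * |t| ≤ |t| / τ₀ := by
      rw [mul_comm, div_eq_mul_inv]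
      refine mul_le_mul_of_nonneg_left ?_ (abs_nonneg t)
      rw [le_inv_comm₀ hC0 hτ₀]
      refine (min_le_right _ _).trans (inv_anti₀ hC0 ?_)
      nlinarith
    calc _ ≤ (4 + K) * e := by linarith
      _ ≤ (4 + K) * ((C * |t|) ^ k * (C * |t|)) := by gcongr
      _ = (C * |t|) ^ k * (C * (4 + K) * |t|) := by ring
      _ ≤ (C * |t|) ^ k * 1 := by gcongr
      _ ≤ (|t| / τ₀) ^ k := by rw [mul_one]; gcongr
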